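/- Let $k$ be a field, $V$ a finite-dimensional $k$-vector space, $V^{(n)}=V^{\otimes n}$ (with $V^{(0)}=k$ and $V^{(n)}=0$ for $n<0$), and let $T(V)=\bigoplus_n V^{(n)}$ be the tensor algebra. Let $S\subseteq\mathbb{N}_{\ge 2}$ be a finite set and $R=\bigoplus_{s\in S}R_s$ with subspaces $R_s\subseteq V^{(s)}$ satisfying the minimality condition $$R_s\cap\sum_{t\in S,\ t<s}\ \sum_{j=0}^{s-t}V^{(j)}\otimes R_t\otimes V^{(s-t-j)}=0\qquad(s\in S),$$ and let $A=T(V)/\langle R\rangle$, graded with $V$ in degree $1$ (an $S$-multi-homogeneous algebra). For $s\in S$ and $l\ge 0$ put $n_s(2l)=sl$, $n_s(2l+1)=sl+1$; let $J_0=k$, $J_1=V$ and, for $i\ge2$, $$J_i=\bigoplus_{s\in S}J_i^s,\qquad J_i^s=\bigcap_{j=0}^{n_s(i)-s}V^{(j)}\otimes R_s\otimes V^{(n_s(i)-s-j)}\subseteq V^{(n_s(i))}.$$ The left multi-Koszul complex of $A$ is $K_i=A\otimes J_i$ ($i\ge 0$), augmented by $\varepsilon:A\to k$, where $\delta_1(\alpha\otimes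 v)=\alpha v$ and, for $i\ge2$, $\delta_i:A\otimes J_i\to A\otimes J_{i-1}$ is the restriction of $$\alpha\otimes v_1\cdots v_{n_s(i)}\mapsto \alpha v_1\cdots v_{p}\otimes v_{p+1}\cdots v_{n_s(i)},\qquad p=n_s(i)-n_s(i-1)\quad(s\in S)$$ (so $p=s-1$ if $i$ is even and $p=1$ if $i$ is odd). The right multi-Koszul complex $K_i'=J_i\otimes A$ is defined symmetrically, by cutting off the last $p$ letters and multiplying them into $A$. The algebra $A$ is left (resp. right) multi-Koszul if its augmented left (resp. right) multi-Koszul complex is a projective resolution of the trivial left (resp. right) module $k$; the two conditions are equivalent, and $A$ is then called multi-Koszul. Let $\mathcal{E}xt_A^i(k,k)=H^i(\mathcal{H}om_A(P_\bullet,k))$, where $P_\bullet\to k$ is a projective resolution of the trivial left module $k$ by $\mathbb{Z}$-graded left $A$-modules (such a resolution exists) and $\mathcal{H}om_A(N,k)=\bigoplus_{d\in\mathbb{Z}}\hom_A(N,k[d])$, with $\hom_A$ the degree-preserving $A$-linear maps and $k[d]_n=k_{n+d}$; and let $J_i^{\#}$ be the graded dual, with $(J_i^{\#})_n=((J_i)_{-n})^*$.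 Then, for any choice of the graded projective resolution $P_\bullet$, the following are equivalent: (i) $A$ is multi-Koszul (left, or equivalently right); (ii) for every $i\ge0$ there is an isomorphism of graded vector spaces $\mathcal{E}xt_A^i(k,k)\cong J_i^{\#}$. -/

import Mathlib

open scoped TensorProduct

universe u v w

noncomputable section

namespace MultiKoszul

/-- `V^{(n)}`, the subspace of the tensor algebra `T(V)` spanned by the words of length `n`.
Inside `T(V)`, the tensor product `X ⊗ Y` of two subspaces consisting of homogeneous tensors
is the product `X * Y`, since concatenation identifies `V^{(m)} ⊗ V^{(n)}` with `V^{(m+n)}`. -/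
abbrev word (k : Type u) (V : Type v) [Field k] [AddCommGroup V] [Module k V] (n : ℕ) :
    Submodule k (TensorAlgebra k V) :=
  LinearMap.range (TensorAlgebra.ι k (M := V)) ^ n

/-- The grading of `T(V)` by `ℤ`, with the convention `V^{(n)} = 0` for `n < 0`. -/
def wordZ (k : Type u) (V : Type v) [Field k] [AddCommGroup V] [Module k V] (n : ℤ) :
    Submodule k (TensorAlgebra k V) :=
  if 0 ≤ n then word k V n.toNat else ⊥

/-- A minimal space of relations `R = ⨁_{s ∈ S} R_s` with `R_s ⊆ V^{(s)}`, for a finite set `S` of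
integers `≥ 2`. Minimality says that no nonzero element of `R_s` lies in the ideal generated by the
relations of the other degrees; for degree reasons only the degrees `t < s` matter. Values of `R`
outside `S` play no role. -/
structure Relations (k : Type u) (V : Type v) [Field k] [AddCommGroup V] [Module k V] where
  S : Finset ℕ
  two_le : ∀ s ∈ S, 2 ≤ s
  R : ℕ → Submodule k (TensorAlgebra k V)
  le_word : ∀ s ∈ S, R s ≤ word k V s
  minimal : ∀ s ∈ S, Disjoint (R s)
    (⨆ t ∈ S, ⨆ (_ : t < s), ⨆ j ∈ Finset.range (s - t + 1),
      word k V j * R t * word k V (s - t - j))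

/-- The quotient `Z/B` of subspaces `B ⊆ Z` of a vector space (in general, `Z/(Z ∩ B)`). -/
def Subquotient {k : Type u} {M : Type w} [Field k] [AddCommGroup M] [Module k M]
    (Z B : Submodule k M) : Type w :=
  Z ⧸ B.submoduleOf Z

instance {k : Type u} {M : Type w} [Field k] [AddCommGroup M] [Module k M] (Z B : Submodule k M) :
    AddCommGroup (Subquotient Z B) :=
  inferInstanceAs (AddCommGroup (Z ⧸ B.submoduleOf Z))

instance {k : Type u} {M : Type w} [Field k] [AddCommGroup M] [Module k M] (Z B : Submodule k M) :
    Module k (Subquotient Z B) :=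
  inferInstanceAs (Module k (Z ⧸ B.submoduleOf Z))

/-! ### Cutting words -/

/-- One step of the recursion for `cut`: given `v` and the family `p ↦ cut p x`, the family
`p ↦ cut p (v x)`. -/
def cutStep (k : Type u) (V : Type v) [Field k] [AddCommGroup V] [Module k V] :
    V →ₗ[k] Module.End k (ℕ → TensorAlgebra k V ⊗[k] TensorAlgebra k V) where
  toFun x := LinearMap.pi fun p => match p with
    | 0 => (LinearMap.mulLeft k ((1 : TensorAlgebra k V) ⊗ₜ[k] TensorAlgebra.ι k x)).comp
        (LinearMap.proj 0)
    | p + 1 => (LinearMap.mulLeft k (TensorAlgebra.ι k x ⊗ₜ[k] (1 : TensorAlgebra k V))).comp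
        (LinearMap.proj p)
  map_add' x y := by
    ext f p
    cases p <;> simp [TensorProduct.tmul_add, TensorProduct.add_tmul, add_mul]
  map_smul' c x := by
    ext f p
    cases p <;> simp [TensorProduct.tmul_smul, ← TensorProduct.smul_tmul']

/-- The linear map `T(V) → T(V) ⊗ T(V)` which cuts a word after its first `p` letters:
`v₁ ⋯ vₙ ↦ v₁ ⋯ v_p ⊗ v_{p+1} ⋯ vₙ` if `p ≤ n`, and `0` if `n < p`. -/
def cut (k : Type u) (V : Type v) [Field k] [AddCommGroup V] [Module k V] (p : ℕ) :
    TensorAlgebra k V →ₗ[k] TensorAlgebra k V ⊗[k] TensorAlgebra k V :=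
  (LinearMap.proj p).comp <|
    (LinearMap.applyₗ (Pi.single (0 : ℕ) (1 : TensorAlgebra k V ⊗[k] TensorAlgebra k V))).comp
      (TensorAlgebra.lift k (cutStep k V)).toLinearMap

section cutLemmas

variable {k : Type u} {V : Type v} [Field k] [AddCommGroup V] [Module k V]

theorem cut_zero_one : cut k V 0 1 = 1 := by
  simp [cut]

theorem cut_succ_one (p : ℕ) : cut k V (p + 1) 1 = 0 := by
  simp [cut]

theorem cut_zero_ι_mul (x : V) (a : TensorAlgebra k V) :
    cut k V 0 (TensorAlgebra.ι k x * a) = (1 ⊗ₜ[k] TensorAlgebra.ι k x) * cut k V 0 a := by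
  simp [cut, cutStep]

theorem cut_succ_ι_mul (p : ℕ) (x : V) (a : TensorAlgebra k V) :
    cut k V (p + 1) (TensorAlgebra.ι k x * a) = (TensorAlgebra.ι k x ⊗ₜ[k] 1) * cut k V p a := by
  simp [cut, cutStep]

end cutLemmas

namespace Relations

variable {k : Type u} {V : Type v} [Field k] [AddCommGroup V] [Module k V] (D : Relations k V)

/-! ### The algebra -/

/-- The two-sided ideal of `T(V)` generated by `R`. -/
def ideal : TwoSidedIdeal (TensorAlgebra k V) :=
  TwoSidedIdeal.span (⋃ s ∈ D.S, (D.R s : Set (TensorAlgebra k V)))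

/-- The `S`-multi-homogeneous algebra `A = T(V)/⟨R⟩`. -/
abbrev Alg : Type (max u v) := D.ideal.ringCon.Quotient

/-- The canonical projection `T(V) → A`. -/
def π : TensorAlgebra k V →ₐ[k] D.Alg := D.ideal.ringCon.mkₐ k

/-- The homogeneous component `A_n`, the image of `V^{(n)}`. -/
def algDeg (n : ℕ) : Submodule k D.Alg := (word k V n).map D.π.toLinearMap

theorem algebraMapInv_word_succ (n : ℕ) {x : TensorAlgebra k V} (hx : x ∈ word k V (n + 1)) :
    TensorAlgebra.algebraMapInv x = (0 : k) := by
  rw [word, pow_succ'] at hx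
  refine Submodule.mul_induction_on hx ?_ ?_
  · rintro _ ⟨y, rfl⟩ b _
    simp [TensorAlgebra.algebraMapInv]
  · intro a b ha hb
    rw [map_add, ha, hb, add_zero]

theorem ideal_le_ker :
    D.ideal ≤ TwoSidedIdeal.ker (TensorAlgebra.algebraMapInv (R := k) (M := V)) := by
  refine TwoSidedIdeal.span_le.2 fun x hx => ?_
  simp only [Set.mem_iUnion, SetLike.mem_coe] at hx
  obtain ⟨s, hs, hx⟩ := hx
  obtain ⟨n, rfl⟩ : ∃ n, s = n + 1 := ⟨s - 1, by have := D.two_le s hs; omega⟩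
  exact (TwoSidedIdeal.mem_ker _).2 (algebraMapInv_word_succ n (D.le_word _ hs hx))

/-- The augmentation `ε : A → k`, which kills `A_n` for `n > 0`. The trivial module `k` is `k` with
`A` acting through `ε`. -/
def ε : D.Alg →ₐ[k] k :=
  D.ideal.ringCon.liftₐ TensorAlgebra.algebraMapInv fun x y h => by
    have h1 : x - y ∈ D.ideal := (TwoSidedIdeal.rel_iff _ _ _).1 h
    have h2 := (TwoSidedIdeal.mem_ker _).1 (D.ideal_le_ker h1)
    rw [map_sub, sub_eq_zero] at h2
    exact h2

/-! ### The spaces `J_i` -/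

/-- `n_s(2l) = s l` and `n_s(2l+1) = s l + 1`. -/
def nn (s i : ℕ) : ℕ := s * (i / 2) + i % 2

/-- `J_i^s = ⋂_{j=0}^{n_s(i)-s} V^{(j)} ⊗ R_s ⊗ V^{(n_s(i)-s-j)}`, for `i ≥ 2`. -/
def Js (s i : ℕ) : Submodule k (TensorAlgebra k V) :=
  ⨅ j ∈ Finset.range (nn s i - s + 1), word k V j * D.R s * word k V (nn s i - s - j)

/-- `J_0 = k`, `J_1 = V` and `J_i = ⨁_{s ∈ S} J_i^s` for `i ≥ 2`. The last sum is direct inside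
`T(V)` because `J_i^s ⊆ V^{(n_s(i))}` and, for `i ≥ 2`, the numbers `n_s(i)` are distinct. -/
def J (i : ℕ) : Submodule k (TensorAlgebra k V) :=
  if i < 2 then word k V i else ⨆ s ∈ D.S, D.Js s i

/-- The homogeneous component of degree `n` of the graded space `J_i`. -/
def Jdeg (i : ℕ) (n : ℤ) : Submodule k (TensorAlgebra k V) := D.J i ⊓ wordZ k V n

/-- The homogeneous component of degree `n` of the graded dual `J_i^#`, which is
`((J_i)_{-n})^*`. -/
abbrev JdualDeg (i : ℕ) (n : ℤ) : Type _ := Module.Dual k (D.Jdeg i (-n))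

/-! ### The left and right multi-Koszul complexes -/

/-- The map defined on the subspace `⨁_{s ∈ S} V^{(n_s(i))}` (on `V` if `i = 1`) which cuts words of
length `n_s(i)` after their first `n_s(i) - n_s(i-1)` letters, that is after `s - 1` letters if `i`
is even and after one letter if `i` is odd. -/
def cutLeft (i : ℕ) : TensorAlgebra k V →ₗ[k] TensorAlgebra k V ⊗[k] TensorAlgebra k V :=
  if i = 1 then cut k V 1
  else ∑ s ∈ D.S, (cut k V (nn s i - nn s (i - 1))).comp
    (GradedAlgebra.proj (fun n : ℕ => LinearMap.range (TensorAlgebra.ι k (M := V)) ^ n) (nn s i))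

/-- The map defined on the subspace `⨁_{s ∈ S} V^{(n_s(i))}` (on `V` if `i = 1`) which cuts words of
length `n_s(i)` after their first `n_s(i-1)` letters, that is before their last `s - 1` letters if
`i` is even and before their last letter if `i` is odd. -/
def cutRight (i : ℕ) : TensorAlgebra k V →ₗ[k] TensorAlgebra k V ⊗[k] TensorAlgebra k V :=
  if i = 1 then cut k V 0
  else ∑ s ∈ D.S, (cut k V (nn s (i - 1))).comp
    (GradedAlgebra.proj (fun n : ℕ => LinearMap.range (TensorAlgebra.ι k (M := V)) ^ n) (nn s i))

/-- `α ⊗ w ↦ ∑ α w' ⊗ w''` where `∑ w' ⊗ w''` is `cutLeft i w`. -/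
def δLeft (i : ℕ) : D.Alg ⊗[k] TensorAlgebra k V →ₗ[k] D.Alg ⊗[k] TensorAlgebra k V :=
  (LinearMap.rTensor _ (LinearMap.mul' k D.Alg)).comp <|
    (TensorProduct.assoc k D.Alg D.Alg (TensorAlgebra k V)).symm.toLinearMap.comp <|
      LinearMap.lTensor _ ((LinearMap.rTensor _ D.π.toLinearMap).comp (D.cutLeft i))

/-- `w ⊗ α ↦ ∑ w' ⊗ w'' α` where `∑ w' ⊗ w''` is `cutRight i w`. -/
def δRight (i : ℕ) : TensorAlgebra k V ⊗[k] D.Alg →ₗ[k] TensorAlgebra k V ⊗[k] D.Alg :=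
  (LinearMap.lTensor _ (LinearMap.mul' k D.Alg)).comp <|
    (TensorProduct.assoc k (TensorAlgebra k V) D.Alg D.Alg).toLinearMap.comp <|
      LinearMap.rTensor _ ((LinearMap.lTensor _ D.π.toLinearMap).comp (D.cutRight i))

/-- `K(A)_i = A ⊗ J_i`, as a subspace of `A ⊗ T(V)`. It is a free left `A`-module. -/
def KLeft (i : ℕ) : Submodule k (D.Alg ⊗[k] TensorAlgebra k V) :=
  LinearMap.range (LinearMap.lTensor D.Alg (D.J i).subtype)

/-- `K(A)'_i = J_i ⊗ A`, as a subspace of `T(V) ⊗ A`. It is a free right `A`-module. -/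
def KRight (i : ℕ) : Submodule k (TensorAlgebra k V ⊗[k] D.Alg) :=
  LinearMap.range (LinearMap.rTensor D.Alg (D.J i).subtype)

/-- On `K(A)_0 = A ⊗ k` this is the augmentation `α ⊗ c ↦ ε(α) c`. -/
def augLeft : D.Alg ⊗[k] TensorAlgebra k V →ₗ[k] k :=
  (LinearMap.mul' k k).comp
    (TensorProduct.map D.ε.toLinearMap TensorAlgebra.algebraMapInv.toLinearMap)

/-- On `K(A)'_0 = k ⊗ A` this is the augmentation `c ⊗ α ↦ c ε(α)`. -/
def augRight : TensorAlgebra k V ⊗[k] D.Alg →ₗ[k] k :=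
  (LinearMap.mul' k k).comp
    (TensorProduct.map TensorAlgebra.algebraMapInv.toLinearMap D.ε.toLinearMap)

/-- `A` is left multi-Koszul: the augmented left multi-Koszul complex
`⋯ → A ⊗ J_2 → A ⊗ J_1 → A ⊗ J_0 → k → 0` is a resolution of `k` (its terms are automatically
free). -/
structure IsLeftMultiKoszul : Prop where
  aug_surjective : (D.KLeft 0).map D.augLeft = ⊤
  exact_zero : (D.KLeft 1).map (D.δLeft 1) = D.KLeft 0 ⊓ LinearMap.ker D.augLeft
  exact_succ : ∀ i,
    (D.KLeft (i + 2)).map (D.δLeft (i + 2)) = D.KLeft (i + 1) ⊓ LinearMap.ker (D.δLeft (i + 1))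

/-- `A` is right multi-Koszul: the augmented right multi-Koszul complex
`⋯ → J_2 ⊗ A → J_1 ⊗ A → J_0 ⊗ A → k → 0` is a resolution of `k` (its terms are automatically
free). -/
structure IsRightMultiKoszul : Prop where
  aug_surjective : (D.KRight 0).map D.augRight = ⊤
  exact_zero : (D.KRight 1).map (D.δRight 1) = D.KRight 0 ⊓ LinearMap.ker D.augRight
  exact_succ : ∀ i,
    (D.KRight (i + 2)).map (D.δRight (i + 2)) = D.KRight (i + 1) ⊓ LinearMap.ker (D.δRight (i + 1))

/-! ### Graded projective resolutions and `𝓔xt` -/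

/-- The graded vector space `k`, concentrated in degree `0`. -/
def trivDeg (k : Type u) [Field k] (n : ℤ) : Submodule k k := if n = 0 then ⊤ else ⊥

/-- A projective resolution `⋯ → P_1 → P_0 → k → 0` of the trivial left `A`-module `k` in the
category of `ℤ`-graded left `A`-modules (a graded module is projective there if and only if the
underlying module is projective). An `A`-linear map to `k` is a map semilinear along `ε`. -/
structure GradedProjRes where
  P : ℕ → Type w
  [addCommGroup : ∀ i, AddCommGroup (P i)]
  [module : ∀ i, Module D.Alg (P i)]
  deg : ∀ i, ℤ → AddSubgroup (P i)
  isInternal : ∀ i, DirectSum.IsInternal (deg i)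
  smul_mem : ∀ (i m : ℕ) (n : ℤ), ∀ a ∈ D.algDeg m, ∀ x ∈ deg i n, a • x ∈ deg i (m + n)
  projective : ∀ i, Module.Projective D.Alg (P i)
  d : ∀ i, P (i + 1) →ₗ[D.Alg] P i
  d_mem : ∀ (i : ℕ) (n : ℤ), ∀ x ∈ deg (i + 1) n, d i x ∈ deg i n
  aug : P 0 →ₛₗ[D.ε.toRingHom] k
  aug_mem : ∀ (n : ℤ), ∀ x ∈ deg 0 n, aug x ∈ trivDeg k n
  aug_surjective : Function.Surjective aug
  exact_zero : Function.Exact (d 0) aug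
  exact_succ : ∀ i, Function.Exact (d (i + 1)) (d i)

attribute [instance] GradedProjRes.addCommGroup GradedProjRes.module

namespace GradedProjRes

variable {D} (Q : GradedProjRes.{u, v, w} D)

/-- `hom_A(P_i, k[n])`, the component of degree `n` of `𝓗om_A(P_i, k)`: the `A`-linear maps
`P_i → k` sending `(P_i)_m` to `k[n]_m = k_{m+n}` for all `m`. -/
def homDeg (i : ℕ) (n : ℤ) : Submodule k (Q.P i →ₛₗ[D.ε.toRingHom] k) where
  carrier := {f | ∀ (m : ℤ), ∀ x ∈ Q.deg i m, f x ∈ trivDeg k (m + n)}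
  add_mem' hf hg m x hx := add_mem (hf m x hx) (hg m x hx)
  zero_mem' _ _ _ := zero_mem _
  smul_mem' c _ hf m x hx := Submodule.smul_mem _ c (hf m x hx)

/-- The differential `f ↦ f ∘ d` from maps on `P_i` to maps on `P_{i+1}`. -/
def dual (i : ℕ) :
    (Q.P i →ₛₗ[D.ε.toRingHom] k) →ₗ[k] (Q.P (i + 1) →ₛₗ[D.ε.toRingHom] k) where
  toFun f := f.comp (Q.d i)
  map_add' _ _ := rfl
  map_smul' _ _ := rfl

/-- The cocycles of degree `n` in `𝓗om_A(P_i, k)`. -/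
def cocycles (i : ℕ) (n : ℤ) : Submodule k (Q.P i →ₛₗ[D.ε.toRingHom] k) :=
  Q.homDeg i n ⊓ LinearMap.ker (Q.dual i)

/-- The coboundaries of degree `n` in `𝓗om_A(P_i, k)`. -/
def coboundaries : (i : ℕ) → (n : ℤ) → Submodule k (Q.P i →ₛₗ[D.ε.toRingHom] k)
  | 0, _ => ⊥
  | i + 1, n => (Q.homDeg i n).map (Q.dual i)

/-- The component of degree `n` of `𝓔xt_A^i(k,k) = H^i(𝓗om_A(P_•, k))`. -/
abbrev ExtDeg (i : ℕ) (n : ℤ) : Type _ :=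
  Subquotient (Q.cocycles i n) (Q.coboundaries i n)

end GradedProjRes

end Relations

end MultiKoszul

end

universe w'

noncomputable section

namespace MultiKoszul

/-! ### Subquotients -/

/-! The left complex is studied through its cycles. For a graded projective resolution with cycles
`Z_i ⊆ P_i`, dimension shifting gives `Ext^{i+1}(k,k)` as the maps `Z_i → k` modulo those extending
to `P_i`. This quotient is the same for all complexes of graded projectives over `k` that are exact
below `i`; exactness at `i` is not needed (`GrComplex.nonempty_homQuot_equiv`). It can therefore be
computed from a multi-Koszul complex known to be exact only below `i`.

The multi-Koszul complex is minimal: every cycle of `K_i` lies in `A_+ K_i` (`p_mem_posPart`). Maps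
from `K_i` to `k` thus vanish on cycles, and `Ext^{i+1}(k,k)` in degree `n` is the dual of the
degree `-n` part of `Z_i / A_+ Z_i`. The differential induces a map from `J_{i+1}` to `Z_i / A_+
Z_i` (`kosβDeg`). It is injective in degree `d` as soon as the complex is exact at `i` in all
degrees below `d`. Both this and minimality rest on `eq_zero_of_δLeft_mem`: no nonzero `1 ⊗ j` has
the same boundary as an element of `A_+ ⊗ J_{i+1}`. That is where the minimality of the space of
relations enters.

If the complex is exact, the map is also surjective, and dualizing gives (ii). Conversely, assume
(ii) and induct on `i`, then on the degree `d`: the map is injective between spaces whose duals are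
isomorphic and finite-dimensional, hence surjective, and so every cycle of degree `d` is a boundary
(`ZL_le_BL`).

The right complex is the left complex of the algebra with reversed relations (`op`), so it remains
to see that reversal changes neither `J_i` nor Ext up to isomorphism. For Ext, let `T = T(V)`, with
augmentation ideal `T_+` and ideal of relations `I`. The Gruenberg resolution with terms `L_i / I
L_i`, where `L_i` runs through `T, T_+, I, I T_+, I^2, …`, both shows that resolutions exist and
identifies `Ext^{i+1}` with the graded dual of `(L_{i+1} ∩ T_+ L_i) / (T_+ L_{i+1} + L_{i+2})`,
Govorov's formula for Tor. In terms of `I` and `T_+` this expression is left-right symmetric, so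
reversal of words carries it to the one for the opposite relations (`revSub_govZ`, `revSub_govB`).
-/

theorem nonempty_subquotient_equiv {k : Type u} [Field k] {M : Type*} {M' : Type*}
    [AddCommGroup M] [Module k M] [AddCommGroup M'] [Module k M'] (g : M →ₗ[k] M')
    {Z B : Submodule k M} {Z' B' : Submodule k M'} (hZ : ∀ z ∈ Z, g z ∈ Z')
    (hsurj : ∀ z' ∈ Z', ∃ z ∈ Z, z' - g z ∈ B') (hB : ∀ z ∈ Z, g z ∈ B' ↔ z ∈ B) :
    Nonempty (Subquotient Z B ≃ₗ[k] Subquotient Z' B') := by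
  let f : Z →ₗ[k] Z' := g.restrict hZ
  have hle : B.submoduleOf Z ≤ (B'.submoduleOf Z').comap f := fun z hz => (hB z z.2).2 hz
  refine ⟨LinearEquiv.ofBijective ((B.submoduleOf Z).mapQ (B'.submoduleOf Z') f hle) ⟨?_, ?_⟩⟩
  · rw [injective_iff_map_eq_zero]
    intro x
    induction x using Submodule.Quotient.induction_on with
    | H z =>
      intro h
      rw [Submodule.mapQ_apply, Submodule.Quotient.mk_eq_zero] at h
      exact (Submodule.Quotient.mk_eq_zero _).2 ((hB z z.2).1 h)
  · intro y
    induction y using Submodule.Quotient.induction_on with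
    | H z' =>
      obtain ⟨z, hz, h⟩ := hsurj z' z'.2
      refine ⟨Submodule.Quotient.mk ⟨z, hz⟩, ?_⟩
      rw [Submodule.mapQ_apply, eq_comm, Submodule.Quotient.eq]
      exact h

/-! ### Homogeneous components -/

section comp

variable {M : Type w} [AddCommGroup M] {deg : ℤ → AddSubgroup M}

/-- The projection onto the homogeneous component of degree `n`. -/
def comp (h : DirectSum.IsInternal deg) (n : ℤ) : M →+ M :=
  letI := h.chooseDecomposition
  { toFun x := DirectSum.decompose deg x n
    map_zero' := by simp
    map_add' := by simp }

variable (h : DirectSum.IsInternal deg)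

theorem comp_mem (n : ℤ) (x : M) : comp h n x ∈ deg n := by
  let := h.chooseDecomposition
  exact (DirectSum.decompose deg x n).2

theorem comp_of_mem {n : ℤ} {x : M} (hx : x ∈ deg n) : comp h n x = x := by
  let := h.chooseDecomposition
  exact DirectSum.decompose_of_mem_same deg hx

theorem comp_of_mem_ne {m n : ℤ} {x : M} (hx : x ∈ deg m) (hmn : m ≠ n) : comp h n x = 0 := by
  let := h.chooseDecomposition
  exact DirectSum.decompose_of_mem_ne deg hx hmn

include h in
theorem internal_induction {p : M → Prop} (h0 : p 0) (hadd : ∀ x y, p x → p y → p (x + y))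
    (hdeg : ∀ n, ∀ x ∈ deg n, p x) (x : M) : p x := by
  let := h.chooseDecomposition
  exact DirectSum.Decomposition.inductionOn deg h0 (fun m => hdeg _ m m.2) hadd x

theorem comp_map {M' : Type w'} [AddCommGroup M'] {deg' : ℤ → AddSubgroup M'}
    (h' : DirectSum.IsInternal deg') (f : M →+ M') (hf : ∀ n, ∀ x ∈ deg n, f x ∈ deg' n)
    (n : ℤ) (x : M) : comp h' n (f x) = f (comp h n x) := by
  induction x using internal_induction h with
  | h0 => simp
  | hadd x y hx hy => simp [hx, hy]
  | hdeg m x hx =>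
    by_cases hmn : m = n
    · subst hmn
      rw [comp_of_mem h hx, comp_of_mem h' (hf _ _ hx)]
    · rw [comp_of_mem_ne h hx hmn, comp_of_mem_ne h' (hf _ _ hx) hmn, map_zero]

include h in
/-- An additive map is determined by its values on homogeneous elements, and can be prescribed
there. -/
theorem exists_addMonoidHom_of_components {M' : Type w'} [AddCommGroup M'] (f : ℤ → M →+ M') :
    ∃ g : M →+ M', ∀ n, ∀ x ∈ deg n, g x = f n x := by
  let := h.chooseDecomposition
  refine ⟨(DirectSum.toAddMonoid fun n => (f n).comp (deg n).subtype).comp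
    (DirectSum.decomposeAddEquiv deg).toAddMonoidHom, fun n x hx => ?_⟩
  simp [DirectSum.decompose_of_mem deg hx]

end comp

namespace Relations

theorem trivDeg_ne {k : Type u} [Field k] {n : ℤ} (hn : n ≠ 0) {x : k} (hx : x ∈ trivDeg k n) :
    x = 0 := by
  simpa [trivDeg, hn] using hx

theorem mem_trivDeg_zero {k : Type u} [Field k] {n : ℤ} (hn : n = 0) (x : k) :
    x ∈ trivDeg k n := by
  simp [trivDeg, hn]

variable {k : Type u} {V : Type v} [Field k] [AddCommGroup V] [Module k V] (D : Relations k V)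

theorem iSup_word : (⨆ n, word k V n) = ⊤ := by
  rw [eq_top_iff]
  intro x _
  induction x using TensorAlgebra.induction with
  | algebraMap r =>
    refine Submodule.mem_iSup_of_mem 0 ?_
    rw [word, pow_zero]
    exact Submodule.algebraMap_mem r
  | ι x =>
    refine Submodule.mem_iSup_of_mem 1 ?_
    rw [word, pow_one]
    exact ⟨x, rfl⟩
  | mul a b ha hb =>
    replace ha := ha trivial
    replace hb := hb trivial
    have := Submodule.mul_mem_mul ha hb
    rw [Submodule.iSup_mul] at this
    simp only [Submodule.mul_iSup] at this
    refine (iSup_le fun i => iSup_le fun j => ?_ : _ ≤ (⨆ n, word k V n)) this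
    rw [word, word, ← pow_add]
    exact le_iSup (fun n => word k V n) (i + j)
  | add a b ha hb => exact add_mem (ha trivial) (hb trivial)

theorem π_surjective : Function.Surjective D.π := D.ideal.ringCon.mkₐ_surjective

theorem iSup_algDeg : (⨆ n, D.algDeg n) = ⊤ := by
  simp only [algDeg, ← Submodule.map_iSup, iSup_word]
  rw [Submodule.map_top, LinearMap.range_eq_top]
  exact D.π_surjective

theorem alg_induction {p : D.Alg → Prop} (h0 : p 0) (hadd : ∀ x y, p x → p y → p (x + y))
    (hdeg : ∀ n, ∀ a ∈ D.algDeg n, p a) (a : D.Alg) : p a := by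
  have ha : a ∈ ⨆ n, D.algDeg n := D.iSup_algDeg ▸ trivial
  exact Submodule.iSup_induction _ (motive := p) ha hdeg h0 hadd

theorem ε_π (x : TensorAlgebra k V) : D.ε (D.π x) = TensorAlgebra.algebraMapInv x := rfl

/-! ### Graded modules and degree-preserving lifts -/

section graded

variable {D}
variable {M : Type w} [AddCommGroup M] [Module D.Alg M] {deg : ℤ → AddSubgroup M}
variable {M' : Type w'} [AddCommGroup M'] [Module D.Alg M'] {deg' : ℤ → AddSubgroup M'}

theorem comp_smul (h : DirectSum.IsInternal deg)
    (hs : ∀ (m : ℕ) (n : ℤ), ∀ a ∈ D.algDeg m, ∀ x ∈ deg n, a • x ∈ deg (m + n))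
    {m : ℕ} {a : D.Alg} (ha : a ∈ D.algDeg m) (n : ℤ) (x : M) :
    comp h (m + n) (a • x) = a • comp h n x := by
  induction x using internal_induction h with
  | h0 => simp
  | hadd x y hx hy => simp [hx, hy]
  | hdeg l x hx =>
    by_cases hln : l = n
    · subst hln
      rw [comp_of_mem h hx, comp_of_mem h (hs _ _ a ha x hx)]
    · rw [comp_of_mem_ne h hx hln, comp_of_mem_ne h (hs _ _ a ha x hx) (by omega), smul_zero]

/-- An `A`-linear map need not respect degrees. Keeping only the degree `n` component of its value
at each element of degree `n` leaves it `A`-linear, since by `comp_smul` homogeneous scalars shift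
components and these scalars span `A`. -/
theorem exists_degree_zero_part (h : DirectSum.IsInternal deg) (h' : DirectSum.IsInternal deg')
    (hs : ∀ (m : ℕ) (n : ℤ), ∀ a ∈ D.algDeg m, ∀ x ∈ deg n, a • x ∈ deg (m + n))
    (hs' : ∀ (m : ℕ) (n : ℤ), ∀ a ∈ D.algDeg m, ∀ x ∈ deg' n, a • x ∈ deg' (m + n))
    (φ : M →ₗ[D.Alg] M') :
    ∃ f : M →ₗ[D.Alg] M', ∀ n, ∀ x ∈ deg n, f x = comp h' n (φ x) := by
  obtain ⟨g, hg⟩ := exists_addMonoidHom_of_components h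
    fun n => (comp h' n).comp φ.toAddMonoidHom
  refine ⟨{ toFun := g, map_add' := map_add g, map_smul' := fun a x => ?_ }, hg⟩
  induction x using internal_induction h with
  | h0 => simp
  | hadd x y hx hy => simp only [smul_add, map_add, hx, hy]
  | hdeg n x hx =>
    induction a using D.alg_induction with
    | h0 => simp
    | hadd a b ha hb => simp only [add_smul, map_add, ha, hb]
    | hdeg m a ha =>
      rw [hg _ _ (hs m n a ha x hx), hg _ _ hx]
      simp only [AddMonoidHom.comp_apply, LinearMap.toAddMonoidHom_coe, map_smul]
      exact comp_smul h' hs' ha n _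

/-- An ordinary lift exists by projectivity, and its degree-preserving part is still a lift. `N`
carries no grading; `hc` supplies what is needed instead, that the degree `n` component of a
preimage of `f x` is again a preimage when `x` has degree `n`. -/
theorem exists_graded_lift {N : Type*} [AddCommGroup N] [Module D.Alg N]
    [Module.Projective D.Alg M]
    (h : DirectSum.IsInternal deg) (h' : DirectSum.IsInternal deg')
    (hs : ∀ (m : ℕ) (n : ℤ), ∀ a ∈ D.algDeg m, ∀ x ∈ deg n, a • x ∈ deg (m + n))
    (hs' : ∀ (m : ℕ) (n : ℤ), ∀ a ∈ D.algDeg m, ∀ x ∈ deg' n, a • x ∈ deg' (m + n))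
    (g : M' →ₗ[D.Alg] N) (f : M →ₗ[D.Alg] N) (hfg : ∀ x, ∃ y, g y = f x)
    (hc : ∀ n, ∀ x ∈ deg n, ∀ y, g y = f x → g (comp h' n y) = f x) :
    ∃ F : M →ₗ[D.Alg] M', (∀ n, ∀ x ∈ deg n, F x ∈ deg' n) ∧ ∀ x, g (F x) = f x := by
  obtain ⟨φ, hφ⟩ := Module.projective_lifting_property g.rangeRestrict
    (f.codRestrict (LinearMap.range g) fun x => LinearMap.mem_range.2 (hfg x))
    g.surjective_rangeRestrict
  have hφ' : ∀ x, g (φ x) = f x := fun x => congrArg Subtype.val (LinearMap.congr_fun hφ x)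
  obtain ⟨F, hF⟩ := exists_degree_zero_part h h' hs hs' φ
  refine ⟨F, fun n x hx => hF n x hx ▸ comp_mem h' n _, fun x => ?_⟩
  induction x using internal_induction h with
  | h0 => simp
  | hadd x y hx hy => simp only [map_add, hx, hy]
  | hdeg n x hx => rw [hF n x hx, hc n x hx _ (hφ' x)]

end graded

/-! ### Complexes of graded projective modules -/

/-- A complex `⋯ → P_1 → P_0 → k → 0` of graded projective left `A`-modules, with surjective
augmentation, not necessarily exact elsewhere. -/
structure GrComplex where
  P : ℕ → Type w
  [addCommGroup : ∀ i, AddCommGroup (P i)]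
  [module : ∀ i, Module D.Alg (P i)]
  deg : ∀ i, ℤ → AddSubgroup (P i)
  isInternal : ∀ i, DirectSum.IsInternal (deg i)
  smul_mem : ∀ (i m : ℕ) (n : ℤ), ∀ a ∈ D.algDeg m, ∀ x ∈ deg i n, a • x ∈ deg i (m + n)
  projective : ∀ i, Module.Projective D.Alg (P i)
  d : ∀ i, P (i + 1) →ₗ[D.Alg] P i
  d_mem : ∀ (i : ℕ) (n : ℤ), ∀ x ∈ deg (i + 1) n, d i x ∈ deg i n
  aug : P 0 →ₛₗ[D.ε.toRingHom] k
  aug_mem : ∀ (n : ℤ), ∀ x ∈ deg 0 n, aug x ∈ trivDeg k n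
  aug_surjective : Function.Surjective aug
  aug_d : ∀ x, aug (d 0 x) = 0
  d_d : ∀ i x, d i (d (i + 1) x) = 0

attribute [instance] GrComplex.addCommGroup GrComplex.module

/-- A graded projective resolution, with its exactness forgotten. -/
def GradedProjRes.toGrComplex {D : Relations k V} (Q : GradedProjRes.{u, v, w} D) :
    GrComplex.{u, v, w} D where
  P := Q.P
  deg := Q.deg
  isInternal := Q.isInternal
  smul_mem := Q.smul_mem
  projective := Q.projective
  d := Q.d
  d_mem := Q.d_mem
  aug := Q.aug
  aug_mem := Q.aug_mem
  aug_surjective := Q.aug_surjective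
  aug_d x := (Q.exact_zero _).2 ⟨x, rfl⟩
  d_d i x := (Q.exact_succ i _).2 ⟨x, rfl⟩

/-- The `A`-linear maps `M → k` sending `M_m` to `k[n]_m` for all `m`. -/
def homTo {D : Relations k V} {M : Type w} [AddCommGroup M] [Module D.Alg M]
    (deg : ℤ → AddSubgroup M) (n : ℤ) : Submodule k (M →ₛₗ[D.ε.toRingHom] k) where
  carrier := {f | ∀ (m : ℤ), ∀ x ∈ deg m, f x ∈ trivDeg k (m + n)}
  add_mem' hf hg m x hx := add_mem (hf m x hx) (hg m x hx)
  zero_mem' _ _ _ := zero_mem _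
  smul_mem' c _ hf m x hx := Submodule.smul_mem _ c (hf m x hx)

/-- The grading induced on a submodule. -/
def subDeg {D : Relations k V} {M : Type w} [AddCommGroup M] [Module D.Alg M]
    (deg : ℤ → AddSubgroup M) (Z : Submodule D.Alg M) (n : ℤ) : AddSubgroup Z :=
  (deg n).comap Z.subtype.toAddMonoidHom

/-- Precomposition with an `A`-linear map. -/
def precomp {D : Relations k V} {M : Type w} [AddCommGroup M] [Module D.Alg M]
    {M' : Type w'} [AddCommGroup M'] [Module D.Alg M'] (f : M →ₗ[D.Alg] M') :
    (M' →ₛₗ[D.ε.toRingHom] k) →ₗ[k] (M →ₛₗ[D.ε.toRingHom] k) where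
  toFun g := g.comp f
  map_add' _ _ := rfl
  map_smul' _ _ := rfl

/-- The degree `n` part of `𝓗om_A(Z, k)` modulo the restrictions of elements of `𝓗om_A(M, k)`. -/
abbrev HomQuot {D : Relations k V} {M : Type w} [AddCommGroup M] [Module D.Alg M]
    (deg : ℤ → AddSubgroup M) (Z : Submodule D.Alg M) (n : ℤ) : Type _ :=
  Subquotient (homTo (subDeg deg Z) n) ((homTo deg n).map (precomp Z.subtype))

namespace GrComplex

variable {D}
variable (X : GrComplex.{u, v, w} D) (Y : GrComplex.{u, v, w'} D)

/-- The cycles: the kernel of the augmentation in `P_0`, that of the differential in `P_{i+1}`. -/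
def syz : ∀ i, Submodule D.Alg (X.P i)
  | 0 => LinearMap.ker X.aug
  | i + 1 => LinearMap.ker (X.d i)

theorem d_mem_syz : ∀ i x, X.d i x ∈ X.syz i
  | 0, x => X.aug_d x
  | i + 1, x => X.d_d i x

/-- Exactness at `P_i`. -/
def ExactAt (i : ℕ) : Prop := ∀ x ∈ X.syz i, ∃ y, X.d i y = x

variable {X Y}

/-- Degree-preserving maps. -/
def IsGraded {i j : ℕ} (f : X.P i →ₗ[D.Alg] Y.P j) : Prop :=
  ∀ n, ∀ x ∈ X.deg i n, f x ∈ Y.deg j n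

variable (X Y) in
/-- `f` is the component in degree `i` of a (partial) chain map over the identity of `k`. -/
def Lifts : ∀ i, (X.P i →ₗ[D.Alg] Y.P i) → Prop
  | 0, f => ∀ x, Y.aug (f x) = X.aug x
  | i + 1, f => ∃ f', IsGraded f' ∧ Lifts i f' ∧ ∀ x, Y.d i (f x) = f' (X.d i x)

theorem Lifts.map_syz : ∀ {i} {f : X.P i →ₗ[D.Alg] Y.P i}, Lifts X Y i f →
    ∀ x ∈ X.syz i, f x ∈ Y.syz i
  | 0, f, hf, x, hx => (hf x).trans hx
  | i + 1, f, ⟨f', _, _, h⟩, x, hx => by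
    have hx' : X.d i x = 0 := hx
    change Y.d i (f x) = 0
    rw [h, hx', map_zero]

theorem exists_graded_lift_d {i j : ℕ} (f : X.P i →ₗ[D.Alg] Y.P j) (hf : IsGraded f)
    (hr : ∀ x, ∃ y, Y.d j y = f x) :
    ∃ F : X.P i →ₗ[D.Alg] Y.P (j + 1), IsGraded F ∧ ∀ x, Y.d j (F x) = f x := by
  have := X.projective i
  refine exists_graded_lift (X.isInternal i) (Y.isInternal (j + 1)) (X.smul_mem i)
    (Y.smul_mem (j + 1)) (Y.d j) f hr fun n x hx y hy => ?_
  have := comp_map (Y.isInternal (j + 1)) (Y.isInternal j) (Y.d j).toAddMonoidHom (Y.d_mem j) n y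
  simp only [LinearMap.toAddMonoidHom_coe] at this
  rw [← this, hy, comp_of_mem _ (hf n x hx)]

/-- The trivial module. -/
def Triv (_ : Relations k V) : Type u := k

instance : AddCommGroup (Triv D) := inferInstanceAs (AddCommGroup k)

instance : Module D.Alg (Triv D) := Module.compHom k D.ε.toRingHom

variable (X) in
/-- The augmentation as an `A`-linear map. -/
def augTriv : X.P 0 →ₗ[D.Alg] Triv D where
  toFun := X.aug
  map_add' := map_add X.aug
  map_smul' a x := X.aug.map_smulₛₗ a x

theorem exists_lifts_zero : ∃ f : X.P 0 →ₗ[D.Alg] Y.P 0, IsGraded f ∧ Lifts X Y 0 f := by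
  have := X.projective 0
  refine exists_graded_lift (X.isInternal 0) (Y.isInternal 0) (X.smul_mem 0) (Y.smul_mem 0)
    Y.augTriv X.augTriv (fun x => Y.aug_surjective _) fun n x hx y hy => ?_
  change Y.aug _ = X.aug x
  replace hy : Y.aug y = X.aug x := hy
  by_cases hn : n = 0
  · subst hn
    rw [← hy]
    clear hy
    induction y using internal_induction (Y.isInternal 0) with
    | h0 => simp
    | hadd y z hy hz => simp only [map_add, hy, hz]
    | hdeg n y hy =>
      by_cases hn : n = 0
      · subst hn
        rw [comp_of_mem _ hy]
      · rw [comp_of_mem_ne _ hy hn, map_zero, trivDeg_ne hn (Y.aug_mem n y hy)]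
  · rw [trivDeg_ne hn (X.aug_mem n x hx), trivDeg_ne hn (Y.aug_mem n _ (comp_mem _ n y))]

theorem exists_lifts : ∀ (m : ℕ), (∀ j < m, Y.ExactAt j) →
    ∃ f : X.P m →ₗ[D.Alg] Y.P m, IsGraded f ∧ Lifts X Y m f
  | 0, _ => exists_lifts_zero
  | m + 1, hY => by
    obtain ⟨f, hf, hl⟩ := exists_lifts m fun j hj => hY j (hj.trans (Nat.lt_succ_self m))
    obtain ⟨F, hF, h⟩ := exists_graded_lift_d (f.comp (X.d m))
      (fun n x hx => hf n _ (X.d_mem m n x hx))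
      fun x => hY m (Nat.lt_succ_self m) _ (hl.map_syz _ (X.d_mem_syz m x))
    exact ⟨F, hF, f, hf, hl, h⟩

theorem IsGraded.sub {i j : ℕ} {f f' : X.P i →ₗ[D.Alg] Y.P j} (hf : IsGraded f)
    (hf' : IsGraded f') : IsGraded (f - f') :=
  fun n x hx => sub_mem (hf n x hx) (hf' n x hx)

/-- The usual chain homotopy, stopped one step early: as `Y` need not be exact at `m`, the last
homotopy `P_m → P_{m+1}` is not available. The difference corrected by the previous homotopy, `f -
f' - s d`, still takes values in cycles, and on cycles of `X` the term `s d` vanishes. -/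
theorem Lifts.sub_eq : ∀ {m : ℕ} {f f' : X.P m →ₗ[D.Alg] Y.P m}, (∀ j < m, Y.ExactAt j) →
    Lifts X Y m f → Lifts X Y m f' → IsGraded f → IsGraded f' →
    ∃ φ : X.P m →ₗ[D.Alg] Y.P m, IsGraded φ ∧ (∀ x, φ x ∈ Y.syz m) ∧
      ∀ x ∈ X.syz m, f x - f' x = φ x
  | 0, f, f', _, hl, hl', hf, hf' => by
    refine ⟨f - f', hf.sub hf', fun x => ?_, fun x _ => rfl⟩
    change Y.aug (f x - f' x) = 0
    rw [map_sub, hl x, hl' x, sub_self]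
  | m + 1, f, f', hY, ⟨g, hg, hgl, h⟩, ⟨g', hg', hgl', h'⟩, hf, hf' => by
    obtain ⟨φ, hφ, hφs, hφe⟩ := Lifts.sub_eq (fun j hj => hY j (hj.trans (Nat.lt_succ_self m)))
      hgl hgl' hg hg'
    obtain ⟨s, hs, hsd⟩ := exists_graded_lift_d φ hφ
      fun x => hY m (Nat.lt_succ_self m) _ (hφs x)
    refine ⟨f - f' - s.comp (X.d m), (hf.sub hf').sub fun n x hx => hs n _ (X.d_mem m n x hx),
      fun x => ?_, fun x hx => ?_⟩
    · change Y.d m (f x - f' x - s (X.d m x)) = 0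
      rw [map_sub, map_sub, h, h', hsd, hφe _ (X.d_mem_syz m x), sub_self]
    · have hx' : X.d m x = 0 := hx
      simp [hx']

theorem lifts_id : ∀ m, Lifts X X m LinearMap.id
  | 0 => fun _ => rfl
  | m + 1 => ⟨LinearMap.id, fun _ _ h => h, lifts_id m, fun _ => rfl⟩

theorem Lifts.comp {Z : GrComplex D} : ∀ {m : ℕ} {f : X.P m →ₗ[D.Alg] Y.P m}
    {g : Y.P m →ₗ[D.Alg] Z.P m}, Lifts X Y m f → Lifts Y Z m g → Lifts X Z m (g.comp f)
  | 0, f, g, hf, hg => fun x => (hg _).trans (hf x)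
  | m + 1, f, g, ⟨f', hf', hl, h⟩, ⟨g', hg', hl', h'⟩ =>
    ⟨g'.comp f', fun n x hx => hg' n _ (hf' n x hx), Lifts.comp hl hl', fun x => by
      simp [h, h']⟩

/-- Going back and forth changes a functional on cycles only by one defined on all of `P_m`, namely
`h ∘ φ` with `φ` from `Lifts.sub_eq`. So the two comparison maps are mutually inverse on `HomQuot`.
-/
theorem comp_sub_id_mem {m : ℕ} (hX : ∀ j < m, X.ExactAt j) {f : X.P m →ₗ[D.Alg] Y.P m}
    {g : Y.P m →ₗ[D.Alg] X.P m} (hf : IsGraded f) (hg : IsGraded g) (hlf : Lifts X Y m f)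
    (hlg : Lifts Y X m g) (n : ℤ) (h : X.syz m →ₛₗ[D.ε.toRingHom] k)
    (hh : h ∈ homTo (D := D) (subDeg (X.deg m) (X.syz m)) n) :
    ∃ c ∈ homTo (D := D) (X.deg m) n, ∀ x (hx : x ∈ X.syz m),
      h ⟨g (f x), hlg.map_syz _ (hlf.map_syz _ hx)⟩ = h ⟨x, hx⟩ + c x := by
  obtain ⟨φ, hφ, hφs, hφe⟩ := Lifts.sub_eq hX (hlf.comp hlg) (lifts_id m)
    (fun n x hx => hg n _ (hf n x hx)) (fun n x hx => hx)
  refine ⟨h.comp (φ.codRestrict _ hφs), fun j x hx => hh j _ (hφ j x hx), fun x hx => ?_⟩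
  change _ = _ + h ⟨φ x, _⟩
  rw [← map_add]
  congr 1
  ext
  simp [← hφe x hx]

/-- `𝓗om_A(syz_m, k)` modulo restrictions from `P_m` does not depend on the complex, as long as it
is exact below `m`. -/
theorem nonempty_homQuot_equiv (m : ℕ) (hX : ∀ j < m, X.ExactAt j) (hY : ∀ j < m, Y.ExactAt j)
    (n : ℤ) :
    Nonempty (HomQuot (X.deg m) (X.syz m) n ≃ₗ[k] HomQuot (Y.deg m) (Y.syz m) n) := by
  obtain ⟨f, hf, hlf⟩ := exists_lifts (X := X) m hY
  obtain ⟨g, hg, hlg⟩ := exists_lifts (X := Y) m hX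
  let fZ : X.syz m →ₗ[D.Alg] Y.syz m := f.restrict hlf.map_syz
  let gZ : Y.syz m →ₗ[D.Alg] X.syz m := g.restrict hlg.map_syz
  refine nonempty_subquotient_equiv (precomp gZ) (fun h hh j x hx => hh j _ (hg j _ hx)) ?_ ?_
  · intro h hh
    refine ⟨precomp fZ h, fun j x hx => hh j _ (hf j _ hx), ?_⟩
    obtain ⟨c, hc, hce⟩ := comp_sub_id_mem hY hg hf hlg hlf n h hh
    refine ⟨-c, neg_mem hc, ?_⟩
    ext ⟨x, hx⟩
    have := hce x hx
    change -c x = h ⟨x, hx⟩ - h ⟨f (g x), _⟩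
    rw [this]
    ring
  · intro h hh
    constructor
    · rintro ⟨c, hc, hce⟩
      obtain ⟨c', hc', hce'⟩ := comp_sub_id_mem hX hf hg hlf hlg n h hh
      refine ⟨precomp f c - c', sub_mem (fun j x hx => hc j _ (hf j x hx)) hc', ?_⟩
      ext ⟨x, hx⟩
      have h1 := hce' x hx
      have h2 : c (f x) = h ⟨g (f x), _⟩ :=
        LinearMap.congr_fun hce (⟨f x, hlf.map_syz _ hx⟩ : Y.syz m)
      change c (f x) - c' x = h ⟨x, hx⟩
      rw [h2, h1]
      ring
    · rintro ⟨c, hc, rfl⟩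
      exact ⟨precomp g c, fun j x hx => hc j _ (hg j x hx), rfl⟩

end GrComplex

/-! ### Ext as functionals on syzygies -/

namespace GradedProjRes

variable {D} (Q : GradedProjRes.{u, v, w} D)

theorem exactAt : ∀ i, Q.toGrComplex.ExactAt i
  | 0 => fun x hx => (Q.exact_zero x).1 hx
  | i + 1 => fun x hx => (Q.exact_succ i x).1 hx

/-- A cocycle on `P_{i+1}` kills the image of the next differential, which is the kernel of `d i`,
so it factors through the image of `d i`, that is, through the cycles in `P_i`. It is a coboundary
exactly when the factored map extends to `P_i`. -/
theorem nonempty_extDeg_succ_equiv (i : ℕ) (n : ℤ) :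
    Nonempty (HomQuot (Q.deg i) (Q.toGrComplex.syz i) n ≃ₗ[k] Q.ExtDeg (i + 1) n) := by
  let dZ : Q.P (i + 1) →ₗ[D.Alg] Q.toGrComplex.syz i :=
    (Q.d i).codRestrict (Q.toGrComplex.syz i) (Q.toGrComplex.d_mem_syz i)
  have hdZ : Function.Surjective dZ := fun ⟨x, hx⟩ => by
    obtain ⟨y, hy⟩ := Q.exactAt i x hx
    exact ⟨y, Subtype.ext hy⟩
  refine nonempty_subquotient_equiv (precomp dZ) ?_ ?_ ?_
  · intro h hh
    refine ⟨fun j x hx => hh j _ (Q.d_mem i j x hx), ?_⟩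
    refine LinearMap.mem_ker.2 (LinearMap.ext fun x => ?_)
    change h (dZ (Q.d (i + 1) x)) = 0
    have : dZ (Q.d (i + 1) x) = 0 := Subtype.ext (Q.toGrComplex.d_d i x)
    rw [this, map_zero]
  · rintro c ⟨hc, hcd⟩
    have hker : ∀ x y, dZ x = dZ y → c x = c y := fun x y hxy => by
      have : Q.d i (x - y) = 0 := by
        rw [map_sub, sub_eq_zero]
        exact congrArg Subtype.val hxy
      obtain ⟨z, hz⟩ := Q.exactAt (i + 1) (x - y) this
      rw [← sub_eq_zero, ← map_sub, ← hz]
      exact LinearMap.congr_fun hcd z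
    -- A set-theoretic section suffices: `c` is constant on the fibres of `dZ`, so `c ∘ s` is linear
    -- although `s` need not be.
    let s := Function.surjInv hdZ
    have hs : ∀ x, c (s (dZ x)) = c x := fun x => hker _ _ (Function.surjInv_eq hdZ _)
    let h : Q.toGrComplex.syz i →ₛₗ[D.ε.toRingHom] k :=
      { toFun z := c (s z)
        map_add' z z' := by
          obtain ⟨x, rfl⟩ := hdZ z
          obtain ⟨x', rfl⟩ := hdZ z'
          rw [← map_add, hs, hs, hs, map_add]
        map_smul' a z := by
          obtain ⟨x, rfl⟩ := hdZ z
          rw [← map_smul, hs, hs, LinearMap.map_smulₛₗ] }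
    refine ⟨h, fun j z hz => ?_, ?_⟩
    · obtain ⟨x, rfl⟩ := hdZ z
      -- The preimage `x` of the homogeneous `z` may be replaced by its component of degree `j`, to
      -- which the degree condition on `c` applies.
      have h1 : dZ (comp (Q.isInternal (i + 1)) j x) = dZ x := by
        refine Subtype.ext ?_
        have := comp_map (Q.isInternal (i + 1)) (Q.isInternal i) (Q.d i).toAddMonoidHom
          (Q.d_mem i) j x
        exact this.symm.trans (comp_of_mem _ hz)
      change c (s (dZ x)) ∈ _
      rw [← h1, hs]
      exact hc j _ (comp_mem _ j x)
    · have : c - precomp dZ h = 0 := by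
        ext x
        change c x - c (s (dZ x)) = 0
        rw [hs, sub_self]
      rw [this]
      exact zero_mem _
  · intro h hh
    constructor
    · rintro ⟨c, hc, hce⟩
      refine ⟨c, hc, DFunLike.ext _ _ fun z => ?_⟩
      obtain ⟨x, rfl⟩ := hdZ z
      exact LinearMap.congr_fun hce x
    · rintro ⟨c, hc, rfl⟩
      exact ⟨c, hc, rfl⟩

/-- A map on `P_0` killing the image of `d 0`, which is the kernel of the augmentation, is a scalar
multiple of the augmentation. -/
theorem extDeg_zero_eq (n : ℤ) :
    Nonempty (Q.ExtDeg 0 n ≃ₗ[k] Subquotient (trivDeg k n) (⊥ : Submodule k k)) := by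
  let g : k →ₗ[k] (Q.P 0 →ₛₗ[D.ε.toRingHom] k) :=
    { toFun c := c • Q.aug
      map_add' c c' := add_smul c c' _
      map_smul' c c' := mul_smul c c' _ }
  refine (nonempty_subquotient_equiv g ?_ ?_ ?_).map LinearEquiv.symm
  · intro c hc
    refine ⟨fun m x hx => ?_, ?_⟩
    · by_cases hn : n = 0
      · subst hn
        rw [add_zero]
        exact Submodule.smul_mem _ c (Q.aug_mem m x hx)
      · rw [trivDeg_ne hn hc]
        exact (map_zero g).symm ▸ zero_mem (trivDeg k (m + n))
    · refine LinearMap.mem_ker.2 (LinearMap.ext fun x => ?_)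
      change c • Q.aug (Q.d 0 x) = 0
      rw [(Q.exact_zero _).2 ⟨x, rfl⟩, smul_zero]
  · rintro f ⟨hf, hfd⟩
    obtain ⟨x, hx⟩ := Q.aug_surjective 1
    have h0 : comp (Q.isInternal 0) 0 x ∈ Q.deg 0 0 := comp_mem _ _ _
    have hx0 : Q.aug (comp (Q.isInternal 0) 0 x) = 1 := by
      rw [← hx]
      clear hx h0
      induction x using internal_induction (Q.isInternal 0) with
      | h0 => simp
      | hadd y z hy hz => simp only [map_add, hy, hz]
      | hdeg n y hy =>
        by_cases hn : n = 0
        · subst hn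
          rw [comp_of_mem _ hy]
        · rw [comp_of_mem_ne _ hy hn, map_zero, trivDeg_ne hn (Q.aug_mem n y hy)]
    generalize comp (Q.isInternal 0) 0 x = y at h0 hx0
    refine ⟨f y, by simpa using hf 0 y h0, ?_⟩
    have : f - g (f y) = 0 := by
      ext z
      -- Here `y` has degree `0` and augmentation `1`, so subtracting this multiple of `y` from `z`
      -- lands in the kernel of the augmentation, where `f` vanishes.
      have hz : Q.aug (z - algebraMap k D.Alg (Q.aug z) • y) = 0 := by
        rw [map_sub, LinearMap.map_smulₛₗ, hx0]
        simp
      obtain ⟨t, ht⟩ := (Q.exact_zero _).1 hz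
      have h1 : f (Q.d 0 t) = 0 := LinearMap.congr_fun hfd t
      rw [ht, map_sub, LinearMap.map_smulₛₗ, sub_eq_zero] at h1
      change f z - f y • Q.aug z = 0
      rw [h1]
      simp [mul_comm]
    rw [this]
    exact zero_mem _
  · intro c _
    change c • Q.aug ∈ (⊥ : Submodule k _) ↔ _
    rw [Submodule.mem_bot, Submodule.mem_bot]
    constructor
    · intro h
      obtain ⟨x, hx⟩ := Q.aug_surjective 1
      have h1 : c • Q.aug x = 0 := LinearMap.congr_fun h x
      rw [hx] at h1
      simpa using h1
    · rintro rfl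
      exact zero_smul _ _

end GradedProjRes

end Relations

/-- Restrict a functional on `U` that kills `BU` to the preimage of `BM`. Every functional there
extends to `U`, so restriction is onto. Its kernel consists of the functionals vanishing on the
kernel of `U → M / BM`, and these are the ones pulled back from `M / BM`. -/
theorem nonempty_subquotient_dualAnnihilator_equiv {k : Type u} [Field k] {U : Type*} {M : Type*}
    [AddCommGroup U] [Module k U] [AddCommGroup M] [Module k M] (u : U →ₗ[k] M)
    {BU : Submodule k U} {BM : Submodule k M} (hle : BU ≤ BM.comap u) :
    Nonempty (Subquotient BU.dualAnnihilator (BM.dualAnnihilator.map u.dualMap) ≃ₗ[k]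
      Module.Dual k (Subquotient (BM.comap u) BU)) := by
  let Ψ : BU.dualAnnihilator →ₗ[k] Module.Dual k (BM.comap u ⧸ BU.submoduleOf (BM.comap u)) :=
    { toFun h := (BU.submoduleOf (BM.comap u)).liftQ (h.1.comp (BM.comap u).subtype)
        fun x hx => (Submodule.mem_dualAnnihilator _).1 h.2 x hx
      map_add' h h' := Submodule.linearMap_qext _ rfl
      map_smul' c h := Submodule.linearMap_qext _ rfl }
  have hsurj : Function.Surjective Ψ := by
    intro l
    obtain ⟨f, hf⟩ := LinearMap.exists_extend (l.comp (BU.submoduleOf (BM.comap u)).mkQ)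
    have hf' : ∀ x : BM.comap u, f x = l (Submodule.Quotient.mk x) := LinearMap.congr_fun hf
    refine ⟨⟨f, (Submodule.mem_dualAnnihilator _).2 fun x hx => ?_⟩,
      Submodule.linearMap_qext _ (LinearMap.ext hf')⟩
    have hx' : (⟨x, hle hx⟩ : BM.comap u) ∈ BU.submoduleOf (BM.comap u) := hx
    rw [hf' ⟨x, hle hx⟩, (Submodule.Quotient.mk_eq_zero _).2 hx', map_zero]
  have hker : (BM.dualAnnihilator.map u.dualMap).submoduleOf BU.dualAnnihilator =
      LinearMap.ker Ψ := by
    ext ⟨h, hh⟩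
    constructor
    · rintro ⟨c, hc, hce⟩
      refine Submodule.linearMap_qext _ (LinearMap.ext fun x => ?_)
      have h1 : c (u x) = h x := LinearMap.congr_fun hce (x : U)
      change h x = 0
      rw [← h1]
      exact (Submodule.mem_dualAnnihilator _).1 hc _ x.2
    · intro h0
      have hq : h ∈ LinearMap.range (BM.mkQ.comp u).dualMap := by
        rw [LinearMap.range_dualMap_eq_dualAnnihilator_ker, Submodule.mem_dualAnnihilator]
        intro x hx
        have hx' : x ∈ BM.comap u := by
          rw [LinearMap.mem_ker, LinearMap.comp_apply, Submodule.mkQ_apply,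
            Submodule.Quotient.mk_eq_zero] at hx
          exact hx
        exact LinearMap.congr_fun (LinearMap.mem_ker.1 h0) (Submodule.Quotient.mk ⟨x, hx'⟩)
      obtain ⟨f, hf⟩ := hq
      refine ⟨f.comp BM.mkQ, (Submodule.mem_dualAnnihilator _).2 fun x hx => ?_, hf⟩
      rw [LinearMap.comp_apply, Submodule.mkQ_apply, (Submodule.Quotient.mk_eq_zero _).2 hx,
        map_zero]
  exact ⟨(Submodule.quotEquivOfEq _ _ hker).trans (Ψ.quotKerEquivOfSurjective hsurj)⟩

namespace Relations

variable {k : Type u} {V : Type v} [Field k] [AddCommGroup V] [Module k V] {D : Relations k V}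

/-! ### Maps to the trivial module as linear functionals -/

/-- The subspace on which all elements of `homTo deg n` vanish: it is spanned by `A_+ M` and the
homogeneous elements whose degree is not `-n`. -/
def bad (D : Relations k V) {M : Type w} [AddCommGroup M] [Module D.Alg M] [Module k M]
    (deg : ℤ → AddSubgroup M) (n : ℤ) : Submodule k M :=
  Submodule.span k ({y | ∃ a : D.Alg, D.ε a = 0 ∧ ∃ x : M, y = a • x} ∪
    {x | ∃ m, m ≠ -n ∧ x ∈ deg m})

section duality

variable {M : Type w} [AddCommGroup M] [Module D.Alg M] [Module k M]
variable (deg : ℤ → AddSubgroup M) (n : ℤ)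

theorem smul_mem_bad {a : D.Alg} (ha : D.ε a = 0) (x : M) : a • x ∈ bad D deg n :=
  Submodule.subset_span (Or.inl ⟨a, ha, x, rfl⟩)

theorem mem_bad_of_mem_deg {m : ℤ} (hm : m ≠ -n) {x : M} (hx : x ∈ deg m) : x ∈ bad D deg n :=
  Submodule.subset_span (Or.inr ⟨m, hm, hx⟩)

theorem bad_le {N : Submodule k M} (h1 : ∀ a : D.Alg, D.ε a = 0 → ∀ x : M, a • x ∈ N)
    (h2 : ∀ m, m ≠ -n → ∀ x ∈ deg m, x ∈ N) : bad D deg n ≤ N := by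
  refine Submodule.span_le.2 ?_
  rintro x (⟨a, ha, x, rfl⟩ | ⟨m, hm, hx⟩)
  · exact h1 a ha x
  · exact h2 m hm x hx

variable [IsScalarTower k D.Alg M]

/-- An `A`-linear map to the trivial module as a `k`-linear functional. -/
def toFunctional : (M →ₛₗ[D.ε.toRingHom] k) →ₗ[k] Module.Dual k M where
  toFun h :=
    { toFun := h
      map_add' := map_add h
      map_smul' c x := by
        rw [← algebraMap_smul D.Alg c x, LinearMap.map_smulₛₗ]
        simp }
  map_add' _ _ := rfl
  map_smul' _ _ := rfl

variable {deg n} in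
theorem eq_zero_of_mem_bad {h : M →ₛₗ[D.ε.toRingHom] k} (hh : h ∈ homTo deg n) {x : M}
    (hx : x ∈ bad D deg n) : h x = 0 := by
  have : bad D deg n ≤ LinearMap.ker (toFunctional h) := by
    refine bad_le deg n (fun a ha x => ?_) fun m hm x hx => ?_
    · change h (a • x) = 0
      rw [LinearMap.map_smulₛₗ]
      change D.ε a • h x = 0
      rw [ha, zero_smul]
    · exact trivDeg_ne (by omega) (hh m x hx)
  exact this hx

variable {deg n} in
theorem exists_homTo {f : Module.Dual k M} (hf : ∀ x ∈ bad D deg n, f x = 0) :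
    ∃ h ∈ homTo (D := D) deg n, ∀ x, h x = f x := by
  refine ⟨{ toFun := f, map_add' := map_add f, map_smul' := fun a x => ?_ }, fun m x hx => ?_,
    fun _ => rfl⟩
  -- Since `a - ε(a)` has augmentation zero, `f` kills its multiples, which is exactly `A`-linearity
  -- for the trivial action.
  · have h1 := hf _ (smul_mem_bad deg n (a := a - algebraMap k D.Alg (D.ε a)) (by simp) x)
    rw [sub_smul, map_sub, sub_eq_zero] at h1
    rw [h1, algebraMap_smul, map_smul]
    rfl
  · change f x ∈ _
    by_cases hm : m + n = 0
    · exact mem_trivDeg_zero hm _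
    · rw [hf x (mem_bad_of_mem_deg deg n (by omega) hx)]
      exact zero_mem _

variable (Z : Submodule D.Alg M)

theorem bad_subDeg_le : bad D (subDeg deg Z) n ≤
    (bad D deg n).comap (Z.subtype.restrictScalars k) := by
  refine bad_le _ n (fun a ha x => ?_) fun m hm x hx => ?_
  · exact smul_mem_bad deg n ha (x : M)
  · exact mem_bad_of_mem_deg deg n hm hx

/-- Maps to `k` of degree `n` are the linear functionals that kill `bad`, on `Z` as on `M`, so
linear duality applies. For `Z` the cycles of a resolution, the space dualized is the degree `-n`
part of `(Z ∩ A_+ M) / A_+ Z`, that is, of Tor. -/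
theorem nonempty_homQuot_equiv_dual :
    Nonempty (HomQuot deg Z n ≃ₗ[k] Module.Dual k
      (Subquotient ((bad D deg n).comap (Z.subtype.restrictScalars k))
        (bad D (subDeg deg Z) n))) := by
  obtain ⟨e⟩ := nonempty_subquotient_dualAnnihilator_equiv (Z.subtype.restrictScalars k)
    (bad_subDeg_le deg n Z)
  have hres : ∀ (h : Z →ₛₗ[D.ε.toRingHom] k) (f : Module.Dual k M),
      (∀ x : Z, f x = h x) → f ∈ (bad D deg n).dualAnnihilator →
      ∃ c ∈ homTo (D := D) deg n, precomp Z.subtype c = h := fun h f hf hfb => by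
    obtain ⟨c, hc, hcf⟩ := exists_homTo (deg := deg) (n := n)
      ((Submodule.mem_dualAnnihilator f).1 hfb)
    refine ⟨c, hc, ?_⟩
    refine DFunLike.ext _ _ fun x => ?_
    exact (hcf x).trans (hf x)
  refine (nonempty_subquotient_equiv toFunctional ?_ ?_ ?_).map fun e' => e'.trans e
  · exact fun h hh => (Submodule.mem_dualAnnihilator _).2 fun x hx => eq_zero_of_mem_bad hh hx
  · intro f hf
    obtain ⟨h, hh, hhf⟩ := exists_homTo (deg := subDeg deg Z) (n := n)
      ((Submodule.mem_dualAnnihilator f).1 hf)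
    refine ⟨h, hh, ?_⟩
    have : f - toFunctional h = 0 := by
      refine LinearMap.ext fun x => ?_
      exact sub_eq_zero.2 (hhf x).symm
    rw [this]
    exact zero_mem _
  · intro h hh
    constructor
    · rintro ⟨f, hf, hfh⟩
      exact hres h f (LinearMap.congr_fun hfh) hf
    · rintro ⟨c, hc, rfl⟩
      exact ⟨toFunctional c, (Submodule.mem_dualAnnihilator _).2
        fun x hx => eq_zero_of_mem_bad hc hx, rfl⟩

end duality

end Relations

/-! ### Vector spaces graded by the natural numbers -/

/-- A grading of a vector space by `ℕ`, given by its components and the projections onto them. -/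
structure NatGrading (k : Type u) (M : Type w) [Field k] [AddCommGroup M] [Module k M] where
  G : ℕ → Submodule k M
  p : ℕ → M →ₗ[k] M
  p_same : ∀ n, ∀ x ∈ G n, p n x = x
  p_ne : ∀ m n, m ≠ n → ∀ x ∈ G m, p n x = 0
  iSup_G : ⨆ n, G n = ⊤

namespace NatGrading

variable {k : Type u} {M : Type w} [Field k] [AddCommGroup M] [Module k M] (g : NatGrading k M)

theorem induction {P : M → Prop} (h0 : P 0) (hadd : ∀ x y, P x → P y → P (x + y))
    (hG : ∀ n, ∀ x ∈ g.G n, P x) (x : M) : P x :=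
  Submodule.iSup_induction _ (motive := P) (g.iSup_G ▸ trivial : x ∈ ⨆ n, g.G n) hG h0 hadd

theorem p_mem (n : ℕ) (x : M) : g.p n x ∈ g.G n := by
  induction x using g.induction with
  | h0 => simp
  | hadd x y hx hy => rw [map_add]; exact add_mem hx hy
  | hG m x hx =>
    by_cases h : m = n
    · subst h
      rwa [g.p_same m x hx]
    · rw [g.p_ne m n h x hx]
      exact zero_mem _

/-- Each element is the finite sum of its components; the proof carries a finite support along to
make sense of this sum. -/
theorem mem_of_p_mem {N : Submodule k M} {x : M} (h : ∀ n, g.p n x ∈ N) : x ∈ N := by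
  suffices ∀ x : M, x ∈ ⨆ n, Submodule.span k {g.p n x} by
    refine (iSup_le fun n => ?_ : (⨆ n, Submodule.span k {g.p n x}) ≤ N) (this x)
    rw [Submodule.span_singleton_le_iff_mem]
    exact h n
  intro x
  have hfin : ∃ s : Finset ℕ, x = ∑ n ∈ s, g.p n x ∧ ∀ n ∉ s, g.p n x = 0 := by
    induction x using g.induction with
    | h0 => exact ⟨∅, by simp⟩
    | hadd x y hx hy =>
      obtain ⟨s, hs, hs0⟩ := hx
      obtain ⟨t, ht, ht0⟩ := hy
      classical
      refine ⟨s ∪ t, ?_, fun n hn => ?_⟩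
      · simp only [map_add, Finset.sum_add_distrib]
        rw [← Finset.sum_subset Finset.subset_union_left fun n _ hn => hs0 n hn,
          ← Finset.sum_subset Finset.subset_union_right fun n _ hn => ht0 n hn, ← hs, ← ht]
      · rw [Finset.mem_union, not_or] at hn
        rw [map_add, hs0 n hn.1, ht0 n hn.2, add_zero]
    | hG m x hx =>
      refine ⟨{m}, by simp [g.p_same m x hx], fun n hn => g.p_ne m n ?_ x hx⟩
      rintro rfl
      simp at hn
  obtain ⟨s, hs, -⟩ := hfin
  have : ∀ t : Finset ℕ, ∑ n ∈ t, g.p n x ∈ ⨆ n, Submodule.span k {g.p n x} := fun t =>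
    sum_mem fun n _ => Submodule.mem_iSup_of_mem n (Submodule.mem_span_singleton_self _)
  have h1 := this s
  rwa [← hs] at h1

/-- Homogeneous subspaces. -/
def Homog (N : Submodule k M) : Prop := N ≤ ⨆ n, N ⊓ g.G n

variable {g} in
theorem Homog.p_mem {N : Submodule k M} (hN : g.Homog N) (n : ℕ) {x : M} (hx : x ∈ N) :
    g.p n x ∈ N := by
  refine Submodule.iSup_induction _ (motive := fun x => g.p n x ∈ N) (hN hx)
    (fun m x hx => ?_) (by simp) fun x y hx hy => by rw [map_add]; exact add_mem hx hy
  by_cases h : m = n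
  · subst h
    rw [g.p_same m x hx.2]
    exact hx.1
  · rw [g.p_ne m n h x hx.2]
    exact zero_mem _

theorem homog_of_p_mem {N : Submodule k M} (h : ∀ n, ∀ x ∈ N, g.p n x ∈ N) : g.Homog N :=
  fun x hx => g.mem_of_p_mem fun n => Submodule.mem_iSup_of_mem n ⟨h n x hx, g.p_mem n x⟩

theorem homog_top : g.Homog ⊤ := g.homog_of_p_mem fun _ _ _ => trivial

theorem homog_of_le {N : Submodule k M} {n : ℕ} (h : N ≤ g.G n) : g.Homog N :=
  fun _ hx => Submodule.mem_iSup_of_mem n ⟨hx, h hx⟩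

theorem homog_iSup {ι : Sort*} {N : ι → Submodule k M} (h : ∀ i, g.Homog (N i)) :
    g.Homog (⨆ i, N i) :=
  iSup_le fun i => (h i).trans (iSup_mono fun _ => inf_le_inf_right _ (le_iSup N i))

/-! #### The associated grading by the integers -/

/-- The components of the grading by `ℤ` which vanishes in negative degrees. -/
def zG (n : ℤ) : Submodule k M := if 0 ≤ n then g.G n.toNat else ⊥

/-- The projections onto the components of the grading by `ℤ`. -/
def zp (n : ℤ) : M →ₗ[k] M := if 0 ≤ n then g.p n.toNat else 0

theorem zG_natCast (n : ℕ) : g.zG n = g.G n := by simp [zG]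

theorem zp_natCast (n : ℕ) : g.zp n = g.p n := by simp [zp]

theorem zG_of_neg {n : ℤ} (hn : n < 0) : g.zG n = ⊥ := by simp [zG, hn]

theorem zp_of_neg {n : ℤ} (hn : n < 0) : g.zp n = 0 := by simp [zp, hn]

theorem zp_same {n : ℤ} {x : M} (hx : x ∈ g.zG n) : g.zp n x = x := by
  rcases lt_or_ge n 0 with hn | hn
  · rw [zG_of_neg g hn, Submodule.mem_bot] at hx
    rw [hx, map_zero]
  · lift n to ℕ using hn
    rw [zG_natCast] at hx
    rw [zp_natCast, g.p_same n x hx]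

theorem zp_ne {m n : ℤ} (hmn : m ≠ n) {x : M} (hx : x ∈ g.zG m) : g.zp n x = 0 := by
  rcases lt_or_ge m 0 with hm | hm
  · rw [zG_of_neg g hm, Submodule.mem_bot] at hx
    rw [hx, map_zero]
  · rcases lt_or_ge n 0 with hn | hn
    · rw [zp_of_neg g hn, LinearMap.zero_apply]
    · lift n to ℕ using hn
      lift m to ℕ using hm
      rw [zG_natCast] at hx
      rw [zp_natCast, g.p_ne m n (by exact_mod_cast hmn) x hx]

theorem zp_mem (n : ℤ) (x : M) : g.zp n x ∈ g.zG n := by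
  rcases lt_or_ge n 0 with hn | hn
  · rw [zp_of_neg g hn]
    exact zero_mem _
  · lift n to ℕ using hn
    rw [zp_natCast, zG_natCast]
    exact g.p_mem n x

variable {g} in
theorem Homog.zp_mem {N : Submodule k M} (hN : g.Homog N) (n : ℤ) {x : M} (hx : x ∈ N) :
    g.zp n x ∈ N := by
  rcases lt_or_ge n 0 with hn | hn
  · rw [zp_of_neg g hn]
    exact zero_mem _
  · lift n to ℕ using hn
    rw [zp_natCast]
    exact hN.p_mem n hx

variable {g} in
/-- To show that `x - x_n` belongs to `Q` for all `x ∈ N`, it suffices to treat homogeneous elements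
of other degrees. -/
theorem Homog.sub_zp_mem {N Q : Submodule k M} (hN : g.Homog N) (n : ℤ)
    (h : ∀ m : ℕ, (m : ℤ) ≠ n → ∀ x ∈ N, x ∈ g.G m → x ∈ Q) {x : M} (hx : x ∈ N) :
    x - g.zp n x ∈ Q := by
  refine Submodule.iSup_induction _ (motive := fun x => x - g.zp n x ∈ Q) (hN hx)
    (fun m x hx => ?_) (by simp) fun x y hx hy => by
      rw [map_add, add_sub_add_comm]; exact add_mem hx hy
  have hx' : x ∈ g.zG m := by rw [zG_natCast]; exact hx.2
  by_cases hmn : (m : ℤ) = n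
  · subst hmn
    rw [g.zp_same hx', sub_self]
    exact zero_mem _
  · rw [g.zp_ne hmn hx', sub_zero]
    exact h m hmn x hx.1 hx.2

/-- The components of the grading by `ℤ`, as additive subgroups. -/
def deg (n : ℤ) : AddSubgroup M := (g.zG n).toAddSubgroup

theorem isInternal_deg : DirectSum.IsInternal g.deg := by
  have hp : ∀ (f : DirectSum ℤ fun n => g.deg n) (n : ℤ),
      g.zp n (DirectSum.coeAddMonoidHom g.deg f) = f n := by
    intro f n
    induction f using DirectSum.induction_on with
    | zero => simp
    | of m x =>
      rw [DirectSum.coeAddMonoidHom_of]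
      by_cases hmn : m = n
      · subst hmn
        rw [DirectSum.of_eq_same, g.zp_same x.2]
      · rw [DirectSum.of_eq_of_ne _ _ _ (Ne.symm hmn), g.zp_ne hmn x.2]
        rfl
    | add f f' hf hf' => rw [map_add, map_add, hf, hf', DirectSum.add_apply, AddSubgroup.coe_add]
  constructor
  · rw [injective_iff_map_eq_zero]
    intro f hf
    refine DFinsupp.ext fun n => Subtype.ext ?_
    rw [← hp f n, hf, map_zero]
    rfl
  · intro x
    induction x using g.induction with
    | h0 => exact ⟨0, map_zero _⟩
    | hadd x y hx hy =>
      obtain ⟨f, rfl⟩ := hx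
      obtain ⟨f', rfl⟩ := hy
      exact ⟨f + f', map_add _ _ _⟩
    | hG n x hx =>
      rw [← zG_natCast] at hx
      exact ⟨DirectSum.of (fun n => g.deg n) n ⟨x, hx⟩, DirectSum.coeAddMonoidHom_of _ _ _⟩

variable {g} in
/-- The grading induced on a homogeneous subspace. -/
def restrict {N : Submodule k M} (hN : g.Homog N) : NatGrading k N where
  G n := (g.G n).comap N.subtype
  p n := (g.p n).restrict fun _ hx => hN.p_mem n hx
  p_same n x hx := Subtype.ext (g.p_same n x hx)
  p_ne m n h x hx := Subtype.ext (g.p_ne m n h x hx)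
  iSup_G := by
    rw [eq_top_iff]
    rintro ⟨x, hx⟩ -
    have h1 : (⨆ n, N ⊓ g.G n) ≤ (⨆ n, (g.G n).comap N.subtype).map N.subtype := by
      rw [Submodule.map_iSup]
      refine iSup_mono fun n x hx => ⟨⟨x, hx.1⟩, hx.2, rfl⟩
    obtain ⟨y, hy, hyx⟩ := h1 (hN hx)
    have : y = ⟨x, hx⟩ := Subtype.ext hyx
    rwa [← this]

variable {g} in
/-- The grading induced on the quotient by a homogeneous subspace. -/
def quotient {N : Submodule k M} (hN : g.Homog N) : NatGrading k (M ⧸ N) where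
  G n := (g.G n).map N.mkQ
  p n := N.mapQ N (g.p n) fun _ hx => hN.p_mem n hx
  p_same n x hx := by
    obtain ⟨x, hx, rfl⟩ := hx
    rw [Submodule.mkQ_apply, Submodule.mapQ_apply, g.p_same n x hx]
  p_ne m n h x hx := by
    obtain ⟨x, hx, rfl⟩ := hx
    rw [Submodule.mkQ_apply, Submodule.mapQ_apply, g.p_ne m n h x hx, Submodule.Quotient.mk_zero]
  iSup_G := by
    rw [← Submodule.map_iSup, g.iSup_G, Submodule.map_top, Submodule.range_mkQ]

theorem mem_deg_restrict {N : Submodule k M} (hN : g.Homog N) (n : ℤ) (x : N) :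
    x ∈ (restrict hN).deg n ↔ (x : M) ∈ g.zG n := by
  change x ∈ (restrict hN).zG n ↔ _
  unfold zG
  split_ifs with h
  · rfl
  · simp

theorem mem_deg_quotient {N : Submodule k M} (hN : g.Homog N) (n : ℤ) (x : M ⧸ N) :
    x ∈ (quotient hN).deg n ↔ ∃ y ∈ g.zG n, N.mkQ y = x := by
  change x ∈ (quotient hN).zG n ↔ _
  unfold zG
  split_ifs with h
  · rfl
  · simp [eq_comm]

end NatGrading

/-! ### Words -/

section words

variable {k : Type u} {V : Type v} [Field k] [AddCommGroup V] [Module k V]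

theorem word_zero : word k V 0 = 1 := pow_zero _

theorem word_add (m n : ℕ) : word k V (m + n) = word k V m * word k V n := pow_add _ m n

theorem one_mem_word : (1 : TensorAlgebra k V) ∈ word k V 0 := by
  rw [word_zero]
  exact Submodule.one_le.1 le_rfl

theorem ι_mem_word (x : V) : TensorAlgebra.ι k x ∈ word k V 1 := by
  rw [word, pow_one]
  exact ⟨x, rfl⟩

variable (k V) in
/-- The grading of the tensor algebra by the length of words. -/
def wordGrading : NatGrading k (TensorAlgebra k V) where
  G := word k V
  p := GradedAlgebra.proj (fun n : ℕ => LinearMap.range (TensorAlgebra.ι k (M := V)) ^ n)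
  p_same n x hx := by
    rw [GradedAlgebra.proj_apply]
    exact DirectSum.decompose_of_mem_same
      (fun n : ℕ => LinearMap.range (TensorAlgebra.ι k (M := V)) ^ n) hx
  p_ne m n h x hx := by
    rw [GradedAlgebra.proj_apply]
    exact DirectSum.decompose_of_mem_ne
      (fun n : ℕ => LinearMap.range (TensorAlgebra.ι k (M := V)) ^ n) hx h
  iSup_G := Relations.iSup_word

theorem wordGrading_zG (n : ℤ) : (wordGrading k V).zG n = wordZ k V n := rfl

theorem wordGrading_G (n : ℕ) : (wordGrading k V).G n = word k V n := rfl

theorem Homog.mul {X Y : Submodule k (TensorAlgebra k V)} (hX : (wordGrading k V).Homog X)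
    (hY : (wordGrading k V).Homog Y) : (wordGrading k V).Homog (X * Y) := by
  refine (mul_le_mul' hX hY).trans ?_
  rw [Submodule.iSup_mul]
  simp only [Submodule.mul_iSup]
  refine iSup_le fun i => iSup_le fun j => le_iSup_of_le (i + j) (le_inf ?_ ?_)
  · exact mul_le_mul' inf_le_left inf_le_left
  · rw [wordGrading_G, wordGrading_G, wordGrading_G, word_add]
    exact mul_le_mul' inf_le_right inf_le_right

theorem word_induction {P : TensorAlgebra k V → Prop} (h0 : ∀ r : k, P (algebraMap _ _ r))
    (hadd : ∀ x y, P x → P y → P (x + y)) (hmul : ∀ (x : V) a, P a → P (TensorAlgebra.ι k x * a))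
    (a : TensorAlgebra k V) : P a := by
  induction a using (wordGrading k V).induction with
  | h0 => simpa using h0 0
  | hadd x y hx hy => exact hadd x y hx hy
  | hG n x hx =>
    refine Submodule.pow_induction_on_left _ h0 hadd ?_ hx
    rintro _ ⟨x, rfl⟩ a ha
    exact hmul x a ha

theorem cut_zero (a : TensorAlgebra k V) : cut k V 0 a = 1 ⊗ₜ[k] a := by
  induction a using word_induction with
  | h0 r => rw [Algebra.algebraMap_eq_smul_one, map_smul, cut_zero_one, TensorProduct.tmul_smul]; rfl
  | hadd x y hx hy => rw [map_add, hx, hy, TensorProduct.tmul_add]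
  | hmul x a ha => rw [cut_zero_ι_mul, ha, Algebra.TensorProduct.tmul_mul_tmul, one_mul]

theorem cut_mul {p : ℕ} {x : TensorAlgebra k V} (hx : x ∈ word k V p) (y : TensorAlgebra k V) :
    cut k V p (x * y) = x ⊗ₜ[k] y := by
  induction p generalizing x with
  | zero =>
    rw [word_zero] at hx
    obtain ⟨r, rfl⟩ := Submodule.mem_one.1 hx
    rw [cut_zero, Algebra.algebraMap_eq_smul_one, smul_one_mul, TensorProduct.smul_tmul]
  | succ p ih =>
    rw [word, pow_succ'] at hx
    refine Submodule.mul_induction_on hx ?_ ?_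
    · rintro _ ⟨v, rfl⟩ b hb
      rw [mul_assoc, cut_succ_ι_mul, ih hb, Algebra.TensorProduct.tmul_mul_tmul, one_mul]
    · intro a b ha hb
      rw [add_mul, map_add, ha, hb, TensorProduct.add_tmul]

theorem exists_cut_eq {p : ℕ} {X Y : Submodule k (TensorAlgebra k V)} (hX : X ≤ word k V p)
    {x : TensorAlgebra k V} (hx : x ∈ X * Y) :
    ∃ y : X ⊗[k] Y, cut k V p x = TensorProduct.map X.subtype Y.subtype y := by
  refine Submodule.mul_induction_on hx ?_ ?_
  · intro a ha b hb
    exact ⟨⟨a, ha⟩ ⊗ₜ ⟨b, hb⟩, cut_mul (hX ha) b⟩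
  · rintro a b ⟨y, hy⟩ ⟨z, hz⟩
    exact ⟨y + z, by rw [map_add, map_add, hy, hz]⟩

theorem exists_rTensor_ker_eq {N M Q : Type*} [AddCommGroup N] [Module k N] [AddCommGroup M]
    [Module k M] [AddCommGroup Q] [Module k Q] (h : N →ₗ[k] M) {y : N ⊗[k] Q}
    (hy : h.rTensor Q y = 0) : ∃ z, (LinearMap.ker h).subtype.rTensor Q z = y :=
  (Module.Flat.rTensor_exact Q (LinearMap.exact_subtype_ker_map h) y).1 hy

/-- Flatness over a field: under `V^{(p+q)} = V^{(p)} ⊗ V^{(q)}`, the kernel of `f ⊗ id` is the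
kernel of `f` on `V^{(p)}` tensored with `V^{(q)}`. Multiplication undoes the cut and returns to
`T(V)`. -/
theorem mem_mul_of_map_cut_eq_zero {M : Type*} [AddCommGroup M] [Module k M]
    (f : TensorAlgebra k V →ₗ[k] M) {p q : ℕ} {x : TensorAlgebra k V}
    (hx : x ∈ word k V p * word k V q)
    (hf : f.rTensor (TensorAlgebra k V) (cut k V p x) = 0) :
    x ∈ (LinearMap.ker f ⊓ word k V p) * word k V q := by
  have hflat : Function.Injective ((LinearMap.lTensor M (word k V q).subtype)) :=
    Module.Flat.lTensor_preserves_injective_linearMap _ (word k V q).injective_subtype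
  have hmul : LinearMap.mul' k _ (cut k V p x) = x := by
    refine Submodule.mul_induction_on hx (fun a ha b _ => ?_) fun a b ha hb => ?_
    · rw [cut_mul ha, LinearMap.mul'_apply]
    · rw [map_add, map_add, ha, hb]
  obtain ⟨y, hy⟩ := exists_cut_eq le_rfl hx
  set h := f.comp (word k V p).subtype with hh
  have hy0 : h.rTensor (word k V q) y = 0 := by
    apply hflat
    rw [map_zero, ← hf, hy]
    simp only [LinearMap.lTensor, LinearMap.rTensor, ← LinearMap.comp_apply,
      ← TensorProduct.map_comp, hh]
    rfl
  obtain ⟨z, rfl⟩ := exists_rTensor_ker_eq h hy0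
  rw [← hmul, hy]
  clear hy hy0 hmul hx hf
  induction z using TensorProduct.induction_on with
  | zero => simp
  | tmul a b =>
    rw [LinearMap.rTensor_tmul, TensorProduct.map_tmul, LinearMap.mul'_apply]
    exact Submodule.mul_mem_mul ⟨a.2, a.1.2⟩ b.2
  | add a b ha hb => simpa only [map_add] using add_mem ha hb

/-- `X ⊗ V^{(q)}` injects into `(T(V) / Y) ⊗ T(V)` because `X → T(V) / Y` is injective, whereas `Y ⊗
V^{(q)}` maps to zero there. -/
theorem eq_zero_of_mem_mul_of_disjoint {p q : ℕ} {X Y : Submodule k (TensorAlgebra k V)}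
    (hXY : Disjoint X Y) (hX : X ≤ word k V p) (hY : Y ≤ word k V p) {x : TensorAlgebra k V}
    (hxX : x ∈ X * word k V q) (hxY : x ∈ Y * word k V q) : x = 0 := by
  obtain ⟨y, hy⟩ := exists_cut_eq hY hxY
  have h1 : Y.mkQ.rTensor (TensorAlgebra k V) (cut k V p x) = 0 := by
    rw [hy]
    clear hy
    induction y using TensorProduct.induction_on with
    | zero => simp
    | tmul a b =>
      have : Y.mkQ a = 0 := (Submodule.Quotient.mk_eq_zero _).2 a.2
      rw [TensorProduct.map_tmul, LinearMap.rTensor_tmul, Submodule.subtype_apply, this,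
        TensorProduct.zero_tmul]
    | add a b ha hb => rw [map_add, map_add, ha, hb, add_zero]
  obtain ⟨z, hz⟩ := exists_cut_eq hX hxX
  have hinj : Function.Injective (TensorProduct.map (Y.mkQ.comp X.subtype)
      (word k V q).subtype) := by
    refine TensorProduct.map_injective_of_flat_flat _ _ ?_ (Submodule.injective_subtype _)
    rw [injective_iff_map_eq_zero]
    intro a ha
    have haY : (a : TensorAlgebra k V) ∈ Y := (Submodule.Quotient.mk_eq_zero _).1 ha
    exact Subtype.ext (Submodule.disjoint_def.1 hXY _ a.2 haY)
  have hz0 : z = 0 := by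
    apply hinj
    rw [map_zero, ← h1, hz, LinearMap.rTensor, ← LinearMap.comp_apply, ← TensorProduct.map_comp]
    rfl
  have hmul : LinearMap.mul' k _ (cut k V p x) = x := by
    refine Submodule.mul_induction_on hxX (fun a ha b _ => ?_) fun a b ha hb => ?_
    · rw [cut_mul (hX ha), LinearMap.mul'_apply]
    · rw [map_add, map_add, ha, hb]
  rw [← hmul, hz, hz0, map_zero, map_zero]

instance [FiniteDimensional k V] (n : ℕ) : FiniteDimensional k (word k V n) := by
  rw [FiniteDimensional, Module.Finite.iff_fg]
  exact Submodule.FG.pow (Submodule.fg_top _ |>.1 (by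
    rw [← Module.finite_def]; infer_instance)) n

/-- Tensoring with the finite-dimensional `V^{(p)}` commutes with arbitrary intersections:
contracting the first `p` letters with the coordinates of a basis gives coefficients that lie in
every `Y j`. A nonempty index set is needed, as otherwise nothing constrains `x`. -/
theorem mem_word_mul_iInf [FiniteDimensional k V] {p : ℕ} {α : Type*} [Nonempty α]
    {Y : α → Submodule k (TensorAlgebra k V)} {x : TensorAlgebra k V}
    (h : ∀ j, x ∈ word k V p * Y j) : x ∈ word k V p * ⨅ j, Y j := by
  let b := Module.finBasis k (word k V p)
  choose φ hφ using fun i => LinearMap.exists_extend (b.coord i)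
  let c i : TensorAlgebra k V →ₗ[k] TensorAlgebra k V :=
    (TensorProduct.lid k (TensorAlgebra k V)).toLinearMap.comp
      (((φ i).rTensor (TensorAlgebra k V)).comp (cut k V p))
  have hc : ∀ i, ∀ a (ha : a ∈ word k V p) y, c i (a * y) = b.coord i ⟨a, ha⟩ • y := by
    intro i a ha y
    rw [← hφ i]
    simp [c, cut_mul ha]
  have hcY : ∀ i j, c i x ∈ Y j := fun i j => by
    refine Submodule.mul_induction_on (h j) (fun a ha y hy => ?_) fun a b ha hb => ?_
    · rw [hc i a ha]
      exact Submodule.smul_mem _ _ hy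
    · rw [map_add]
      exact add_mem ha hb
  have hsum : x = ∑ i, (b i : TensorAlgebra k V) * c i x := by
    obtain ⟨j⟩ := ‹Nonempty α›
    refine Submodule.mul_induction_on (h j) (fun a ha y hy => ?_) fun x y hx hy => ?_
    · simp only [hc _ a ha, mul_smul_comm]
      simp only [← smul_mul_assoc, ← Finset.sum_mul]
      congr 1
      have h1 := congrArg Subtype.val (b.sum_repr ⟨a, ha⟩)
      rw [AddSubmonoidClass.coe_finsetSum] at h1
      exact h1.symm
    · simp only [map_add, mul_add, Finset.sum_add_distrib, ← hx, ← hy]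
  rw [hsum]
  exact sum_mem fun i _ => Submodule.mul_mem_mul (b i).2 (Submodule.mem_iInf _ |>.2 (hcY i))

end words

namespace Relations

variable {k : Type u} {V : Type v} [Field k] [AddCommGroup V] [Module k V] (D : Relations k V)

/-! ### The ideal of relations -/

/-- The ideal generated by the relations, as a subspace. -/
def idealSub : Submodule k (TensorAlgebra k V) := ⊤ * (⨆ s ∈ D.S, D.R s) * ⊤

theorem top_mul_top : (⊤ : Submodule k (TensorAlgebra k V)) * ⊤ = ⊤ :=
  eq_top_iff.2 fun x _ => by
    simpa using Submodule.mul_mem_mul (Submodule.mem_top (x := x))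
      (Submodule.mem_top (x := (1 : TensorAlgebra k V)))

theorem top_mul_idealSub : ⊤ * D.idealSub = D.idealSub := by
  rw [idealSub, ← mul_assoc, ← mul_assoc, top_mul_top]

theorem idealSub_mul_top : D.idealSub * ⊤ = D.idealSub := by
  rw [idealSub, mul_assoc, top_mul_top]

theorem R_le_idealSub {s : ℕ} (hs : s ∈ D.S) : D.R s ≤ D.idealSub := fun x hx => by
  have h1 : x ∈ ⨆ s ∈ D.S, D.R s :=
    Submodule.mem_iSup_of_mem s (Submodule.mem_iSup_of_mem hs hx)
  have h2 := Submodule.mul_mem_mul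
    (Submodule.mul_mem_mul (Submodule.mem_top (x := (1 : TensorAlgebra k V))) h1)
    (Submodule.mem_top (x := (1 : TensorAlgebra k V)))
  rwa [one_mul, mul_one] at h2

theorem mem_ideal_iff {x : TensorAlgebra k V} : x ∈ D.ideal ↔ x ∈ D.idealSub := by
  constructor
  · intro hx
    let J : TwoSidedIdeal (TensorAlgebra k V) := TwoSidedIdeal.mk' (D.idealSub : Set _)
      (zero_mem _) (fun h h' => add_mem h h') (fun h => neg_mem h)
      (fun {x y} h => D.top_mul_idealSub.le (Submodule.mul_mem_mul (Submodule.mem_top (x := x)) h))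
      (fun {x y} h => D.idealSub_mul_top.le (Submodule.mul_mem_mul h (Submodule.mem_top (x := y))))
    have hJ : D.ideal ≤ J := by
      refine TwoSidedIdeal.span_le.2 fun x hx => ?_
      rw [SetLike.mem_coe, TwoSidedIdeal.mem_mk']
      simp only [Set.mem_iUnion, SetLike.mem_coe] at hx
      obtain ⟨s, hs, hx⟩ := hx
      exact D.R_le_idealSub hs hx
    have := hJ hx
    rwa [TwoSidedIdeal.mem_mk'] at this
  · intro hx
    refine Submodule.mul_induction_on hx (fun a ha b _ => ?_) fun a b ha hb => add_mem ha hb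
    refine D.ideal.mul_mem_right _ _ ?_
    refine Submodule.mul_induction_on ha (fun c _ r hr => ?_) fun a b ha hb => add_mem ha hb
    refine D.ideal.mul_mem_left _ _ ?_
    have h1 : ∀ c : k, ∀ r ∈ D.ideal, c • r ∈ D.ideal := fun c r hr => by
      rw [Algebra.smul_def]
      exact D.ideal.mul_mem_left _ _ hr
    let N : Submodule k (TensorAlgebra k V) :=
      { carrier := {x | x ∈ D.ideal}
        add_mem' := fun h h' => D.ideal.add_mem h h'
        zero_mem' := D.ideal.zero_mem
        smul_mem' := h1 }
    have h2 : (⨆ s ∈ D.S, D.R s) ≤ N := iSup₂_le fun s hs r hr =>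
      TwoSidedIdeal.subset_span (Set.mem_iUnion₂.2 ⟨s, hs, hr⟩)
    exact h2 hr

theorem π_eq_zero_iff {x : TensorAlgebra k V} : D.π x = 0 ↔ x ∈ D.idealSub := by
  rw [← mem_ideal_iff, TwoSidedIdeal.mem_iff, ← D.ideal.ringCon.eq]
  rfl

theorem ker_π : LinearMap.ker D.π.toLinearMap = D.idealSub :=
  Submodule.ext fun _ => D.π_eq_zero_iff

theorem homog_idealSub : (wordGrading k V).Homog D.idealSub := by
  refine Homog.mul (Homog.mul (NatGrading.homog_top _) ?_) (NatGrading.homog_top _)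
  exact NatGrading.homog_iSup _ fun s => NatGrading.homog_iSup _ fun hs =>
    NatGrading.homog_of_le _ (D.le_word s hs)

/-- The subspace of `V^{(n)}` spanned by the relations of degree less than `s`. -/
def relLT (s n : ℕ) : Submodule k (TensorAlgebra k V) :=
  ⨆ t ∈ D.S, ⨆ (_ : t < s), ⨆ j ∈ Finset.range (n - t + 1),
    word k V j * D.R t * word k V (n - t - j)

theorem disjoint_relLT {s : ℕ} (hs : s ∈ D.S) : Disjoint (D.R s) (D.relLT s s) := D.minimal s hs

theorem word_mul_R_mul_word_le_relLT {s t a b n : ℕ} (ht : t ∈ D.S) (hts : t < s)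
    (hn : a + t + b = n) : word k V a * D.R t * word k V b ≤ D.relLT s n := by
  refine le_iSup₂_of_le t ht (le_iSup₂_of_le hts a ?_)
  refine le_iSup_of_le (Finset.mem_range.2 (by omega)) ?_
  rw [show n - t - a = b by omega]

theorem word_mul_R_mul_word_le_word {t a b n : ℕ} (ht : t ∈ D.S)
    (hn : a + t + b = n) : word k V a * D.R t * word k V b ≤ word k V n := by
  rw [← hn, word_add, word_add]
  exact mul_le_mul' (mul_le_mul' le_rfl (D.le_word t ht)) le_rfl

/-- The bound `s ≤ n + 1` forces `t ≤ n` for every `t < s`; otherwise the truncated `n - t` would be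
`0` and `relLT` would contain words longer than `n`. -/
theorem relLT_le_word {s n : ℕ} (hn : s ≤ n + 1) : D.relLT s n ≤ word k V n := by
  refine iSup₂_le fun t ht => iSup_le fun hts => iSup₂_le fun j hj => ?_
  rw [Finset.mem_range] at hj
  exact D.word_mul_R_mul_word_le_word ht (by omega)

theorem idealSub_eq_iSup : D.idealSub =
    ⨆ a, ⨆ s ∈ D.S, ⨆ b, word k V a * D.R s * word k V b := by
  rw [idealSub, ← iSup_word]
  simp only [Submodule.iSup_mul, Submodule.mul_iSup]
  refine le_antisymm ?_ ?_
  · exact iSup_le fun b => iSup₂_le fun s hs => iSup_le fun a =>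
      le_iSup_of_le a (le_iSup₂_of_le s hs (le_iSup_of_le b le_rfl))
  · exact iSup_le fun a => iSup₂_le fun s hs => iSup_le fun b =>
      le_iSup_of_le b (le_iSup₂_of_le s hs (le_iSup_of_le a le_rfl))

/-- Project the spanning subspaces `V^{(a)} R_t V^{(b)}` of the ideal to length `p`: only those with
`a + t + b = p` survive, and they have `t ≤ p < s`. -/
theorem idealSub_inf_word_le {p s : ℕ} (hp : p < s) : D.idealSub ⊓ word k V p ≤ D.relLT s p := by
  rintro x ⟨hx, hxp⟩
  rw [← (wordGrading k V).p_same p x hxp]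
  suffices D.idealSub ≤ (D.relLT s p).comap ((wordGrading k V).p p) from this hx
  rw [idealSub_eq_iSup]
  refine iSup_le fun a => iSup₂_le fun t ht => iSup_le fun b y hy => ?_
  have hy' := D.word_mul_R_mul_word_le_word ht rfl hy
  rw [Submodule.mem_comap]
  by_cases h : a + t + b = p
  · subst h
    rw [(wordGrading k V).p_same _ y hy']
    exact D.word_mul_R_mul_word_le_relLT ht (by omega) rfl hy
  · rw [(wordGrading k V).p_ne _ _ h y hy']
    exact zero_mem _

theorem relLT_mul_word_le (s m n : ℕ) (hs : s ≤ m + 1) :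
    D.relLT s m * word k V n ≤ D.relLT s (m + n) := by
  simp only [relLT, Submodule.iSup_mul]
  refine iSup₂_le fun t ht => iSup_le fun hts => iSup₂_le fun j hj => ?_
  rw [Finset.mem_range] at hj
  rw [mul_assoc, ← word_add]
  exact D.word_mul_R_mul_word_le_relLT ht hts (by omega)

end Relations

/-! ### Recursion on the first letter, and the augmentation ideal -/

section recursion

variable {k : Type u} {V : Type v} [Field k] [AddCommGroup V] [Module k V]

/-- Linear maps out of the tensor algebra can be defined by recursion on the first letter. -/
theorem exists_linearMap_recursion {W : Type*} [AddCommGroup W] [Module k W]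
    (b : V →ₗ[k] Module.End k W) (c : V →ₗ[k] TensorAlgebra k V →ₗ[k] W) (w₀ : W) :
    ∃ Φ : TensorAlgebra k V →ₗ[k] W, Φ 1 = w₀ ∧
      ∀ v t, Φ (TensorAlgebra.ι k v * t) = b v (Φ t) + c v t := by
  -- The recursion step uses both `t` and `Φ t`, so each letter acts on the pair `(t, Φ t)`;
  -- freeness of `T(V)` turns this into a module structure, and `Φ` is the second coordinate of the
  -- orbit of `(1, w₀)`.
  let E : V →ₗ[k] Module.End k (TensorAlgebra k V × W) :=
    { toFun v := ((LinearMap.mulLeft k (TensorAlgebra.ι k v)).comp (LinearMap.fst k _ W)).prod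
        ((b v).comp (LinearMap.snd k _ W) + (c v).comp (LinearMap.fst k _ W))
      map_add' v v' := by
        refine LinearMap.ext fun x => Prod.ext ?_ ?_
        · simp [add_mul]
        · change b (v + v') x.2 + c (v + v') x.1 =
            b v x.2 + c v x.1 + (b v' x.2 + c v' x.1)
          simp only [map_add, LinearMap.add_apply]
          abel
      map_smul' r v := by
        refine LinearMap.ext fun x => Prod.ext ?_ ?_ <;> simp }
  let F := TensorAlgebra.lift k E
  have hF : ∀ t, (F t (1, w₀)).1 = t := fun t => by
    induction t using word_induction with
    | h0 r => simp [Algebra.algebraMap_eq_smul_one]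
    | hadd x y hx hy => simp [hx, hy]
    | hmul v a ha =>
      have : F (TensorAlgebra.ι k v) = E v := TensorAlgebra.lift_ι_apply E v
      rw [map_mul, Module.End.mul_apply, this]
      change TensorAlgebra.ι k v * (F a (1, w₀)).1 = _
      rw [ha]
  refine ⟨(LinearMap.snd k _ W).comp ((LinearMap.applyₗ (1, w₀)).comp F.toLinearMap), by simp,
    fun v t => ?_⟩
  have : F (TensorAlgebra.ι k v) = E v := TensorAlgebra.lift_ι_apply E v
  change (F (TensorAlgebra.ι k v * t) (1, w₀)).2 = b v (F t (1, w₀)).2 + c v t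
  rw [map_mul, Module.End.mul_apply, this]
  change b v (F t (1, w₀)).2 + c v (F t (1, w₀)).1 = _
  rw [hF]

variable (k V) in
/-- The augmentation ideal of the tensor algebra. -/
def augSub : Submodule k (TensorAlgebra k V) :=
  LinearMap.ker (TensorAlgebra.algebraMapInv (R := k) (M := V)).toLinearMap

theorem mem_augSub {x : TensorAlgebra k V} :
    x ∈ augSub k V ↔ TensorAlgebra.algebraMapInv x = (0 : k) := Iff.rfl

theorem algebraMapInv_ι (x : V) :
    TensorAlgebra.algebraMapInv (TensorAlgebra.ι k x) = (0 : k) := by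
  simp [TensorAlgebra.algebraMapInv]

theorem augSub_eq : augSub k V = word k V 1 * ⊤ := by
  apply le_antisymm
  · intro x hx
    suffices ∀ x : TensorAlgebra k V,
        x - algebraMap k _ (TensorAlgebra.algebraMapInv x) ∈ word k V 1 * ⊤ by
      have h1 := this x
      rwa [mem_augSub.1 hx, map_zero, sub_zero] at h1
    intro x
    induction x using word_induction with
    | h0 r => simp [TensorAlgebra.algebraMapInv]
    | hadd x y hx hy =>
      rw [map_add, map_add, add_sub_add_comm]
      exact add_mem hx hy
    | hmul x a ha =>
      rw [map_mul, algebraMapInv_ι, zero_mul, map_zero, sub_zero]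
      exact Submodule.mul_mem_mul (ι_mem_word x) trivial
  · refine Submodule.mul_le.2 fun x hx a _ => ?_
    rw [mem_augSub, map_mul, Relations.algebraMapInv_word_succ 0 hx, zero_mul]

theorem homog_augSub : (wordGrading k V).Homog (augSub k V) := by
  rw [augSub_eq]
  exact Homog.mul (NatGrading.homog_of_le _ le_rfl) (NatGrading.homog_top _)

theorem top_mul_augSub : ⊤ * augSub k V = augSub k V := by
  apply le_antisymm
  · refine Submodule.mul_le.2 fun x _ y hy => ?_
    rw [mem_augSub, map_mul, mem_augSub.1 hy, mul_zero]
  · intro x hx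
    simpa using Submodule.mul_mem_mul (Submodule.mem_top (x := (1 : TensorAlgebra k V))) hx

theorem augSub_mul_top : augSub k V * ⊤ = augSub k V := by
  rw [augSub_eq, mul_assoc, Relations.top_mul_top]

theorem mul_mem_wordZ {m : ℕ} {n : ℤ} {x y : TensorAlgebra k V} (hx : x ∈ word k V m)
    (hy : y ∈ wordZ k V n) : x * y ∈ wordZ k V (m + n) := by
  rw [wordZ] at *
  split_ifs at hy with hn
  · rw [if_pos (by omega), show (m + n).toNat = m + n.toNat by omega, word_add]
    exact Submodule.mul_mem_mul hx hy
  · rw [Submodule.mem_bot] at hy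
    rw [hy, mul_zero]
    exact zero_mem _

end recursion

namespace Relations

variable {k : Type u} {V : Type v} [Field k] [AddCommGroup V] [Module k V] (D : Relations k V)

theorem idealSub_le_augSub : D.idealSub ≤ augSub k V := by
  intro x hx
  rw [mem_augSub, ← D.ε_π, D.π_eq_zero_iff.2 hx, map_zero]

/-! ### The Gruenberg resolution -/

/-- The left ideals `T, T_+, I, I T_+, I^2, I^2 T_+, …` of the tensor algebra. -/
def L : ℕ → Submodule k (TensorAlgebra k V)
  | 0 => ⊤
  | 1 => augSub k V
  | i + 2 => D.idealSub * L i

theorem top_mul_L : ∀ i, ⊤ * D.L i = D.L i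
  | 0 => top_mul_top
  | 1 => top_mul_augSub
  | i + 2 => by rw [L, ← mul_assoc, top_mul_idealSub]

theorem mul_mem_L (i : ℕ) (t : TensorAlgebra k V) {x : TensorAlgebra k V} (hx : x ∈ D.L i) :
    t * x ∈ D.L i :=
  (D.top_mul_L i).le (Submodule.mul_mem_mul trivial hx)

theorem L_succ_le : ∀ i, D.L (i + 1) ≤ D.L i
  | 0 => le_top
  | 1 => by
    rw [L, L, L, idealSub_mul_top]
    exact D.idealSub_le_augSub
  | i + 2 => mul_le_mul' le_rfl (L_succ_le i)

theorem L_add_two_le (i : ℕ) : D.L (i + 2) ≤ augSub k V * D.L i :=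
  mul_le_mul' D.idealSub_le_augSub le_rfl

theorem homog_L : ∀ i, (wordGrading k V).Homog (D.L i)
  | 0 => NatGrading.homog_top _
  | 1 => homog_augSub
  | i + 2 => Homog.mul D.homog_idealSub (homog_L i)

/-- The terms `L_i/I L_i` of the Gruenberg resolution. -/
def GruP (i : ℕ) : Type (max u v) := D.L i ⧸ (D.L (i + 2)).submoduleOf (D.L i)

instance (i : ℕ) : AddCommGroup (D.GruP i) :=
  inferInstanceAs (AddCommGroup (D.L i ⧸ (D.L (i + 2)).submoduleOf (D.L i)))

instance (i : ℕ) : Module k (D.GruP i) :=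
  inferInstanceAs (Module k (D.L i ⧸ (D.L (i + 2)).submoduleOf (D.L i)))

/-- The projection `L_i → L_i/I L_i`. -/
def gruMk (i : ℕ) : D.L i →ₗ[k] D.GruP i := ((D.L (i + 2)).submoduleOf (D.L i)).mkQ

theorem gruMk_surjective (i : ℕ) : Function.Surjective (D.gruMk i) :=
  Submodule.mkQ_surjective _

theorem gruMk_eq_zero_iff {i : ℕ} {x : D.L i} :
    D.gruMk i x = 0 ↔ (x : TensorAlgebra k V) ∈ D.L (i + 2) :=
  Submodule.Quotient.mk_eq_zero _

/-- Maps out of `L_i/I L_i`. -/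
def gruLift {W : Type*} [AddCommGroup W] [Module k W] (i : ℕ) (f : D.L i →ₗ[k] W)
    (hf : ∀ x : D.L i, (x : TensorAlgebra k V) ∈ D.L (i + 2) → f x = 0) : D.GruP i →ₗ[k] W :=
  ((D.L (i + 2)).submoduleOf (D.L i)).liftQ f hf

theorem gruLift_mk {W : Type*} [AddCommGroup W] [Module k W] (i : ℕ) (f : D.L i →ₗ[k] W)
    (hf : ∀ x : D.L i, (x : TensorAlgebra k V) ∈ D.L (i + 2) → f x = 0) (x : D.L i) :
    D.gruLift i f hf (D.gruMk i x) = f x := rfl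

/-- Left multiplication by `t` on `L_i`. -/
def lMul (i : ℕ) (t : TensorAlgebra k V) : D.L i →ₗ[k] D.L i :=
  (LinearMap.mulLeft k t).restrict fun _ hx => D.mul_mem_L i t hx

theorem coe_lMul (i : ℕ) (t : TensorAlgebra k V) (x : D.L i) :
    (D.lMul i t x : TensorAlgebra k V) = t * x := rfl

theorem gruP_ext {W : Type*} [AddCommGroup W] [Module k W] {i : ℕ} {f g : D.GruP i →ₗ[k] W}
    (h : ∀ x, f (D.gruMk i x) = g (D.gruMk i x)) : f = g :=
  LinearMap.ext fun y => by
    obtain ⟨x, rfl⟩ := D.gruMk_surjective i y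
    exact h x

/-- The action of the tensor algebra on `L_i/I L_i`. -/
def gruActT (i : ℕ) : TensorAlgebra k V →ₐ[k] Module.End k (D.GruP i) :=
  AlgHom.ofLinearMap
    { toFun t := D.gruLift i ((D.gruMk i).comp (D.lMul i t))
        fun x hx => D.gruMk_eq_zero_iff.2 (D.mul_mem_L (i + 2) t hx)
      map_add' t t' := D.gruP_ext fun x => by
        simp only [gruLift_mk, LinearMap.comp_apply, LinearMap.add_apply, ← map_add]
        congr 1
        exact Subtype.ext (add_mul t t' _)
      map_smul' c t := D.gruP_ext fun x => by
        simp only [gruLift_mk, LinearMap.comp_apply, LinearMap.smul_apply, RingHom.id_apply]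
        rw [← map_smul (D.gruMk i)]
        congr 1
        exact Subtype.ext (smul_mul_assoc c t _) }
    (D.gruP_ext fun x => congrArg (D.gruMk i) (Subtype.ext (one_mul _)))
    (fun t t' => D.gruP_ext fun x => congrArg (D.gruMk i) (Subtype.ext (mul_assoc _ _ _)))

theorem gruActT_mk (i : ℕ) (t : TensorAlgebra k V) (x : D.L i) :
    D.gruActT i t (D.gruMk i x) = D.gruMk i (D.lMul i t x) := rfl

/-- The action of `A` on `L_i/I L_i`. -/
def gruAct (i : ℕ) : D.Alg →ₐ[k] Module.End k (D.GruP i) :=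
  D.ideal.ringCon.liftₐ (D.gruActT i) fun x y h => by
    have h1 : x - y ∈ D.idealSub := D.mem_ideal_iff.1 ((TwoSidedIdeal.rel_iff _ _ _).1 h)
    change D.gruActT i x = D.gruActT i y
    rw [← sub_eq_zero, ← map_sub]
    refine D.gruP_ext fun z => ?_
    rw [gruActT_mk, LinearMap.zero_apply, gruMk_eq_zero_iff]
    exact Submodule.mul_mem_mul h1 z.2

instance (i : ℕ) : Module D.Alg (D.GruP i) := Module.compHom _ (D.gruAct i).toRingHom

theorem π_smul_gruMk (i : ℕ) (t : TensorAlgebra k V) (x : D.L i) :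
    D.π t • D.gruMk i x = D.gruMk i (D.lMul i t x) := rfl

instance (i : ℕ) : IsScalarTower k D.Alg (D.GruP i) where
  smul_assoc c a x := by
    change D.gruAct i (c • a) x = c • D.gruAct i a x
    rw [map_smul, LinearMap.smul_apply]

/-- Left ideals of a free algebra are projective, made explicit: `L_i / I L_i` is a direct summand
of the free module `A ⊗ L_i`. The splitting is `Φ` below, built from a linear retraction `q` of
`T(V)` onto `L_i`. The correction `q(v t) - v q(t)` in its recursion makes `Φ` lift `q` everywhere,
and vanishes for `t` in `L_i`, so that `Φ` is linear over `T(V)` there. -/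
instance gruP_projective (i : ℕ) : Module.Projective D.Alg (D.GruP i) := by
  obtain ⟨q, hq⟩ := LinearMap.exists_leftInverse_of_injective (D.L i).subtype
    (Submodule.ker_subtype _)
  replace hq : ∀ x : D.L i, q x = x := LinearMap.congr_fun hq
  let b : V →ₗ[k] Module.End k (D.Alg ⊗[k] D.L i) :=
    ((Algebra.lsmul k k (D.Alg ⊗[k] D.L i) : D.Alg →ₐ[k] _).toLinearMap.comp
      D.π.toLinearMap).comp (TensorAlgebra.ι k)
  let c : V →ₗ[k] TensorAlgebra k V →ₗ[k] D.Alg ⊗[k] D.L i :=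
    { toFun v := (TensorProduct.mk k D.Alg (D.L i) 1).comp
        (q.comp (LinearMap.mulLeft k (TensorAlgebra.ι k v)) - (D.lMul i (TensorAlgebra.ι k v)).comp q)
      map_add' v v' := by
        refine LinearMap.ext fun x => ?_
        simp only [LinearMap.comp_apply, LinearMap.add_apply, LinearMap.sub_apply, ← map_add]
        congr 1
        have : D.lMul i (TensorAlgebra.ι k (v + v')) (q x) =
            D.lMul i (TensorAlgebra.ι k v) (q x) + D.lMul i (TensorAlgebra.ι k v') (q x) :=
          Subtype.ext (by simp [coe_lMul, add_mul])
        rw [this]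
        simp only [LinearMap.mulLeft_apply, map_add, add_mul]
        abel
      map_smul' r v := by
        refine LinearMap.ext fun x => ?_
        simp only [LinearMap.comp_apply, LinearMap.smul_apply, LinearMap.sub_apply, ← map_smul,
          RingHom.id_apply]
        congr 1
        have : D.lMul i (TensorAlgebra.ι k (r • v)) (q x) =
            r • D.lMul i (TensorAlgebra.ι k v) (q x) :=
          Subtype.ext (by simp [coe_lMul])
        rw [this]
        simp only [LinearMap.mulLeft_apply, map_smul, smul_mul_assoc, smul_sub] }
  obtain ⟨Φ, hΦ1, hΦ⟩ := exists_linearMap_recursion b c (1 ⊗ₜ q 1)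
  replace hΦ : ∀ v t, Φ (TensorAlgebra.ι k v * t) = D.π (TensorAlgebra.ι k v) • Φ t +
      1 ⊗ₜ (q (TensorAlgebra.ι k v * t) - D.lMul i (TensorAlgebra.ι k v) (q t)) := hΦ
  have hΦL : ∀ t, ∀ x ∈ D.L i, Φ (t * x) = D.π t • Φ x := fun t x hx => by
    induction t using word_induction with
    | h0 r =>
      rw [AlgHom.commutes, algebraMap_smul, ← map_smul, Algebra.smul_def]
    | hadd t t' ht ht' => rw [add_mul, map_add, map_add, ht, ht', add_smul]
    | hmul v t ht =>
      have hx' := D.mul_mem_L i t hx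
      have h1 := hq ⟨t * x, hx'⟩
      have h2 := hq ⟨_, D.mul_mem_L i (TensorAlgebra.ι k v) hx'⟩
      have h3 : q (TensorAlgebra.ι k v * (t * x)) -
          D.lMul i (TensorAlgebra.ι k v) (q (t * x)) = 0 := by
        rw [sub_eq_zero, h1, h2]
        rfl
      rw [mul_assoc, hΦ, ht, h3, TensorProduct.tmul_zero, add_zero, map_mul, mul_smul]
  -- `Φ` kills `I L_i`: by linearity on `L_i` an element of `I` acts on the value through its image
  -- in `A`, which is zero.
  let σk : D.GruP i →ₗ[k] D.Alg ⊗[k] D.L i := D.gruLift i (Φ.comp (D.L i).subtype) fun _ hx => by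
    rw [LinearMap.comp_apply, Submodule.subtype_apply]
    refine Submodule.mul_induction_on hx (fun a ha y hy => ?_) fun a b ha hb => ?_
    · rw [hΦL a y hy, D.π_eq_zero_iff.2 ha, zero_smul]
    · rw [map_add, ha, hb, add_zero]
  let σ : D.GruP i →ₗ[D.Alg] D.Alg ⊗[k] D.L i :=
    { toFun := σk
      map_add' := map_add σk
      map_smul' a y := by
        obtain ⟨t, rfl⟩ := D.π_surjective a
        obtain ⟨x, rfl⟩ := D.gruMk_surjective i y
        exact hΦL t x x.2 }
  let s : D.Alg ⊗[k] D.L i →ₗ[D.Alg] D.GruP i :=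
    TensorProduct.AlgebraTensorModule.lift
      { toFun a := a • D.gruMk i
        map_add' a b := add_smul a b _
        map_smul' a b := mul_smul a b _ }
  have hs : ∀ a x, s (a ⊗ₜ x) = a • D.gruMk i x := fun a x => rfl
  have hsΦ : ∀ t, s (Φ t) = D.gruMk i (q t) := fun t => by
    induction t using word_induction with
    | h0 r =>
      rw [Algebra.algebraMap_eq_smul_one, map_smul, hΦ1, TensorProduct.smul_tmul', hs,
        smul_assoc, one_smul, map_smul, map_smul]
    | hadd t t' ht ht' => simp only [map_add, ht, ht']
    | hmul v t ht =>
      rw [hΦ, map_add, map_smul, ht, hs, one_smul, π_smul_gruMk, ← map_add]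
      congr 1
      abel
  refine Module.Projective.of_split σ s (LinearMap.ext fun y => ?_)
  obtain ⟨x, rfl⟩ := D.gruMk_surjective i y
  change s (Φ x) = _
  rw [hsΦ, hq]
  rfl

theorem homog_L_submoduleOf (i : ℕ) : (NatGrading.restrict (D.homog_L i)).Homog
    ((D.L (i + 2)).submoduleOf (D.L i)) :=
  NatGrading.homog_of_p_mem _ fun n _ hx => (D.homog_L (i + 2)).p_mem n hx

/-- The grading of `L_i/I L_i`. -/
def gruGrading (i : ℕ) : NatGrading k (D.GruP i) :=
  NatGrading.quotient (D.homog_L_submoduleOf i)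

theorem mem_gruDeg_iff {i : ℕ} {n : ℤ} {y : D.GruP i} : y ∈ (D.gruGrading i).deg n ↔
    ∃ x : D.L i, (x : TensorAlgebra k V) ∈ wordZ k V n ∧ D.gruMk i x = y := by
  refine (NatGrading.mem_deg_quotient _ (D.homog_L_submoduleOf i) n y).trans ?_
  refine exists_congr fun x => and_congr_left fun _ => ?_
  exact NatGrading.mem_deg_restrict _ (D.homog_L i) n x

/-- The inclusion of `L_{i+1}` into `L_i`. -/
def lIncl (i : ℕ) : D.L (i + 1) →ₗ[k] D.L i := Submodule.inclusion (D.L_succ_le i)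

/-- The Gruenberg resolution, as a complex. -/
def gruComplex : GrComplex.{u, v, max u v} D where
  P := D.GruP
  deg i := (D.gruGrading i).deg
  isInternal i := (D.gruGrading i).isInternal_deg
  smul_mem i m n a ha y hy := by
    obtain ⟨t, ht, rfl⟩ := ha
    obtain ⟨x, hx, rfl⟩ := D.mem_gruDeg_iff.1 hy
    exact D.mem_gruDeg_iff.2 ⟨D.lMul i t x, mul_mem_wordZ ht hx, rfl⟩
  projective := D.gruP_projective
  d i :=
    { toFun := D.gruLift (i + 1) ((D.gruMk i).comp (D.lIncl i)) fun x hx =>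
        D.gruMk_eq_zero_iff.2 (D.L_succ_le (i + 2) hx)
      map_add' := map_add _
      map_smul' a y := by
        obtain ⟨t, rfl⟩ := D.π_surjective a
        obtain ⟨x, rfl⟩ := D.gruMk_surjective _ y
        rfl }
  d_mem i n y hy := by
    obtain ⟨x, hx, rfl⟩ := D.mem_gruDeg_iff.1 hy
    exact D.mem_gruDeg_iff.2 ⟨D.lIncl i x, hx, rfl⟩
  aug :=
    { toFun := D.gruLift 0 (TensorAlgebra.algebraMapInv.toLinearMap.comp (D.L 0).subtype)
        fun _ hx => D.idealSub_le_augSub (D.idealSub_mul_top.le (by exact hx))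
      map_add' := map_add _
      map_smul' a y := by
        obtain ⟨t, rfl⟩ := D.π_surjective a
        obtain ⟨x, rfl⟩ := D.gruMk_surjective _ y
        exact map_mul TensorAlgebra.algebraMapInv t (x : TensorAlgebra k V) }
  aug_mem n y hy := by
    obtain ⟨x, hx, rfl⟩ := D.mem_gruDeg_iff.1 hy
    by_cases hn : n = 0
    · exact mem_trivDeg_zero hn _
    · have : TensorAlgebra.algebraMapInv (x : TensorAlgebra k V) = (0 : k) := by
        rw [wordZ] at hx
        split_ifs at hx with h
        · obtain ⟨m, hm⟩ : ∃ m, n.toNat = m + 1 := ⟨n.toNat - 1, by omega⟩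
          rw [hm] at hx
          exact algebraMapInv_word_succ m hx
        · rw [(Submodule.mem_bot k).1 hx, map_zero]
      exact this ▸ zero_mem (trivDeg k n)
  aug_surjective c := ⟨D.gruMk 0 ⟨algebraMap k _ c, trivial⟩,
    TensorAlgebra.algebraMap_leftInverse V c⟩
  aug_d y := by
    obtain ⟨x, rfl⟩ := D.gruMk_surjective _ y
    exact x.2
  d_d i y := by
    obtain ⟨x, rfl⟩ := D.gruMk_surjective _ y
    exact D.gruMk_eq_zero_iff.2 x.2

theorem gruMk_mem_syz_iff : ∀ {i : ℕ} {x : D.L i},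
    D.gruMk i x ∈ D.gruComplex.syz i ↔ (x : TensorAlgebra k V) ∈ D.L (i + 1)
  | 0, _ => Iff.rfl
  | _ + 1, _ => D.gruMk_eq_zero_iff

theorem gruComplex_exactAt (i : ℕ) : D.gruComplex.ExactAt i := fun y hy => by
  obtain ⟨x, rfl⟩ := D.gruMk_surjective _ y
  exact ⟨D.gruMk (i + 1) ⟨x, D.gruMk_mem_syz_iff.1 hy⟩, rfl⟩

/-- The Gruenberg resolution. -/
def gruenberg : GradedProjRes.{u, v, max u v} D where
  P := D.gruComplex.P
  deg := D.gruComplex.deg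
  isInternal := D.gruComplex.isInternal
  smul_mem := D.gruComplex.smul_mem
  projective := D.gruComplex.projective
  d := D.gruComplex.d
  d_mem := D.gruComplex.d_mem
  aug := D.gruComplex.aug
  aug_mem := D.gruComplex.aug_mem
  aug_surjective := D.gruComplex.aug_surjective
  exact_zero y := ⟨D.gruComplex_exactAt 0 y, by
    rintro ⟨x, rfl⟩
    exact D.gruComplex.aug_d x⟩
  exact_succ i y := ⟨D.gruComplex_exactAt (i + 1) y, by
    rintro ⟨x, rfl⟩
    exact D.gruComplex.d_d i x⟩

/-! ### Govorov's description of the torsion spaces -/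

/-- Cycles in degree `n` for Govorov's description of `Tor_{i+1}(k,k)`. -/
def govZ (i : ℕ) (n : ℤ) : Submodule k (TensorAlgebra k V) :=
  D.L (i + 1) ⊓ augSub k V * D.L i ⊓ wordZ k V n

/-- Boundaries for Govorov's description of `Tor_{i+1}(k,k)`. -/
def govB (i : ℕ) : Submodule k (TensorAlgebra k V) :=
  augSub k V * D.L (i + 1) ⊔ D.L (i + 2)

/-- The map from `L_i/I L_i` induced by the projection to the component of degree `n`. -/
def gruProj (i : ℕ) (n : ℤ) {Y : Submodule k (TensorAlgebra k V)} (hY : D.L (i + 2) ≤ Y) :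
    D.GruP i →ₗ[k] TensorAlgebra k V ⧸ Y :=
  D.gruLift i (Y.mkQ.comp (((wordGrading k V).zp n).comp (D.L i).subtype)) fun _ hx =>
    (Submodule.Quotient.mk_eq_zero _).2 (hY ((D.homog_L (i + 2)).zp_mem n hx))

theorem gruProj_mk_eq_zero_iff {i : ℕ} {n : ℤ} {Y : Submodule k (TensorAlgebra k V)}
    {hY : D.L (i + 2) ≤ Y} {x : D.L i} :
    D.gruProj i n hY (D.gruMk i x) = 0 ↔ (wordGrading k V).zp n x ∈ Y :=
  Submodule.Quotient.mk_eq_zero _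

theorem exists_mem_augSub {a : D.Alg} (ha : D.ε a = 0) : ∃ t ∈ augSub k V, D.π t = a := by
  obtain ⟨t, rfl⟩ := D.π_surjective a
  exact ⟨t, ha, rfl⟩

/-- The cycles in `L_i/I L_i`. -/
def gruSyz (i : ℕ) : Submodule D.Alg (D.GruP i) := D.gruComplex.syz i

/-- The projection from `L_{i+1}` to the cycles in `L_i/I L_i`. -/
def gruToSyz (i : ℕ) : D.L (i + 1) →ₗ[k] D.gruSyz i where
  toFun x := ⟨D.gruMk i (D.lIncl i x), D.gruMk_mem_syz_iff.2 x.2⟩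
  map_add' x y := Subtype.ext (map_add ((D.gruMk i).comp (D.lIncl i)) x y)
  map_smul' c x := Subtype.ext (map_smul ((D.gruMk i).comp (D.lIncl i)) c x)

theorem gruToSyz_surjective (i : ℕ) : Function.Surjective (D.gruToSyz i) := fun ⟨y, hy⟩ => by
  obtain ⟨x, rfl⟩ := D.gruMk_surjective _ y
  exact ⟨⟨x, D.gruMk_mem_syz_iff.1 hy⟩, rfl⟩

/-- In `L_i / I L_i` the cycles are `L_{i+1} / L_{i+2}`, the decomposable elements come from `T_+
L_i` and the decomposable cycles from `T_+ L_{i+1}`. The four auxiliary facts translate both `bad`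
subspaces, in each direction, into subspaces of `T(V)`; all of these are homogeneous, so one may
pass to the component of degree `-n`. -/
theorem nonempty_gru_subquotient_equiv (i : ℕ) (n : ℤ) :
    Nonempty (Subquotient (D.govZ i (-n)) (D.govB i) ≃ₗ[k]
      Subquotient ((bad D (D.gruGrading i).deg n).comap ((D.gruSyz i).subtype.restrictScalars k))
        (bad D (subDeg (D.gruGrading i).deg (D.gruSyz i)) n)) := by
  have hbad : ∀ x : D.L i, D.gruMk i x ∈ bad D (D.gruGrading i).deg n →
      (wordGrading k V).zp (-n) x ∈ augSub k V * D.L i := by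
    intro x hx
    rw [← D.gruProj_mk_eq_zero_iff (hY := D.L_add_two_le i)]
    refine (bad_le _ n (fun a ha y => ?_) fun m hm y hy => ?_ :
      _ ≤ LinearMap.ker (D.gruProj i (-n) (D.L_add_two_le i))) hx
    · obtain ⟨t, ht, rfl⟩ := D.exists_mem_augSub ha
      obtain ⟨y, rfl⟩ := D.gruMk_surjective _ y
      rw [LinearMap.mem_ker, π_smul_gruMk, gruProj_mk_eq_zero_iff]
      exact (Homog.mul homog_augSub (D.homog_L i)).zp_mem _ (Submodule.mul_mem_mul ht y.2)
    · obtain ⟨z, hz, rfl⟩ := D.mem_gruDeg_iff.1 hy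
      rw [LinearMap.mem_ker, gruProj_mk_eq_zero_iff, (wordGrading k V).zp_ne hm hz]
      exact zero_mem _
  have hbad' : ∀ x : D.L (i + 1),
      D.gruToSyz i x ∈ bad D (subDeg (D.gruGrading i).deg (D.gruSyz i)) n →
      (wordGrading k V).zp (-n) x ∈ D.govB i := by
    intro x hx
    have hY : D.L (i + 2) ≤ D.govB i := le_sup_right
    have h1 := (bad_le _ n (fun a ha y => ?_) fun m hm y hy => ?_ :
      _ ≤ LinearMap.ker ((D.gruProj i (-n) hY).comp ((D.gruSyz i).subtype.restrictScalars k))) hx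
    · exact (D.gruProj_mk_eq_zero_iff (hY := hY) (x := D.lIncl i x)).1 h1
    · obtain ⟨t, ht, rfl⟩ := D.exists_mem_augSub ha
      obtain ⟨y, rfl⟩ := D.gruToSyz_surjective i y
      refine (D.gruProj_mk_eq_zero_iff (hY := hY) (x := D.lMul i t (D.lIncl i y))).2 ?_
      exact Submodule.mem_sup_left ((Homog.mul homog_augSub (D.homog_L (i + 1))).zp_mem _
        (Submodule.mul_mem_mul ht y.2))
    · obtain ⟨y, rfl⟩ := D.gruToSyz_surjective i y
      obtain ⟨z, hz, hzy⟩ := D.mem_gruDeg_iff.1 hy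
      change D.gruProj i (-n) hY (D.gruMk i (D.lIncl i y)) = 0
      change D.gruMk i z = D.gruMk i (D.lIncl i y) at hzy
      rw [← hzy, gruProj_mk_eq_zero_iff, (wordGrading k V).zp_ne hm hz]
      exact zero_mem _
  have hmem : ∀ x : D.L i, (x : TensorAlgebra k V) ∈ augSub k V * D.L i →
      D.gruMk i x ∈ bad D (D.gruGrading i).deg n := by
    intro x hx
    have h1 : augSub k V * D.L i ≤
        ((bad D (D.gruGrading i).deg n).comap (D.gruMk i)).map (D.L i).subtype :=
      Submodule.mul_le.2 fun t ht y hy => ⟨D.lMul i t ⟨y, hy⟩,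
        smul_mem_bad (D := D) _ n (a := D.π t) ht (D.gruMk i ⟨y, hy⟩), rfl⟩
    obtain ⟨y, hy, hyx⟩ := h1 hx
    rwa [← Subtype.ext hyx]
  have hmem' : ∀ x : D.L (i + 1), (x : TensorAlgebra k V) ∈ D.govB i →
      D.gruToSyz i x ∈ bad D (subDeg (D.gruGrading i).deg (D.gruSyz i)) n := by
    intro x hx
    have h1 : D.govB i ≤ ((bad D (subDeg (D.gruGrading i).deg (D.gruSyz i)) n).comap
        (D.gruToSyz i)).map (D.L (i + 1)).subtype := by
      refine sup_le (Submodule.mul_le.2 fun t ht y hy => ⟨D.lMul (i + 1) t ⟨y, hy⟩,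
        smul_mem_bad (D := D) _ n (a := D.π t) ht (D.gruToSyz i ⟨y, hy⟩), rfl⟩) fun y hy =>
        ⟨⟨y, D.L_succ_le (i + 1) hy⟩, ?_, rfl⟩
      have : D.gruToSyz i ⟨y, D.L_succ_le (i + 1) hy⟩ = 0 :=
        Subtype.ext (D.gruMk_eq_zero_iff.2 hy)
      rw [SetLike.mem_coe, Submodule.mem_comap, this]
      exact zero_mem _
    obtain ⟨y, hy, hyx⟩ := h1 hx
    rwa [← Subtype.ext hyx]
  have hgB : D.govB i ≤ D.L (i + 1) :=
    sup_le (Submodule.mul_le.2 fun t _ y hy => D.mul_mem_L _ t hy) (D.L_succ_le _)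
  obtain ⟨e₁⟩ : Nonempty (Subquotient ((D.govZ i (-n)).comap (D.L (i + 1)).subtype)
      ((D.govB i).comap (D.L (i + 1)).subtype) ≃ₗ[k]
        Subquotient (D.govZ i (-n)) (D.govB i)) := by
    refine nonempty_subquotient_equiv (D.L (i + 1)).subtype (fun z hz => hz) (fun z hz => ?_)
      fun z _ => Iff.rfl
    exact ⟨⟨z, hz.1.1⟩, hz, by simp⟩
  obtain ⟨e₂⟩ : Nonempty (Subquotient ((D.govZ i (-n)).comap (D.L (i + 1)).subtype)
      ((D.govB i).comap (D.L (i + 1)).subtype) ≃ₗ[k]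
      Subquotient ((bad D (D.gruGrading i).deg n).comap ((D.gruSyz i).subtype.restrictScalars k))
        (bad D (subDeg (D.gruGrading i).deg (D.gruSyz i)) n)) := by
    refine nonempty_subquotient_equiv (D.gruToSyz i) (fun z hz => hmem (D.lIncl i z) hz.1.2)
      (fun z hz => ?_) fun z hz => ⟨fun h => ?_, hmem' z⟩
    · obtain ⟨x, rfl⟩ := D.gruToSyz_surjective i z
      have h1 := hbad (D.lIncl i x) hz
      have h2 := (D.homog_L (i + 1)).zp_mem (-n) x.2
      refine ⟨⟨_, h2⟩, ⟨⟨h2, h1⟩, (wordGrading k V).zp_mem _ _⟩, ?_⟩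
      rw [← map_sub]
      have h3 := (D.homog_L (i + 1)).sub_zp_mem (-n)
        (Q := ((bad D (subDeg (D.gruGrading i).deg (D.gruSyz i)) n).comap
          (D.gruToSyz i)).map (D.L (i + 1)).subtype) (fun m hm y hy hym => ?_) x.2
      · obtain ⟨y, hy, hyx⟩ := h3
        have : x - ⟨_, h2⟩ = y := Subtype.ext hyx.symm
        rwa [this]
      · refine ⟨⟨y, hy⟩, mem_bad_of_mem_deg (D := D) _ n hm ?_, rfl⟩
        change D.gruMk i (D.lIncl i ⟨y, hy⟩) ∈ (D.gruGrading i).deg m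
        refine D.mem_gruDeg_iff.2 ⟨D.lIncl i ⟨y, hy⟩, ?_, rfl⟩
        rw [← wordGrading_zG, NatGrading.zG_natCast]
        exact hym
    · have h1 := hbad' z h
      have h2 : (wordGrading k V).zp (-n) (z : TensorAlgebra k V) = z :=
        (wordGrading k V).zp_same hz.2
      rwa [h2] at h1
  exact ⟨e₁.symm.trans e₂⟩

theorem nonempty_gru_homQuot_equiv (i : ℕ) (n : ℤ) :
    Nonempty (HomQuot (D.gruComplex.deg i) (D.gruComplex.syz i) n ≃ₗ[k]
      Module.Dual k (Subquotient (D.govZ i (-n)) (D.govB i))) := by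
  obtain ⟨e⟩ := D.nonempty_gru_subquotient_equiv i n
  obtain ⟨e'⟩ := nonempty_homQuot_equiv_dual (D.gruGrading i).deg n (D.gruSyz i)
  exact ⟨e'.trans e.dualMap⟩

/-- Ext becomes the dual of a subquotient of `T(V)` expressed through `I` and `T_+` only. This makes
the comparison with the opposite algebra possible without relating left and right modules. -/
theorem GradedProjRes.nonempty_extDeg_succ_equiv_dual {D : Relations k V}
    (Q : GradedProjRes.{u, v, w} D) (i : ℕ) (n : ℤ) :
    Nonempty (Q.ExtDeg (i + 1) n ≃ₗ[k]
      Module.Dual k (Subquotient (D.govZ i (-n)) (D.govB i))) := by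
  obtain ⟨e⟩ := Q.nonempty_extDeg_succ_equiv i n
  obtain ⟨e'⟩ := GrComplex.nonempty_homQuot_equiv (X := Q.toGrComplex) (Y := D.gruComplex) i
    (fun j _ => Q.exactAt j) (fun j _ => D.gruComplex_exactAt j) n
  obtain ⟨e''⟩ := D.nonempty_gru_homQuot_equiv i n
  exact ⟨e.symm.trans (e'.trans e'')⟩

end Relations

/-! ### Gradings of images and of tensor products -/

namespace NatGrading

variable {k : Type u} [Field k] {M : Type w} [AddCommGroup M] [Module k M]
  {M' : Type w'} [AddCommGroup M'] [Module k M']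

/-- The grading induced on the image of a surjective map with homogeneous kernel. -/
def map (g : NatGrading k M) (f : M →ₗ[k] M') (hf : Function.Surjective f)
    (hN : g.Homog (LinearMap.ker f)) : NatGrading k M' where
  G n := (g.G n).map f
  p n := ((LinearMap.ker f).liftQ (f.comp (g.p n)) fun _ hx => hN.p_mem n hx).comp
    (f.quotKerEquivOfSurjective hf).symm.toLinearMap
  p_same n x hx := by
    obtain ⟨x, hx, rfl⟩ := hx
    have : (f.quotKerEquivOfSurjective hf).symm (f x) = (LinearMap.ker f).mkQ x := by
      rw [LinearEquiv.symm_apply_eq]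
      rfl
    rw [LinearMap.comp_apply, LinearEquiv.coe_coe, this]
    change f (g.p n x) = _
    rw [g.p_same n x hx]
  p_ne m n h x hx := by
    obtain ⟨x, hx, rfl⟩ := hx
    have : (f.quotKerEquivOfSurjective hf).symm (f x) = (LinearMap.ker f).mkQ x := by
      rw [LinearEquiv.symm_apply_eq]
      rfl
    rw [LinearMap.comp_apply, LinearEquiv.coe_coe, this]
    change f (g.p n x) = _
    rw [g.p_ne m n h x hx, map_zero]
  iSup_G := by rw [← Submodule.map_iSup, g.iSup_G, Submodule.map_top, LinearMap.range_eq_top.2 hf]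

section tensor

variable (g : NatGrading k M) (g' : NatGrading k M')

theorem tensor_p_tmul {a b n : ℕ} {x : M} {y : M'} (hx : x ∈ g.G a) (hy : y ∈ g'.G b) :
    (∑ c ∈ Finset.HasAntidiagonal.antidiagonal n, TensorProduct.map (g.p c.1) (g'.p c.2)) (x ⊗ₜ[k] y) =
      if a + b = n then x ⊗ₜ[k] y else 0 := by
  rw [LinearMap.sum_apply]
  simp only [TensorProduct.map_tmul]
  split_ifs with h
  · rw [Finset.sum_eq_single (a, b)]
    · rw [g.p_same a x hx, g'.p_same b y hy]
    · rintro ⟨c, d⟩ - hcd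
      by_cases hc : a = c
      · have hd : b ≠ d := fun hd => hcd (by rw [hc, hd])
        rw [g'.p_ne b d hd y hy, TensorProduct.tmul_zero]
      · rw [g.p_ne a c hc x hx, TensorProduct.zero_tmul]
    · intro h'
      exact absurd (Finset.HasAntidiagonal.mem_antidiagonal.2 h) h'
  · refine Finset.sum_eq_zero fun c hc => ?_
    rw [Finset.HasAntidiagonal.mem_antidiagonal] at hc
    by_cases hc' : a = c.1
    · have hd : b ≠ c.2 := by omega
      rw [g'.p_ne b _ hd y hy, TensorProduct.tmul_zero]
    · rw [g.p_ne a _ hc' x hx, TensorProduct.zero_tmul]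

/-- The total grading of a tensor product. -/
def tensor : NatGrading k (M ⊗[k] M') where
  G n := ⨆ c ∈ Finset.HasAntidiagonal.antidiagonal n, Submodule.map₂ (TensorProduct.mk k M M') (g.G c.1) (g'.G c.2)
  p n := ∑ c ∈ Finset.HasAntidiagonal.antidiagonal n, TensorProduct.map (g.p c.1) (g'.p c.2)
  p_same n x hx := by
    refine (iSup₂_le fun c hc => Submodule.map₂_le.2 fun x hx y hy => ?_ :
      _ ≤ LinearMap.eqLocus _ LinearMap.id) hx
    rw [Finset.HasAntidiagonal.mem_antidiagonal] at hc
    exact (tensor_p_tmul g g' hx hy).trans (if_pos hc)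
  p_ne m n h x hx := by
    refine (iSup₂_le fun c hc => Submodule.map₂_le.2 fun x hx y hy => ?_ :
      _ ≤ LinearMap.ker _) hx
    rw [Finset.HasAntidiagonal.mem_antidiagonal] at hc
    exact (tensor_p_tmul g g' hx hy).trans (if_neg (by omega))
  iSup_G := by
    rw [eq_top_iff, ← TensorProduct.map₂_mk_top_top_eq_top, ← g.iSup_G, ← g'.iSup_G]
    rw [Submodule.map₂_iSup_left]
    refine iSup_le fun a => ?_
    rw [Submodule.map₂_iSup_right]
    exact iSup_le fun b => le_iSup_of_le (a + b)
      (le_iSup₂_of_le (a, b) (Finset.HasAntidiagonal.mem_antidiagonal.2 rfl) le_rfl)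

theorem tmul_mem_tensor {a b n : ℕ} {x : M} {y : M'} (hx : x ∈ g.G a) (hy : y ∈ g'.G b)
    (h : a + b = n) : x ⊗ₜ[k] y ∈ (g.tensor g').G n :=
  (le_iSup₂_of_le (a, b) (Finset.HasAntidiagonal.mem_antidiagonal.2 h) le_rfl :
    Submodule.map₂ (TensorProduct.mk k M M') (g.G a) (g'.G b) ≤ _)
    (Submodule.apply_mem_map₂ _ hx hy)

variable {g g'} in
theorem map₂_mk_le_of_homog {N : Submodule k M} {N' : Submodule k M'} (hN : g.Homog N)
    (hN' : g'.Homog N') {Q : Submodule k (M ⊗[k] M')}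
    (h : ∀ a, ∀ x ∈ N, x ∈ g.G a → ∀ b, ∀ y ∈ N', y ∈ g'.G b → x ⊗ₜ[k] y ∈ Q) :
    Submodule.map₂ (TensorProduct.mk k M M') N N' ≤ Q := by
  refine (Submodule.map₂_le_map₂ hN hN').trans ?_
  rw [Submodule.map₂_iSup_left]
  refine iSup_le fun a => ?_
  rw [Submodule.map₂_iSup_right]
  exact iSup_le fun b => Submodule.map₂_le.2 fun x hx y hy => h a x hx.1 hx.2 b y hy.1 hy.2

variable {g g'} in
theorem Homog.map₂_mk {N : Submodule k M} {N' : Submodule k M'} (hN : g.Homog N)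
    (hN' : g'.Homog N') :
    (g.tensor g').Homog (Submodule.map₂ (TensorProduct.mk k M M') N N') :=
  map₂_mk_le_of_homog hN hN' fun a _ hx hxa b _ hy hyb => Submodule.mem_iSup_of_mem (a + b)
    ⟨Submodule.apply_mem_map₂ _ hx hy, tmul_mem_tensor g g' hxa hyb rfl⟩

end tensor

end NatGrading

namespace Relations

variable {k : Type u} {V : Type v} [Field k] [AddCommGroup V] [Module k V] (D : Relations k V)

/-! ### The numbers `n_s(i)` -/

theorem nn_zero (s : ℕ) : nn s 0 = 0 := by simp [nn]

theorem nn_one (s : ℕ) : nn s 1 = 1 := by simp [nn]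

theorem nn_add_two (s i : ℕ) : nn s (i + 2) = nn s i + s := by
  have h1 : (i + 2) / 2 = i / 2 + 1 := by omega
  have h2 : (i + 2) % 2 = i % 2 := by omega
  rw [nn, nn, h1, h2]
  ring

theorem nn_lt_nn_succ {s : ℕ} (hs : 2 ≤ s) : ∀ i, nn s i < nn s (i + 1)
  | 0 => by rw [nn_zero, nn_one]; omega
  | 1 => by rw [nn_add_two, nn_zero, nn_one]; omega
  | i + 2 => by
    rw [nn_add_two, show i + 2 + 1 = i + 1 + 2 by ring, nn_add_two]
    have := nn_lt_nn_succ hs i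
    omega

theorem nn_lt_nn {s t i : ℕ} (hst : s < t) (hi : 2 ≤ i) : nn s i < nn t i := by
  have : 0 < i / 2 := by omega
  rw [nn, nn]
  have := Nat.mul_lt_mul_of_pos_right hst this
  omega

theorem nn_ne_nn {s t i : ℕ} (hst : s ≠ t) (hi : 2 ≤ i) : nn s i ≠ nn t i := by
  rcases lt_or_gt_of_ne hst with h | h
  · exact (nn_lt_nn h hi).ne
  · exact (nn_lt_nn h hi).ne'

/-! ### The spaces `J_i` -/

theorem J_zero : D.J 0 = word k V 0 := rfl

theorem J_one : D.J 1 = word k V 1 := rfl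

theorem J_add_two (i : ℕ) : D.J (i + 2) = ⨆ s ∈ D.S, D.Js s (i + 2) := by
  rw [J, if_neg (by omega)]

theorem Js_le {s i j m : ℕ} (h : j + s + m = nn s i) :
    D.Js s i ≤ word k V j * D.R s * word k V m := by
  refine (iInf₂_le j (Finset.mem_range.2 (by omega))).trans ?_
  rw [show nn s i - s - j = m by omega]

theorem Js_le_word {s i : ℕ} (hs : s ∈ D.S) (hi : 2 ≤ i) : D.Js s i ≤ word k V (nn s i) := by
  obtain ⟨i, rfl⟩ : ∃ l, i = l + 2 := ⟨i - 2, by omega⟩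
  have h : 0 + s + nn s i = nn s (i + 2) := by rw [nn_add_two]; ring
  exact (D.Js_le h).trans (D.word_mul_R_mul_word_le_word hs h)

theorem Js_two (s : ℕ) : D.Js s 2 = D.R s := by
  have h : nn s 2 = s := by simp [nn]
  simp [Js, h]

theorem homog_J : ∀ i, (wordGrading k V).Homog (D.J i)
  | 0 => NatGrading.homog_of_le _ le_rfl
  | 1 => NatGrading.homog_of_le _ le_rfl
  | i + 2 => by
    rw [J_add_two]
    exact NatGrading.homog_iSup _ fun s => NatGrading.homog_iSup _ fun hs =>
      NatGrading.homog_of_le _ (D.Js_le_word hs (by omega))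

/-- For a fixed index at least `2` the lengths `n_s` are pairwise distinct, so each length meets at
most one summand. -/
theorem eq_zero_or_mem_Js {i d : ℕ} {x : TensorAlgebra k V} (hx : x ∈ D.J (i + 2))
    (hxd : x ∈ word k V d) : x = 0 ∨ ∃ s ∈ D.S, d = nn s (i + 2) ∧ x ∈ D.Js s (i + 2) := by
  rw [← (wordGrading k V).p_same d x hxd]
  rw [J_add_two] at hx
  by_cases h : ∃ s ∈ D.S, d = nn s (i + 2)
  · obtain ⟨s, hs, rfl⟩ := h
    refine Or.inr ⟨s, hs, rfl, ?_⟩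
    refine (iSup₂_le fun t ht y hy => ?_ : _ ≤ (D.Js s (i + 2)).comap _) hx
    rw [Submodule.mem_comap]
    have hy' := D.Js_le_word ht (by omega) hy
    by_cases hst : s = t
    · subst hst
      rwa [(wordGrading k V).p_same _ y hy']
    · rw [(wordGrading k V).p_ne _ _ (nn_ne_nn (Ne.symm hst) (by omega)) y hy']
      exact zero_mem _
  · left
    refine (iSup₂_le fun t ht y hy => ?_ : _ ≤ LinearMap.ker _) hx
    exact (wordGrading k V).p_ne _ _ (fun h' => h ⟨t, ht, h'.symm⟩) y
      (D.Js_le_word ht (by omega) hy)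

/-- Among the positions of `R_s` in the longer word, keep those at least `n_s(i+3) - n_s(i+2)`.
Shifted by this number they are exactly the positions required for the shorter word, and the common
prefix can be taken out of the intersection because `V` is finite-dimensional. -/
theorem Js_succ_le [FiniteDimensional k V] {s i : ℕ} (hs : s ∈ D.S) :
    D.Js s (i + 3) ≤ word k V (nn s (i + 3) - nn s (i + 2)) * D.Js s (i + 2) := by
  have h2 : nn s (i + 2) = nn s i + s := nn_add_two s i
  have hlt : nn s (i + 2) < nn s (i + 3) := nn_lt_nn_succ (D.two_le s hs) (i + 2)
  intro x hx
  have : Nonempty (Finset.range (nn s (i + 2) - s + 1)) := ⟨⟨0, by simp⟩⟩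
  have h1 := mem_word_mul_iInf (p := nn s (i + 3) - nn s (i + 2))
    (Y := fun j : Finset.range (nn s (i + 2) - s + 1) =>
      word k V j * D.R s * word k V (nn s (i + 2) - s - j)) (x := x) fun j => by
    have hj := Finset.mem_range.1 j.2
    rw [← mul_assoc, ← mul_assoc, ← word_add]
    exact D.Js_le (by omega) hx
  rw [iInf_subtype] at h1
  exact h1

/-! ### The differential -/

theorem rTensor_mul'_assoc_symm_tmul (a : D.Alg) (z : D.Alg ⊗[k] TensorAlgebra k V) :
    (LinearMap.mul' k D.Alg).rTensor (TensorAlgebra k V)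
      ((TensorProduct.assoc k D.Alg D.Alg (TensorAlgebra k V)).symm (a ⊗ₜ z)) = a • z := by
  induction z using TensorProduct.induction_on with
  | zero => rw [TensorProduct.tmul_zero, LinearEquiv.map_zero, LinearMap.map_zero, smul_zero]
  | tmul c t => rfl
  | add z z' hz hz' =>
    rw [TensorProduct.tmul_add, LinearEquiv.map_add, LinearMap.map_add, smul_add, hz, hz']

theorem δLeft_tmul_eq (i : ℕ) (a : D.Alg) (w : TensorAlgebra k V) :
    D.δLeft i (a ⊗ₜ w) = a • D.π.toLinearMap.rTensor _ (D.cutLeft i w) :=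
  D.rTensor_mul'_assoc_symm_tmul a _

theorem δLeft_smul (i : ℕ) (a : D.Alg) (x : D.Alg ⊗[k] TensorAlgebra k V) :
    D.δLeft i (a • x) = a • D.δLeft i x := by
  induction x using TensorProduct.induction_on with
  | zero => rw [smul_zero, LinearMap.map_zero, smul_zero]
  | tmul b w => rw [TensorProduct.smul_tmul', δLeft_tmul_eq, δLeft_tmul_eq, smul_eq_mul, mul_smul]
  | add x y hx hy => rw [smul_add, LinearMap.map_add, LinearMap.map_add, hx, hy, smul_add]

theorem δLeft_tmul (i : ℕ) (a : D.Alg) (w : TensorAlgebra k V) :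
    D.δLeft i (a ⊗ₜ w) = a • D.δLeft i (1 ⊗ₜ w) := by
  rw [← δLeft_smul, TensorProduct.smul_tmul', smul_eq_mul, mul_one]

theorem δLeft_one_tmul (i : ℕ) (w : TensorAlgebra k V) :
    D.δLeft i (1 ⊗ₜ w) = D.π.toLinearMap.rTensor _ (D.cutLeft i w) := by
  rw [δLeft_tmul_eq, one_smul]

theorem cutLeft_one (w : TensorAlgebra k V) : D.cutLeft 1 w = cut k V 1 w := by
  rw [cutLeft, if_pos rfl]

theorem cutLeft_of_mem {s i : ℕ} (hs : s ∈ D.S) {w : TensorAlgebra k V}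
    (hw : w ∈ word k V (nn s (i + 1))) :
    D.cutLeft (i + 1) w = cut k V (nn s (i + 1) - nn s i) w := by
  rcases Nat.eq_zero_or_pos i with rfl | hi
  · rw [cutLeft_one, nn_zero, nn_one]
  · rw [cutLeft, if_neg (by omega), LinearMap.sum_apply, Finset.sum_eq_single s]
    · rw [LinearMap.comp_apply]
      congr 1
      exact (wordGrading k V).p_same _ w hw
    · intro t ht hts
      rw [LinearMap.comp_apply]
      have : GradedAlgebra.proj (fun n : ℕ => LinearMap.range (TensorAlgebra.ι k (M := V)) ^ n)
          (nn t (i + 1)) w = 0 :=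
        (wordGrading k V).p_ne _ _ (nn_ne_nn (Ne.symm hts) (by omega)) w hw
      rw [this, map_zero]
    · exact fun h => absurd hs h

/-- The differential `δ_{i+1}` cuts words of length `p + q` after `p` letters. -/
def CutsAt (i p q : ℕ) : Prop :=
  ∀ u ∈ word k V p, ∀ w ∈ word k V q, D.δLeft (i + 1) (1 ⊗ₜ (u * w)) = D.π u ⊗ₜ w

theorem cutsAt {s : ℕ} (hs : s ∈ D.S) (i : ℕ) :
    D.CutsAt i (nn s (i + 1) - nn s i) (nn s i) := fun u hu w hw => by
  have hlt := nn_lt_nn_succ (D.two_le s hs) i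
  have huw : u * w ∈ word k V (nn s (i + 1)) := by
    rw [show nn s (i + 1) = nn s (i + 1) - nn s i + nn s i by omega, word_add]
    exact Submodule.mul_mem_mul hu hw
  rw [δLeft_one_tmul, D.cutLeft_of_mem hs huw, cut_mul hu]
  rfl

theorem cutsAt_zero : D.CutsAt 0 1 0 := fun u hu w _ => by
  rw [δLeft_one_tmul, zero_add, cutLeft_one, cut_mul hu]
  rfl

/-- `J_{i+1}` itself is not spanned by products `u w` lying in it, but it is contained in the span
of products of words with elements of `J_i`, on each of which the differential is an explicit cut.
Linear statements about the differential can be checked on these products. -/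
theorem J_succ_induction [FiniteDimensional k V] (i : ℕ) {Q : Submodule k (TensorAlgebra k V)}
    (h : ∀ p q, 0 < p → D.CutsAt i p q → ∀ u ∈ word k V p, ∀ w ∈ D.J i, w ∈ word k V q →
      u * w ∈ Q) : D.J (i + 1) ≤ Q := by
  match i with
  | 0 =>
    rw [zero_add, J_one, ← mul_one (word k V 1), ← word_zero]
    exact Submodule.mul_le.2 fun u hu w hw => h 1 0 one_pos D.cutsAt_zero u hu w hw hw
  | 1 =>
    rw [J_add_two]
    refine iSup₂_le fun s hs => ?_
    have h2 := D.two_le s hs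
    have hc := D.cutsAt hs 1
    have hn : nn s 2 = s := by simp [nn]
    rw [nn_one, hn] at hc
    rw [Js_two]
    refine (D.le_word s hs).trans ?_
    rw [show s = s - 1 + 1 by omega, word_add]
    exact Submodule.mul_le.2 fun u hu w hw => h _ 1 (by omega) hc u hu w hw hw
  | i + 2 =>
    rw [show i + 2 + 1 = i + 1 + 2 by ring, J_add_two]
    refine iSup₂_le fun s hs => (D.Js_succ_le hs).trans ?_
    have hlt := nn_lt_nn_succ (D.two_le s hs) (i + 2)
    refine Submodule.mul_le.2 fun u hu w hw => h _ _ (by omega) (D.cutsAt hs (i + 2)) u hu w ?_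
      (D.Js_le_word hs (by omega) hw)
    rw [J_add_two]
    exact Submodule.mem_iSup_of_mem s (Submodule.mem_iSup_of_mem hs hw)

theorem KLeft_eq (i : ℕ) : D.KLeft i =
    Submodule.map₂ (TensorProduct.mk k D.Alg (TensorAlgebra k V)) ⊤ (D.J i) := by
  apply le_antisymm
  · rintro _ ⟨x, rfl⟩
    induction x using TensorProduct.induction_on with
    | zero => simp
    | tmul a j => exact Submodule.apply_mem_map₂ _ trivial j.2
    | add x y hx hy => rw [map_add]; exact add_mem hx hy
  · exact Submodule.map₂_le.2 fun a _ j hj => ⟨a ⊗ₜ ⟨j, hj⟩, rfl⟩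

theorem tmul_mem_KLeft {i : ℕ} (a : D.Alg) {j : TensorAlgebra k V} (hj : j ∈ D.J i) :
    a ⊗ₜ j ∈ D.KLeft i := ⟨a ⊗ₜ ⟨j, hj⟩, rfl⟩

/-- The grading of `A`. -/
def algGrading : NatGrading k D.Alg :=
  (wordGrading k V).map D.π.toLinearMap D.π_surjective (by rw [ker_π]; exact D.homog_idealSub)

/-- The total grading of `A ⊗ T(V)`. -/
def totGrading : NatGrading k (D.Alg ⊗[k] TensorAlgebra k V) :=
  D.algGrading.tensor (wordGrading k V)

theorem tmul_mem_tot {a b n : ℕ} {x : D.Alg} {y : TensorAlgebra k V} (hx : x ∈ D.algDeg a)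
    (hy : y ∈ word k V b) (h : a + b = n) : x ⊗ₜ y ∈ D.totGrading.G n :=
  NatGrading.tmul_mem_tensor D.algGrading (wordGrading k V) hx hy h

theorem algDeg_mul {m n : ℕ} {a b : D.Alg} (ha : a ∈ D.algDeg m) (hb : b ∈ D.algDeg n) :
    a * b ∈ D.algDeg (m + n) := by
  obtain ⟨x, hx, rfl⟩ := ha
  obtain ⟨y, hy, rfl⟩ := hb
  refine ⟨x * y, ?_, map_mul D.π x y⟩
  rw [word_add]
  exact Submodule.mul_mem_mul hx hy

theorem smul_mem_tot {m n : ℕ} {a : D.Alg} {x : D.Alg ⊗[k] TensorAlgebra k V}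
    (ha : a ∈ D.algDeg m) (hx : x ∈ D.totGrading.G n) : a • x ∈ D.totGrading.G (m + n) := by
  refine (iSup₂_le fun c hc => Submodule.map₂_le.2 fun x hx y hy => ?_ :
    D.totGrading.G n ≤ (D.totGrading.G (m + n)).comap
      (Algebra.lsmul k k (D.Alg ⊗[k] TensorAlgebra k V) a)) hx
  rw [Finset.HasAntidiagonal.mem_antidiagonal] at hc
  exact D.tmul_mem_tot (D.algDeg_mul ha hx) hy (by omega)

theorem smul_mem_totZ {m : ℕ} {n : ℤ} {a : D.Alg} {x : D.Alg ⊗[k] TensorAlgebra k V}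
    (ha : a ∈ D.algDeg m) (hx : x ∈ D.totGrading.zG n) : a • x ∈ D.totGrading.zG (m + n) := by
  rcases lt_or_ge n 0 with hn | hn
  · rw [NatGrading.zG_of_neg _ hn, Submodule.mem_bot] at hx
    rw [hx, smul_zero]
    exact zero_mem _
  · lift n to ℕ using hn
    rw [NatGrading.zG_natCast] at hx
    rw [← Nat.cast_add, NatGrading.zG_natCast]
    exact D.smul_mem_tot ha hx

theorem KLeft_le {i : ℕ} {Q : Submodule k (D.Alg ⊗[k] TensorAlgebra k V)}
    (h : ∀ m, ∀ a ∈ D.algDeg m, ∀ n, ∀ j ∈ D.J i, j ∈ word k V n → a ⊗ₜ j ∈ Q) :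
    D.KLeft i ≤ Q := by
  rw [KLeft_eq]
  exact NatGrading.map₂_mk_le_of_homog (g := D.algGrading) (NatGrading.homog_top _) (D.homog_J i)
    fun m a _ ha n j hj hjn => h m a ha n j hj hjn

theorem homog_KLeft (i : ℕ) : D.totGrading.Homog (D.KLeft i) := by
  rw [KLeft_eq]
  exact NatGrading.Homog.map₂_mk (NatGrading.homog_top _) (D.homog_J i)

theorem δLeft_one_tmul_mem [FiniteDimensional k V] {i : ℕ} {j : TensorAlgebra k V}
    (hj : j ∈ D.J (i + 1)) : D.δLeft (i + 1) (1 ⊗ₜ j) ∈ D.KLeft i := by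
  refine (D.J_succ_induction i fun p q _ hc u hu w hw hwq => ?_ : _ ≤ (D.KLeft i).comap
    ((D.δLeft (i + 1)).comp (TensorProduct.mk k _ _ 1))) hj
  rw [Submodule.mem_comap, LinearMap.comp_apply, TensorProduct.mk_apply, hc u hu w hwq]
  exact D.tmul_mem_KLeft _ hw

theorem δLeft_one_tmul_mem_tot [FiniteDimensional k V] {i n : ℕ} {j : TensorAlgebra k V}
    (hj : j ∈ D.J (i + 1)) (hjn : j ∈ word k V n) :
    D.δLeft (i + 1) (1 ⊗ₜ j) ∈ D.totGrading.G n := by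
  have h1 : ∀ x ∈ D.J (i + 1), D.totGrading.p n (D.δLeft (i + 1) (1 ⊗ₜ x)) =
      D.δLeft (i + 1) (1 ⊗ₜ ((wordGrading k V).p n x)) := by
    intro x hx
    refine (D.J_succ_induction i fun p q _ hc u hu w hw hwq => ?_ : _ ≤ LinearMap.eqLocus
      ((D.totGrading.p n).comp ((D.δLeft (i + 1)).comp (TensorProduct.mk k _ _ 1)))
      ((D.δLeft (i + 1)).comp ((TensorProduct.mk k _ _ 1).comp ((wordGrading k V).p n)))) hx
    have huw : u * w ∈ (wordGrading k V).G (p + q) := by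
      rw [wordGrading_G, word_add]
      exact Submodule.mul_mem_mul hu hwq
    have hπ : D.π u ⊗ₜ w ∈ D.totGrading.G (p + q) := D.tmul_mem_tot ⟨u, hu, rfl⟩ hwq rfl
    rw [LinearMap.mem_eqLocus]
    simp only [LinearMap.comp_apply, TensorProduct.mk_apply]
    by_cases hn : p + q = n
    · subst hn
      rw [(wordGrading k V).p_same _ _ huw, hc u hu w hwq, D.totGrading.p_same _ _ hπ]
    · rw [(wordGrading k V).p_ne _ _ hn _ huw, hc u hu w hwq, D.totGrading.p_ne _ _ hn _ hπ]
      simp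
  have h2 := h1 j hj
  rw [(wordGrading k V).p_same n j hjn] at h2
  rw [← h2]
  exact D.totGrading.p_mem n _

theorem δLeft_tmul_mem_tot [FiniteDimensional k V] {i m n l : ℕ} {a : D.Alg}
    {j : TensorAlgebra k V} (ha : a ∈ D.algDeg m) (hj : j ∈ D.J (i + 1)) (hjn : j ∈ word k V n)
    (hl : m + n = l) : D.δLeft (i + 1) (a ⊗ₜ j) ∈ D.totGrading.G l := by
  rw [δLeft_tmul, ← hl]
  exact D.smul_mem_tot ha (D.δLeft_one_tmul_mem_tot hj hjn)

/-- `K(A)_i` as an `A`-submodule of `A ⊗ T(V)`. -/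
def KA (i : ℕ) : Submodule D.Alg (D.Alg ⊗[k] TensorAlgebra k V) where
  carrier := D.KLeft i
  add_mem' h h' := add_mem h h'
  zero_mem' := zero_mem (D.KLeft i)
  smul_mem' a x hx := by
    refine (D.KLeft_le fun m b hb n j hj hjn => ?_ : D.KLeft i ≤ (D.KLeft i).comap
      (Algebra.lsmul k k (D.Alg ⊗[k] TensorAlgebra k V) a)) hx
    exact D.tmul_mem_KLeft (a * b) hj

theorem δLeft_mem [FiniteDimensional k V] {i : ℕ} {x : D.Alg ⊗[k] TensorAlgebra k V}
    (hx : x ∈ D.KLeft (i + 1)) : D.δLeft (i + 1) x ∈ D.KLeft i := by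
  refine (D.KLeft_le fun m a _ n j hj _ => ?_ : _ ≤ (D.KLeft i).comap (D.δLeft (i + 1))) hx
  rw [Submodule.mem_comap, δLeft_tmul]
  exact (D.KA i).smul_mem a (D.δLeft_one_tmul_mem hj)

theorem p_δLeft [FiniteDimensional k V] {i : ℕ} (n : ℕ) {x : D.Alg ⊗[k] TensorAlgebra k V}
    (hx : x ∈ D.KLeft (i + 1)) :
    D.totGrading.p n (D.δLeft (i + 1) x) = D.δLeft (i + 1) (D.totGrading.p n x) := by
  refine (D.KLeft_le fun m a ha l j hj hjl => ?_ : _ ≤ LinearMap.eqLocus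
    ((D.totGrading.p n).comp (D.δLeft (i + 1))) ((D.δLeft (i + 1)).comp (D.totGrading.p n))) hx
  rw [LinearMap.mem_eqLocus, LinearMap.comp_apply, LinearMap.comp_apply]
  have h1 := D.tmul_mem_tot ha hjl rfl
  have h2 := D.δLeft_tmul_mem_tot ha hj hjl rfl
  by_cases hn : m + l = n
  · subst hn
    rw [D.totGrading.p_same _ _ h1, D.totGrading.p_same _ _ h2]
  · rw [D.totGrading.p_ne _ _ hn _ h1, D.totGrading.p_ne _ _ hn _ h2, map_zero]

theorem δLeft_mem_totZ [FiniteDimensional k V] {i : ℕ} {n : ℤ}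
    {x : D.Alg ⊗[k] TensorAlgebra k V} (hx : x ∈ D.KLeft (i + 1)) (hxn : x ∈ D.totGrading.zG n) :
    D.δLeft (i + 1) x ∈ D.totGrading.zG n := by
  rcases lt_or_ge n 0 with hn | hn
  · rw [NatGrading.zG_of_neg _ hn, Submodule.mem_bot] at hxn
    rw [hxn, map_zero]
    exact zero_mem _
  · lift n to ℕ using hn
    rw [NatGrading.zG_natCast] at *
    rw [← D.totGrading.p_same n x hxn, ← D.p_δLeft n hx]
    exact D.totGrading.p_mem _ _

/-- Two consecutive cuts have lengths `1` and `s - 1` in some order, so together they move exactly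
`s` letters into `A`. On `J_{i+2}^s` these letters form an element of `R_s`, whence `δδ = 0`. -/
theorem δLeft_δLeft_mul {s : ℕ} (hs : s ∈ D.S) (i : ℕ) {x w : TensorAlgebra k V}
    (hx : x ∈ word k V s) (hw : w ∈ word k V (nn s i)) :
    D.δLeft (i + 1) (D.δLeft (i + 2) (1 ⊗ₜ (x * w))) = D.π x ⊗ₜ w := by
  have h1 := nn_lt_nn_succ (D.two_le s hs) i
  have h2 : nn s (i + 1) < nn s (i + 2) := nn_lt_nn_succ (D.two_le s hs) (i + 1)
  have h3 := nn_add_two s i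
  have h4 : s = (nn s (i + 2) - nn s (i + 1)) + (nn s (i + 1) - nn s i) := by omega
  have hx' := hx
  rw [h4, word_add] at hx'
  refine Submodule.mul_induction_on hx' (fun u hu u' hu' => ?_) fun y z hy hz => ?_
  · have hw' : u' * w ∈ word k V (nn s (i + 1)) := by
      rw [show nn s (i + 1) = nn s (i + 1) - nn s i + nn s i by omega, word_add]
      exact Submodule.mul_mem_mul hu' hw
    rw [mul_assoc, D.cutsAt hs (i + 1) u hu _ hw', δLeft_tmul, D.cutsAt hs i u' hu' w hw,
      TensorProduct.smul_tmul', smul_eq_mul, map_mul]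
  · rw [add_mul, TensorProduct.tmul_add, map_add, map_add, hy, hz, map_add, TensorProduct.add_tmul]

theorem δLeft_δLeft (i : ℕ) {x : D.Alg ⊗[k] TensorAlgebra k V} (hx : x ∈ D.KLeft (i + 2)) :
    D.δLeft (i + 1) (D.δLeft (i + 2) x) = 0 := by
  refine (D.KLeft_le fun m a _ n j hj _ => ?_ : _ ≤ LinearMap.ker
    ((D.δLeft (i + 1)).comp (D.δLeft (i + 2)))) hx
  rw [LinearMap.mem_ker, LinearMap.comp_apply, δLeft_tmul, δLeft_smul]
  suffices D.δLeft (i + 1) (D.δLeft (i + 2) (1 ⊗ₜ j)) = 0 by rw [this, smul_zero]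
  rw [J_add_two] at hj
  refine (iSup₂_le fun s hs => ?_ : _ ≤ LinearMap.ker (((D.δLeft (i + 1)).comp
    (D.δLeft (i + 2))).comp (TensorProduct.mk k _ _ 1))) hj
  refine (D.Js_le (show 0 + s + nn s i = _ by rw [nn_add_two]; ring)).trans ?_
  rw [word_zero, one_mul]
  refine Submodule.mul_le.2 fun x hx w hw => ?_
  refine (D.δLeft_δLeft_mul hs i (D.le_word s hs hx) hw).trans ?_
  rw [D.π_eq_zero_iff.2 (D.R_le_idealSub hs hx), TensorProduct.zero_tmul]

theorem augLeft_tmul (a : D.Alg) (w : TensorAlgebra k V) :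
    D.augLeft (a ⊗ₜ w) = D.ε a * TensorAlgebra.algebraMapInv w := rfl

theorem augLeft_smul (a : D.Alg) (x : D.Alg ⊗[k] TensorAlgebra k V) :
    D.augLeft (a • x) = D.ε a * D.augLeft x := by
  induction x using TensorProduct.induction_on with
  | zero => simp
  | tmul b w => rw [TensorProduct.smul_tmul', augLeft_tmul, augLeft_tmul, smul_eq_mul, map_mul,
      mul_assoc]
  | add x y hx hy => simp only [smul_add, map_add, hx, hy, mul_add]

theorem ε_algDeg_succ {n : ℕ} {a : D.Alg} (ha : a ∈ D.algDeg (n + 1)) : D.ε a = 0 := by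
  obtain ⟨x, hx, rfl⟩ := ha
  exact algebraMapInv_word_succ n hx

theorem augLeft_δLeft (x : D.Alg ⊗[k] TensorAlgebra k V) (hx : x ∈ D.KLeft 1) :
    D.augLeft (D.δLeft 1 x) = 0 := by
  refine (D.KLeft_le fun m a _ n j hj _ => ?_ : _ ≤ LinearMap.ker
    (D.augLeft.comp (D.δLeft 1))) hx
  rw [J_one] at hj
  have h1 := D.cutsAt_zero j hj 1 one_mem_word
  rw [mul_one, zero_add] at h1
  have h2 : D.ε (D.π j) = 0 := D.ε_algDeg_succ (n := 0) ⟨j, hj, rfl⟩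
  rw [LinearMap.mem_ker, LinearMap.comp_apply, δLeft_tmul, augLeft_smul, h1, augLeft_tmul,
    h2, zero_mul, mul_zero]

theorem augLeft_mem_trivDeg {n : ℤ} {x : D.Alg ⊗[k] TensorAlgebra k V}
    (hxn : x ∈ D.totGrading.zG n) : D.augLeft x ∈ trivDeg k n := by
  by_cases hn : n = 0
  · exact mem_trivDeg_zero hn _
  suffices D.augLeft x = 0 by rw [this]; exact zero_mem _
  rcases lt_or_ge n 0 with hn' | hn'
  · rw [NatGrading.zG_of_neg _ hn', Submodule.mem_bot] at hxn
    rw [hxn, map_zero]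
  · lift n to ℕ using hn'
    rw [NatGrading.zG_natCast] at hxn
    refine (iSup₂_le fun c hc => Submodule.map₂_le.2 fun a ha w hw => ?_ :
      D.totGrading.G n ≤ LinearMap.ker D.augLeft) hxn
    rw [Finset.HasAntidiagonal.mem_antidiagonal] at hc
    rw [TensorProduct.mk_apply, LinearMap.mem_ker, augLeft_tmul]
    obtain ⟨a', b'⟩ := c
    match a', b' with
    | m + 1, _ => rw [D.ε_algDeg_succ (n := m) ha, zero_mul]
    | 0, m + 1 => rw [algebraMapInv_word_succ m hw, mul_zero]
    | 0, 0 => exact absurd hc.symm (by exact_mod_cast hn)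

/-- `K(A)_i` as an `A`-module. -/
def KMod (i : ℕ) : Type (max u v) := D.KA i

instance (i : ℕ) : AddCommGroup (D.KMod i) := inferInstanceAs (AddCommGroup (D.KA i))

instance (i : ℕ) : Module D.Alg (D.KMod i) := inferInstanceAs (Module D.Alg (D.KA i))

instance (i : ℕ) : Module k (D.KMod i) := inferInstanceAs (Module k (D.KA i))

instance (i : ℕ) : IsScalarTower k D.Alg (D.KMod i) :=
  inferInstanceAs (IsScalarTower k D.Alg (D.KA i))

/-- The inclusion of `K(A)_i` into `A ⊗ T(V)`. -/
def kVal (i : ℕ) : D.KMod i →ₗ[k] D.Alg ⊗[k] TensorAlgebra k V where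
  toFun x := x.1
  map_add' _ _ := rfl
  map_smul' _ _ := rfl

/-- The grading of `K(A)_i`. -/
def kosDeg (i : ℕ) (n : ℤ) : AddSubgroup (D.KMod i) :=
  (D.totGrading.deg n).comap (D.kVal i).toAddMonoidHom

theorem isInternal_kosDeg (i : ℕ) : DirectSum.IsInternal (D.kosDeg i) := by
  have h := (NatGrading.restrict (D.homog_KLeft i)).isInternal_deg
  have he : (NatGrading.restrict (D.homog_KLeft i)).deg = fun n =>
      (D.totGrading.deg n).comap (D.KLeft i).subtype.toAddMonoidHom := by
    funext n
    ext x
    exact NatGrading.mem_deg_restrict _ (D.homog_KLeft i) n x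
  rw [he] at h
  exact h

instance projective_KMod (i : ℕ) : Module.Projective D.Alg (D.KMod i) := by
  let f : D.Alg ⊗[k] D.J i →ₗ[D.Alg] D.Alg ⊗[k] TensorAlgebra k V :=
    TensorProduct.AlgebraTensorModule.map LinearMap.id (D.J i).subtype
  have hf : Function.Injective f :=
    Module.Flat.lTensor_preserves_injective_linearMap _ (D.J i).injective_subtype
  have hr : LinearMap.range f = D.KA i := by
    ext x
    rfl
  exact Module.Projective.of_equiv ((LinearEquiv.ofInjective f hf).trans (LinearEquiv.ofEq _ _ hr))

/-- The left multi-Koszul complex as a complex of graded projective modules. -/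
def kosComplex [FiniteDimensional k V] : GrComplex.{u, v, max u v} D where
  P i := D.KMod i
  deg i := D.kosDeg i
  isInternal := D.isInternal_kosDeg
  smul_mem _ _ _ _ ha _ hx := D.smul_mem_totZ ha hx
  projective := D.projective_KMod
  d i :=
    { toFun x := ⟨D.δLeft (i + 1) x.1, D.δLeft_mem x.2⟩
      map_add' x y := Subtype.ext (map_add (D.δLeft (i + 1)) x.1 y.1)
      map_smul' a x := Subtype.ext (D.δLeft_smul _ a x.1) }
  d_mem i n x hx := D.δLeft_mem_totZ x.2 hx
  aug :=
    { toFun x := D.augLeft x.1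
      map_add' x y := map_add D.augLeft x.1 y.1
      map_smul' a x := D.augLeft_smul a x.1 }
  aug_mem n x hx := D.augLeft_mem_trivDeg hx
  aug_surjective c := ⟨⟨1 ⊗ₜ algebraMap k (TensorAlgebra k V) c, D.tmul_mem_KLeft 1 (by
      rw [J_zero, word_zero]; exact Submodule.algebraMap_mem c)⟩, by
    change D.ε 1 * TensorAlgebra.algebraMapInv (algebraMap k (TensorAlgebra k V) c) = c
    rw [map_one, one_mul]
    exact TensorAlgebra.algebraMap_leftInverse V c⟩
  aug_d x := D.augLeft_δLeft x.1 x.2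
  d_d i x := Subtype.ext (D.δLeft_δLeft i x.2)

end Relations

namespace Relations

variable {k : Type u} {V : Type v} [Field k] [AddCommGroup V] [Module k V] (D : Relations k V)

/-! ### Relations of small degree -/

theorem relLT_mono {s t : ℕ} (hst : s ≤ t) (n : ℕ) : D.relLT s n ≤ D.relLT t n :=
  iSup₂_mono fun _ _ => iSup_mono' fun h => ⟨h.trans_le hst, le_rfl⟩

/-- An ideal element of length `p < s` involves only relations of degree at most `p`; padding it on
the right keeps it inside the subspace that minimality separates from `R_s`. -/
theorem idealSub_inf_word_mul_word_le {p q s : ℕ} (hp : p < s) (hq : p + q = s) :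
    (D.idealSub ⊓ word k V p) * word k V q ≤ D.relLT s s := by
  refine (mul_le_mul' (D.idealSub_inf_word_le (Nat.lt_succ_self p)) le_rfl).trans
    ((D.relLT_mul_word_le _ _ _ le_rfl).trans ?_)
  rw [hq]
  exact D.relLT_mono hp s

variable {D} in
theorem CutsAt.eq {i p q : ℕ} (h : D.CutsAt i p q) {x : TensorAlgebra k V}
    (hx : x ∈ word k V p * word k V q) :
    D.δLeft (i + 1) (1 ⊗ₜ x) = D.π.toLinearMap.rTensor _ (cut k V p x) := by
  refine Submodule.mul_induction_on hx (fun u hu w hw => ?_) fun y z hy hz => ?_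
  · rw [h u hu w hw, cut_mul hu]
    rfl
  · rw [TensorProduct.tmul_add, map_add, map_add, map_add, hy, hz]

variable {D} in
-- After the cut, the differential only projects the first `p` letters to `A`, so by flatness its
-- kernel consists of words whose prefix is a relation in `A`.
theorem CutsAt.mem_of_eq_zero {i p q : ℕ} (h : D.CutsAt i p q) {x : TensorAlgebra k V}
    (hx : x ∈ word k V p * word k V q) (h0 : D.δLeft (i + 1) (1 ⊗ₜ x) = 0) :
    x ∈ (D.idealSub ⊓ word k V p) * word k V q := by
  rw [← ker_π]
  refine mem_mul_of_map_cut_eq_zero D.π.toLinearMap hx ?_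
  rw [← h.eq hx, h0]

/-! ### Decomposable elements of the multi-Koszul complex -/

/-- The part of degree `d` of `A_+ ⊗ J_i`. -/
def posPart (i d : ℕ) : Submodule k (D.Alg ⊗[k] TensorAlgebra k V) :=
  Submodule.span k {z | ∃ b e, 0 < b ∧ b + e = d ∧
    ∃ a ∈ D.algDeg b, ∃ j ∈ D.J i, j ∈ word k V e ∧ z = a ⊗ₜ j}

theorem tmul_mem_posPart {i d b e : ℕ} (hb : 0 < b) (hd : b + e = d) {a : D.Alg}
    (ha : a ∈ D.algDeg b) {j : TensorAlgebra k V} (hj : j ∈ D.J i) (hje : j ∈ word k V e) :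
    a ⊗ₜ j ∈ D.posPart i d :=
  Submodule.subset_span ⟨b, e, hb, hd, a, ha, j, hj, hje, rfl⟩

theorem posPart_le {i d : ℕ} {N : Submodule k (D.Alg ⊗[k] TensorAlgebra k V)}
    (h : ∀ b e, 0 < b → b + e = d → ∀ a ∈ D.algDeg b, ∀ j ∈ D.J i, j ∈ word k V e →
      a ⊗ₜ j ∈ N) : D.posPart i d ≤ N := by
  refine Submodule.span_le.2 ?_
  rintro _ ⟨b, e, hb, hd, a, ha, j, hj, hje, rfl⟩
  exact h b e hb hd a ha j hj hje

theorem posPart_le_KLeft (i d : ℕ) : D.posPart i d ≤ D.KLeft i :=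
  D.posPart_le fun _ _ _ _ a _ _ hj _ => D.tmul_mem_KLeft a hj

/-- Since `A_0 = k`, the degree `d` part of `A ⊗ J_i` is `1 ⊗ (J_i)_d` plus the part with positive
degree in `A`. -/
theorem exists_sub_mem_posPart {i d : ℕ} {z : D.Alg ⊗[k] TensorAlgebra k V} (hz : z ∈ D.KLeft i) :
    ∃ j ∈ D.J i, j ∈ word k V d ∧ D.totGrading.p d z - 1 ⊗ₜ j ∈ D.posPart i d := by
  have h : D.KLeft i ≤ ((D.J i ⊓ word k V d).map (TensorProduct.mk k D.Alg (TensorAlgebra k V) 1) ⊔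
      D.posPart i d).comap (D.totGrading.p d) := by
    refine D.KLeft_le fun m a ha n j hj hjn => ?_
    rw [Submodule.mem_comap]
    have h1 := D.tmul_mem_tot ha hjn rfl
    by_cases hmn : m + n = d
    · subst hmn
      rw [D.totGrading.p_same _ _ h1]
      rcases Nat.eq_zero_or_pos m with rfl | hm
      · obtain ⟨x, hx, rfl⟩ := ha
        rw [word_zero] at hx
        obtain ⟨c, rfl⟩ := Submodule.mem_one.1 hx
        refine Submodule.mem_sup_left ⟨c • j, ?_, ?_⟩
        · rw [zero_add]
          exact Submodule.smul_mem _ c ⟨hj, hjn⟩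
        · rw [TensorProduct.mk_apply, TensorProduct.tmul_smul, TensorProduct.smul_tmul',
            AlgHom.toLinearMap_apply, AlgHom.commutes, Algebra.algebraMap_eq_smul_one]
      · exact Submodule.mem_sup_right (D.tmul_mem_posPart hm rfl ha hj hjn)
    · rw [D.totGrading.p_ne _ _ hmn _ h1]
      exact zero_mem _
  obtain ⟨_, ⟨j, hj, rfl⟩, y, hy, hzy⟩ := Submodule.mem_sup.1 (h hz)
  refine ⟨j, hj.1, hj.2, ?_⟩
  rw [← hzy, TensorProduct.mk_apply, add_sub_cancel_left]
  exact hy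

theorem smul_mem_posPart {i c d : ℕ} (hc : 0 < c) {a : D.Alg} (ha : a ∈ D.algDeg c)
    {y : D.Alg ⊗[k] TensorAlgebra k V} (hy : y ∈ D.KLeft i) :
    D.totGrading.p d (a • y) ∈ D.posPart i d := by
  refine (D.KLeft_le fun m b hb n j hj hjn => ?_ : D.KLeft i ≤ (D.posPart i d).comap
    ((D.totGrading.p d).comp (Algebra.lsmul k k (D.Alg ⊗[k] TensorAlgebra k V) a))) hy
  change D.totGrading.p d ((a * b) ⊗ₜ j) ∈ D.posPart i d
  have h1 := D.algDeg_mul ha hb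
  have h2 := D.tmul_mem_tot h1 hjn rfl
  by_cases hd : c + m + n = d
  · subst hd
    rw [D.totGrading.p_same _ _ h2]
    exact D.tmul_mem_posPart (by omega) rfl h1 hj hjn
  · rw [D.totGrading.p_ne _ _ hd _ h2]
    exact zero_mem _

theorem p_smul_of_lt {c d : ℕ} (hc : d < c) {a : D.Alg} (ha : a ∈ D.algDeg c)
    (x : D.Alg ⊗[k] TensorAlgebra k V) : D.totGrading.p d (a • x) = 0 := by
  induction x using D.totGrading.induction with
  | h0 => rw [smul_zero, map_zero]
  | hadd x y hx hy => rw [smul_add, map_add, hx, hy, add_zero]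
  | hG n x hx => exact D.totGrading.p_ne _ _ (by omega) _ (D.smul_mem_tot ha hx)

theorem p_add_smul {c e : ℕ} {a : D.Alg} (ha : a ∈ D.algDeg c)
    (x : D.Alg ⊗[k] TensorAlgebra k V) :
    D.totGrading.p (c + e) (a • x) = a • D.totGrading.p e x := by
  induction x using D.totGrading.induction with
  | h0 => rw [smul_zero, map_zero, map_zero, smul_zero]
  | hadd x y hx hy => rw [smul_add, map_add, hx, hy, map_add, smul_add]
  | hG n x hx =>
    by_cases hn : n = e
    · subst hn
      rw [D.totGrading.p_same n x hx, D.totGrading.p_same _ _ (D.smul_mem_tot ha hx)]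
    · rw [D.totGrading.p_ne n e hn x hx, smul_zero,
        D.totGrading.p_ne _ _ (by omega) _ (D.smul_mem_tot ha hx)]

/-! ### The images of indecomposable elements are not decomposable -/

theorem eq_zero_of_mem_word {m n : ℕ} (hmn : m ≠ n) {x : TensorAlgebra k V} (hm : x ∈ word k V m)
    (hn : x ∈ word k V n) : x = 0 := by
  rw [← (wordGrading k V).p_same n x hn, (wordGrading k V).p_ne m n hmn x hm]

/-- In degree `1` there is nothing decomposable, and `V` injects into `A` because all relations have
degree at least `2`. -/
theorem eq_zero_of_δLeft_one_mem {d : ℕ} {j : TensorAlgebra k V} (hj : j ∈ D.J 1)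
    (hjd : j ∈ word k V d) (h : D.δLeft 1 (1 ⊗ₜ j) ∈ (D.posPart 1 d).map (D.δLeft 1)) : j = 0 := by
  rw [J_one] at hj
  by_cases hd : 1 = d
  · subst hd
    have h0 : D.posPart 1 1 = ⊥ := by
      rw [eq_bot_iff]
      refine D.posPart_le fun b e hb hbe a _ x hx hxe => ?_
      rw [J_one] at hx
      rw [eq_zero_of_mem_word (by omega) hx hxe, TensorProduct.tmul_zero]
      exact zero_mem _
    rw [h0, Submodule.map_bot, Submodule.mem_bot] at h
    have h1 := D.cutsAt_zero.mem_of_eq_zero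
      (by simpa only [mul_one] using Submodule.mul_mem_mul hj (one_mem_word (k := k) (V := V))) h
    rw [word_zero, mul_one] at h1
    have h2 := D.idealSub_inf_word_le (s := 2) one_lt_two h1
    refine (?_ : D.relLT 2 1 ≤ ⊥) h2
    refine iSup₂_le fun t ht => iSup_le fun h2 => ?_
    have := D.two_le t ht
    omega
  · exact eq_zero_of_mem_word hd hj hjd

/-- Here `J_2` is the space of relations. Lifting the coefficients from `A` to `T(V)` turns a
decomposable element of degree `d` into an element `z` of the span of relations of smaller degree.
If its boundary equals that of `j`, then `j - z` has its first `d - 1` letters in the ideal, so `j -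
z`, and with it `j`, lies in that span, and minimality gives `j = 0`. -/
theorem eq_zero_of_δLeft_two_mem {d : ℕ} {j : TensorAlgebra k V} (hj : j ∈ D.J 2)
    (hjd : j ∈ word k V d) (h : D.δLeft 2 (1 ⊗ₜ j) ∈ (D.posPart 2 d).map (D.δLeft 2)) : j = 0 := by
  rcases D.eq_zero_or_mem_Js hj hjd with h0 | ⟨s, hs, hds, hjs⟩
  · exact h0
  have hn : ∀ s, nn s 2 = s := fun s => by simp [nn]
  have hc : ∀ t ∈ D.S, D.CutsAt 1 (t - 1) 1 := fun t ht => by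
    have := D.cutsAt ht 1
    rwa [nn_one, hn] at this
  have hle : ∀ t ∈ D.S, word k V t = word k V (t - 1) * word k V 1 := fun t ht => by
    have := D.two_le t ht
    rw [← word_add, show t - 1 + 1 = t by omega]
  rw [zero_add, hn] at hds
  rw [zero_add, Js_two] at hjs
  subst hds
  have h2 := D.two_le d hs
  have h1 : (D.posPart 2 d).map (D.δLeft 2) ≤ ((D.relLT d d).map (cut k V (d - 1))).map
      (D.π.toLinearMap.rTensor (TensorAlgebra k V)) := by
    rw [Submodule.map_le_iff_le_comap]
    refine D.posPart_le fun b e hb hbe a ha x hx hxe => ?_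
    rw [Submodule.mem_comap]
    obtain ⟨y, hy, rfl⟩ := ha
    rcases D.eq_zero_or_mem_Js hx hxe with rfl | ⟨t, ht, het, hxt⟩
    · rw [TensorProduct.tmul_zero, map_zero]
      exact zero_mem _
    · rw [zero_add, hn] at het
      rw [zero_add, Js_two] at hxt
      subst het
      have h2e := D.two_le e ht
      refine ⟨_, ⟨y * x, D.word_mul_R_mul_word_le_relLT (a := b) (b := 0) ht (by omega)
        (by omega) ?_, rfl⟩, ?_⟩
      · rw [word_zero, mul_one]
        exact Submodule.mul_mem_mul hy hxt
      · rw [δLeft_tmul]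
        rw [hle e ht] at hxe
        refine Submodule.mul_induction_on hxe (fun u hu w hw => ?_) fun x x' hx hx' => ?_
        · have hyu : y * u ∈ word k V (d - 1) := by
            rw [show d - 1 = b + (e - 1) by omega, word_add]
            exact Submodule.mul_mem_mul hy hu
          rw [hc e ht u hu w hw, ← mul_assoc, cut_mul hyu, LinearMap.rTensor_tmul,
            TensorProduct.smul_tmul', smul_eq_mul, AlgHom.toLinearMap_apply,
            AlgHom.toLinearMap_apply, map_mul]
        · rw [mul_add, map_add, map_add, hx, hx', TensorProduct.tmul_add, map_add, smul_add]
  obtain ⟨_, ⟨z, hz, rfl⟩, hzj⟩ := h1 h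
  have hzw : z ∈ word k V d := D.relLT_le_word (Nat.le_succ d) hz
  have hjz := sub_mem hjd hzw
  rw [hle d hs] at hjz hzw hjd
  have h3 := (hc d hs).mem_of_eq_zero hjz (by
    rw [TensorProduct.tmul_sub, map_sub, (hc d hs).eq hzw]
    exact sub_eq_zero.2 hzj.symm)
  have h4 := D.idealSub_inf_word_mul_word_le (s := d) (by omega) (by omega) h3
  have h5 := add_mem h4 hz
  rw [sub_add_cancel] at h5
  exact Submodule.disjoint_def.1 (D.disjoint_relLT hs) j hjs h5

/-- The boundary of `A ⊗ J_{i+3}^t` has right-hand factors of length `n_t(i+2)`, and these lengths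
differ for different `t`. A decomposable element of the degree of `J_{i+3}^s` has no `s`-part, so
projecting to right-hand length `n_s(i+2)` gives `δ(1 ⊗ j) = 0`. The first `s` letters of `j` are
then in `R_s` and also in the span of relations of smaller degree. -/
theorem eq_zero_of_δLeft_add_three_mem {i d : ℕ} {j : TensorAlgebra k V} (hj : j ∈ D.J (i + 3))
    (hjd : j ∈ word k V d)
    (h : D.δLeft (i + 3) (1 ⊗ₜ j) ∈ (D.posPart (i + 3) d).map (D.δLeft (i + 3))) : j = 0 := by
  rcases D.eq_zero_or_mem_Js hj hjd with h0 | ⟨s, hs, hds, hjs⟩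
  · exact h0
  have hw : ∀ t ∈ D.S, word k V (nn t (i + 3)) =
      word k V (nn t (i + 3) - nn t (i + 2)) * word k V (nn t (i + 2)) := fun t ht => by
    have hlt : nn t (i + 2) < nn t (i + 3) := nn_lt_nn_succ (D.two_le t ht) (i + 2)
    rw [← word_add]
    congr 1
    omega
  have hproj : ∀ t ∈ D.S, ∀ x ∈ word k V (nn t (i + 3)),
      ((wordGrading k V).p (nn s (i + 2))).lTensor D.Alg (D.δLeft (i + 3) (1 ⊗ₜ x)) =
        if t = s then D.δLeft (i + 3) (1 ⊗ₜ x) else 0 := by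
    intro t ht x hx
    have hc : D.CutsAt (i + 2) _ _ := D.cutsAt ht (i + 2)
    rw [hw t ht] at hx
    refine Submodule.mul_induction_on hx (fun u hu w hw => ?_) fun x x' hx hx' => ?_
    · rw [hc u hu w hw, LinearMap.lTensor_tmul]
      split_ifs with hts
      · subst hts
        rw [(wordGrading k V).p_same _ w hw]
      · rw [(wordGrading k V).p_ne _ _ (nn_ne_nn hts (by omega)) w hw, TensorProduct.tmul_zero]
    · rw [TensorProduct.tmul_add, map_add, map_add, hx, hx']
      split_ifs
      · rfl
      · rw [add_zero]
  have h0 : (D.posPart (i + 3) d).map (D.δLeft (i + 3)) ≤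
      LinearMap.ker (((wordGrading k V).p (nn s (i + 2))).lTensor D.Alg) := by
    rw [Submodule.map_le_iff_le_comap]
    refine D.posPart_le fun b e hb hbe a _ x hx hxe => ?_
    rw [Submodule.mem_comap, LinearMap.mem_ker]
    rcases D.eq_zero_or_mem_Js hx hxe with rfl | ⟨t, ht, het, hxt⟩
    · rw [TensorProduct.tmul_zero, map_zero, map_zero]
    · subst het
      rw [δLeft_tmul]
      -- With `t = s` the length of `x` would already be `d`, leaving no room for a coefficient of
      -- positive degree.
      have hts : t ≠ s := by
        rintro rfl
        omega
      have hsmul : ∀ z : D.Alg ⊗[k] TensorAlgebra k V,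
          ((wordGrading k V).p (nn s (i + 2))).lTensor D.Alg (a • z) =
            a • ((wordGrading k V).p (nn s (i + 2))).lTensor D.Alg z := fun z =>
        map_smul (TensorProduct.AlgebraTensorModule.lTensor D.Alg D.Alg
          ((wordGrading k V).p (nn s (i + 2)))) a z
      rw [hsmul]
      have := hproj t ht x hxe
      rw [if_neg hts] at this
      exact (congrArg (a • ·) this).trans (smul_zero a)
  have h1 : D.δLeft (i + 3) (1 ⊗ₜ j) = 0 := by
    have h2 := h0 h
    have h3 := hproj s hs j (by rw [← show d = nn s (i + 3) from hds]; exact hjd)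
    rw [if_pos rfl] at h3
    rw [← h3]
    exact h2
  have hc : D.CutsAt (i + 2) _ _ := D.cutsAt hs (i + 2)
  have hjd' : j ∈ word k V (nn s (i + 3)) := by rw [← show d = nn s (i + 3) from hds]; exact hjd
  rw [hw s hs] at hjd'
  have h2 := hc.mem_of_eq_zero hjd' h1
  have hn1 : nn s (i + 3) = nn s (i + 1) + s := nn_add_two s (i + 1)
  have hn2 : nn s (i + 2) = nn s i + s := nn_add_two s i
  have hlt1 : nn s (i + 1) < nn s (i + 2) := nn_lt_nn_succ (D.two_le s hs) (i + 1)
  have hlt2 : nn s (i + 2) < nn s (i + 3) := nn_lt_nn_succ (D.two_le s hs) (i + 2)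
  -- The cut takes fewer than `s` letters, so the prefix is padded to `s` letters, the length at
  -- which minimality of the relations applies.
  have hq : word k V (nn s (i + 2)) =
      word k V (s - (nn s (i + 3) - nn s (i + 2))) * word k V (nn s (i + 1)) := by
    rw [← word_add]
    congr 1
    omega
  have h3 : j ∈ D.relLT s s * word k V (nn s (i + 1)) := by
    refine (?_ : _ ≤ D.relLT s s * word k V (nn s (i + 1))) h2
    rw [hq, ← mul_assoc]
    exact mul_le_mul' (D.idealSub_inf_word_mul_word_le
      (p := nn s (i + 3) - nn s (i + 2)) (by omega) (by omega)) le_rfl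
  have h4 : j ∈ D.R s * word k V (nn s (i + 1)) := by
    have := D.Js_le (j := 0) (m := nn s (i + 1)) (show _ = nn s (i + 3) by omega) hjs
    rwa [word_zero, one_mul] at this
  exact eq_zero_of_mem_mul_of_disjoint (D.disjoint_relLT hs) (D.le_word s hs)
    (D.relLT_le_word (Nat.le_succ s)) h4 h3

theorem eq_zero_of_δLeft_mem {i d : ℕ} {j : TensorAlgebra k V} (hj : j ∈ D.J (i + 1))
    (hjd : j ∈ word k V d)
    (h : D.δLeft (i + 1) (1 ⊗ₜ j) ∈ (D.posPart (i + 1) d).map (D.δLeft (i + 1))) : j = 0 :=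
  match i with
  | 0 => D.eq_zero_of_δLeft_one_mem hj hjd h
  | 1 => D.eq_zero_of_δLeft_two_mem hj hjd h
  | _ + 2 => D.eq_zero_of_δLeft_add_three_mem hj hjd h

end Relations

theorem nonempty_subquotient_top_equiv {k : Type u} [Field k] {M : Type w} [AddCommGroup M]
    [Module k M] (B : Submodule k M) : Nonempty (Subquotient ⊤ B ≃ₗ[k] M ⧸ B) :=
  ⟨Submodule.Quotient.equiv _ _ Submodule.topEquiv (by
    ext x
    exact ⟨fun ⟨y, hy, h⟩ => h ▸ hy, fun h => ⟨⟨x, trivial⟩, h, rfl⟩⟩)⟩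

namespace Relations

variable {k : Type u} {V : Type v} [Field k] [AddCommGroup V] [Module k V] (D : Relations k V)

/-! ### Cycles and boundaries of the left multi-Koszul complex -/

/-- The cycles in `K(A)_i`. -/
def ZL : ℕ → Submodule k (D.Alg ⊗[k] TensorAlgebra k V)
  | 0 => D.KLeft 0 ⊓ LinearMap.ker D.augLeft
  | i + 1 => D.KLeft (i + 1) ⊓ LinearMap.ker (D.δLeft (i + 1))

/-- The boundaries in `K(A)_i`. -/
def BL (i : ℕ) : Submodule k (D.Alg ⊗[k] TensorAlgebra k V) :=
  (D.KLeft (i + 1)).map (D.δLeft (i + 1))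

theorem ZL_le_KLeft (i : ℕ) : D.ZL i ≤ D.KLeft i := by
  cases i <;> exact inf_le_left

theorem augLeft_surjective (c : k) : ∃ x ∈ D.KLeft 0, D.augLeft x = c :=
  ⟨1 ⊗ₜ algebraMap k (TensorAlgebra k V) c, D.tmul_mem_KLeft 1 (by
      rw [J_zero, word_zero]; exact Submodule.algebraMap_mem c), by
    rw [augLeft_tmul, map_one, one_mul]
    exact TensorAlgebra.algebraMap_leftInverse V c⟩

theorem p_augLeft {d : ℕ} {x : D.Alg ⊗[k] TensorAlgebra k V} (hx : D.augLeft x = 0) :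
    D.augLeft (D.totGrading.p d x) = 0 := by
  have h0 : ∀ x, D.augLeft (D.totGrading.p 0 x) = D.augLeft x := fun x => by
    induction x using D.totGrading.induction with
    | h0 => rw [map_zero]
    | hadd x y hx hy => rw [map_add, map_add, map_add, hx, hy]
    | hG n x hx =>
      by_cases hn : n = 0
      · subst hn
        rw [D.totGrading.p_same _ x hx]
      · have h1 : x ∈ D.totGrading.zG n := by rwa [NatGrading.zG_natCast]
        rw [D.totGrading.p_ne _ _ hn x hx, map_zero,
          trivDeg_ne (by exact_mod_cast hn) (D.augLeft_mem_trivDeg h1)]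
  rcases Nat.eq_zero_or_pos d with rfl | hd
  · rw [h0, hx]
  · have h1 : D.totGrading.p d x ∈ D.totGrading.zG d := by
      rw [NatGrading.zG_natCast]
      exact D.totGrading.p_mem d x
    exact trivDeg_ne (by exact_mod_cast hd.ne') (D.augLeft_mem_trivDeg h1)

variable [FiniteDimensional k V]

theorem BL_le_ZL (i : ℕ) : D.BL i ≤ D.ZL i := by
  rintro _ ⟨x, hx, rfl⟩
  cases i with
  | zero => exact ⟨D.δLeft_mem hx, D.augLeft_δLeft x hx⟩
  | succ i => exact ⟨D.δLeft_mem hx, D.δLeft_δLeft i hx⟩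

theorem isLeftMultiKoszul_iff : D.IsLeftMultiKoszul ↔ ∀ i, D.ZL i ≤ D.BL i := by
  constructor
  · rintro ⟨-, h0, h1⟩ (_ | i)
    · exact h0.ge
    · exact (h1 i).ge
  · intro h
    refine ⟨?_, le_antisymm (D.BL_le_ZL 0) (h 0), fun i =>
      le_antisymm (D.BL_le_ZL (i + 1)) (h (i + 1))⟩
    exact eq_top_iff.2 fun c _ => D.augLeft_surjective c

theorem p_mem_ZL (i d : ℕ) {x : D.Alg ⊗[k] TensorAlgebra k V} (hx : x ∈ D.ZL i) :
    D.totGrading.p d x ∈ D.ZL i := by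
  cases i with
  | zero => exact ⟨(D.homog_KLeft 0).p_mem d hx.1, D.p_augLeft hx.2⟩
  | succ i =>
    refine ⟨(D.homog_KLeft (i + 1)).p_mem d hx.1, ?_⟩
    change D.δLeft (i + 1) (D.totGrading.p d x) = 0
    rw [← D.p_δLeft d hx.1, (LinearMap.mem_ker.1 hx.2), map_zero]

/-- The multi-Koszul complex is minimal. -/
theorem p_mem_posPart (i d : ℕ) {x : D.Alg ⊗[k] TensorAlgebra k V} (hx : x ∈ D.ZL i) :
    D.totGrading.p d x ∈ D.posPart i d := by
  obtain ⟨j, hj, hjd, hy⟩ := D.exists_sub_mem_posPart (d := d) (D.ZL_le_KLeft i hx)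
  suffices h : j = 0 by rwa [h, TensorProduct.tmul_zero, sub_zero] at hy
  have hpx := D.p_mem_ZL i d hx
  cases i with
  | zero =>
    by_cases hd : 0 = d
    · subst hd
      have h0 : D.posPart 0 0 ≤ ⊥ := D.posPart_le fun b e hb hbe => by omega
      have h1 := sub_eq_zero.1 (h0 hy)
      rw [J_zero, word_zero] at hj
      obtain ⟨c, rfl⟩ := Submodule.mem_one.1 hj
      have h2 : D.augLeft (D.totGrading.p 0 x) = 0 := hpx.2
      rw [h1, augLeft_tmul, map_one, one_mul] at h2
      rw [← TensorAlgebra.algebraMap_leftInverse V c, h2, map_zero]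
    · exact eq_zero_of_mem_word hd hj hjd
  | succ i =>
    -- The component is a cycle, so `1 ⊗ j` has the same boundary as the negative of the
    -- decomposable remainder.
    refine D.eq_zero_of_δLeft_mem hj hjd ⟨-(D.totGrading.p d x - 1 ⊗ₜ j), neg_mem hy, ?_⟩
    rw [neg_sub, map_sub, LinearMap.mem_ker.1 hpx.2, sub_zero]

/-! ### Comparison of cycles with `J_{i+1}` -/

/-- The cycles of the multi-Koszul complex as an `A`-submodule. -/
def kosSyz (i : ℕ) : Submodule D.Alg (D.KMod i) := D.kosComplex.syz i

theorem mem_kosSyz {i : ℕ} {x : D.KMod i} :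
    x ∈ D.kosSyz i ↔ D.kVal i x ∈ D.ZL i := by
  cases i with
  | zero => exact ⟨fun h => ⟨x.2, h⟩, fun h => h.2⟩
  | succ i => exact ⟨fun h => ⟨x.2, congrArg Subtype.val (show D.kosComplex.d i x = 0 from h)⟩,
      fun h => Subtype.ext h.2⟩

theorem exactAt_kosComplex_iff {i : ℕ} : D.kosComplex.ExactAt i ↔ D.ZL i ≤ D.BL i := by
  constructor
  · intro h x hx
    obtain ⟨y, hy⟩ := h ⟨x, D.ZL_le_KLeft i hx⟩ (D.mem_kosSyz.2 hx)
    exact ⟨y.1, y.2, congrArg Subtype.val hy⟩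
  · intro h x hx
    obtain ⟨y, hy, hyx⟩ := h (D.mem_kosSyz.1 hx)
    exact ⟨⟨y, hy⟩, Subtype.ext hyx⟩

/-- The inclusion of the cycles. -/
def kosVal (i : ℕ) : D.kosSyz i →ₗ[k] D.Alg ⊗[k] TensorAlgebra k V :=
  (D.kVal i).comp ((D.kosSyz i).subtype.restrictScalars k)

theorem kosVal_mem {i : ℕ} (x : D.kosSyz i) : D.kosVal i x ∈ D.ZL i := D.mem_kosSyz.1 x.2

theorem exists_kosVal_eq {i : ℕ} {x : D.Alg ⊗[k] TensorAlgebra k V} (hx : x ∈ D.ZL i) :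
    ∃ y, D.kosVal i y = x := ⟨⟨⟨x, D.ZL_le_KLeft i hx⟩, D.mem_kosSyz.2 hx⟩, rfl⟩

theorem kosVal_injective (i : ℕ) : Function.Injective (D.kosVal i) :=
  fun _ _ h => Subtype.ext (Subtype.ext h)

/-- The decomposable cycles and the cycles of degree other than `-n`. -/
def kosBad (i : ℕ) (n : ℤ) : Submodule k (D.kosSyz i) :=
  bad D (subDeg (D.kosDeg i) (D.kosSyz i)) n

/-- Minimality in the form needed for duality: no map from `K_i` to `k` is nonzero on a cycle. The
component of degree `-n` of a cycle is decomposable and the other components have the wrong degree.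
-/
theorem comap_bad_kosSyz (i : ℕ) (n : ℤ) :
    (bad D (D.kosDeg i) n).comap ((D.kosSyz i).subtype.restrictScalars k) = ⊤ := by
  rw [eq_top_iff]
  rintro ⟨⟨x, hxK⟩, hx⟩ -
  have hxZ := D.mem_kosSyz.1 hx
  suffices x ∈ (bad D (D.kosDeg i) n).map (D.kVal i) by
    obtain ⟨y, hy, hyx⟩ := this
    rw [Submodule.mem_comap]
    change (⟨x, hxK⟩ : D.KMod i) ∈ bad D (D.kosDeg i) n
    rwa [← (Subtype.ext hyx : y = ⟨x, hxK⟩)]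
  have h1 : x - D.totGrading.zp (-n) x ∈ (bad D (D.kosDeg i) n).map (D.kVal i) := by
    refine (D.homog_KLeft i).sub_zp_mem (-n) (fun m hm y hy hym => ?_) hxK
    refine ⟨⟨y, hy⟩, mem_bad_of_mem_deg (D := D) _ n hm ?_, rfl⟩
    change y ∈ D.totGrading.zG m
    rwa [NatGrading.zG_natCast]
  have h2 : ∀ d, D.posPart i d ≤ (bad D (D.kosDeg i) n).map (D.kVal i) := fun d =>
    D.posPart_le fun b e hb _ a ha j hj _ => by
      obtain ⟨b, rfl⟩ : ∃ c, b = c + 1 := ⟨b - 1, by omega⟩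
      refine ⟨a • ⟨1 ⊗ₜ j, D.tmul_mem_KLeft 1 hj⟩,
        smul_mem_bad (D := D) _ n (D.ε_algDeg_succ ha) _, ?_⟩
      change (a * 1) ⊗ₜ j = _
      rw [mul_one]
  have h3 : D.totGrading.zp (-n) x ∈ (bad D (D.kosDeg i) n).map (D.kVal i) := by
    rcases lt_or_ge (-n) 0 with hn | hn
    · rw [NatGrading.zp_of_neg _ hn]
      exact zero_mem _
    · obtain ⟨d, hd⟩ := Int.eq_ofNat_of_zero_le hn
      rw [hd, NatGrading.zp_natCast]
      exact h2 d (D.p_mem_posPart i d hxZ)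
  have h4 := add_mem h1 h3
  rwa [sub_add_cancel] at h4

/-- Exactness is assumed strictly below `i` only, which is what the converse knows when it has to
prove exactness at `i`. -/
theorem GradedProjRes.nonempty_extDeg_succ_equiv_kos {D : Relations k V}
    (Q : GradedProjRes.{u, v, w} D) {i : ℕ} (hex : ∀ j < i, D.ZL j ≤ D.BL j) (n : ℤ) :
    Nonempty (Q.ExtDeg (i + 1) n ≃ₗ[k] Module.Dual k (D.kosSyz i ⧸ D.kosBad i n)) := by
  obtain ⟨e⟩ := Q.nonempty_extDeg_succ_equiv i n
  obtain ⟨e'⟩ := GrComplex.nonempty_homQuot_equiv (X := Q.toGrComplex) (Y := D.kosComplex) i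
    (fun j _ => Q.exactAt j) (fun j hj => D.exactAt_kosComplex_iff.2 (hex j hj)) n
  obtain ⟨e₁⟩ := nonempty_homQuot_equiv_dual (D.kosDeg i) n (D.kosSyz i)
  rw [comap_bad_kosSyz] at e₁
  obtain ⟨e₂⟩ := nonempty_subquotient_top_equiv (D.kosBad i n)
  exact ⟨e.symm.trans (e'.trans (e₁.trans e₂.symm.dualMap))⟩

/-- The map from `J_{i+1}` to the cycles in `K(A)_i` given by the differential. -/
def kosβ (i : ℕ) : D.J (i + 1) →ₗ[k] D.kosSyz i where
  toFun j := ⟨⟨D.δLeft (i + 1) (1 ⊗ₜ j), D.δLeft_one_tmul_mem j.2⟩,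
    D.mem_kosSyz.2 (D.BL_le_ZL i ⟨_, D.tmul_mem_KLeft 1 j.2, rfl⟩)⟩
  map_add' j j' := Subtype.ext (Subtype.ext (map_add
    ((D.δLeft (i + 1)).comp (TensorProduct.mk k D.Alg (TensorAlgebra k V) 1))
    (j : TensorAlgebra k V) j'))
  map_smul' c j := Subtype.ext (Subtype.ext (map_smul
    ((D.δLeft (i + 1)).comp (TensorProduct.mk k D.Alg (TensorAlgebra k V) 1)) c
    (j : TensorAlgebra k V)))

theorem kosVal_kosβ {i : ℕ} (j : D.J (i + 1)) :
    D.kosVal i (D.kosβ i j) = D.δLeft (i + 1) (1 ⊗ₜ (j : TensorAlgebra k V)) := rfl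

/-- The map induced by the differential from `(J_{i+1})_{-n}` to the indecomposable cycles of
degree `-n` in `K(A)_i`. -/
def kosβDeg (i : ℕ) (n : ℤ) : D.Jdeg (i + 1) (-n) →ₗ[k] D.kosSyz i ⧸ D.kosBad i n :=
  (D.kosBad i n).mkQ.comp ((D.kosβ i).comp (Submodule.inclusion inf_le_left))

/-- For `a` of positive degree `c` and a cycle `y`, the degree `d` component of `a y` is `a` times
the component of `y` of degree `d - c`. This is a cycle of degree below `d`, hence a boundary `δ z`
by `hex`, and `a δ z = δ (a z)` with `a z` decomposable. -/
theorem p_kosVal_mem {i d : ℕ} {n : ℤ} (hn : -n = d)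
    (hex : ∀ e < d, D.ZL i ⊓ D.totGrading.G e ≤ D.BL i) {x : D.kosSyz i} (hx : x ∈ D.kosBad i n) :
    D.totGrading.p d (D.kosVal i x) ∈ (D.posPart (i + 1) d).map (D.δLeft (i + 1)) := by
  refine (bad_le _ n (fun a ha x => ?_) fun m hm x hx => ?_ : D.kosBad i n ≤
    ((D.posPart (i + 1) d).map (D.δLeft (i + 1))).comap ((D.totGrading.p d).comp (D.kosVal i))) hx
  · change D.totGrading.p d (a • D.kosVal i x) ∈ (D.posPart (i + 1) d).map (D.δLeft (i + 1))
    have hxZ := D.kosVal_mem x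
    generalize D.kosVal i x = y at hxZ
    have key : ∀ c, 0 < c → ∀ a ∈ D.algDeg c, D.totGrading.p d (a • y) ∈
        (D.posPart (i + 1) d).map (D.δLeft (i + 1)) := by
      intro c hc a ha
      rcases lt_or_ge d c with hdc | hdc
      · rw [D.p_smul_of_lt hdc ha]
        exact zero_mem _
      · obtain ⟨e, rfl⟩ := Nat.exists_eq_add_of_le hdc
        rw [D.p_add_smul ha]
        obtain ⟨z, hz, hzy⟩ := hex e (by omega) ⟨D.p_mem_ZL i e hxZ, D.totGrading.p_mem e y⟩
        refine ⟨_, D.smul_mem_posPart (d := c + e) hc ha hz, ?_⟩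
        rw [← D.p_δLeft _ ((D.KA (i + 1)).smul_mem a hz), δLeft_smul, hzy, D.p_add_smul ha,
          D.totGrading.p_same _ _ (D.totGrading.p_mem _ _)]
    obtain ⟨t, ht, rfl⟩ := D.exists_mem_augSub ha
    rw [augSub_eq, ← iSup_word, Submodule.mul_iSup] at ht
    refine (iSup_le fun b u hu => ?_ : _ ≤ ((D.posPart (i + 1) d).map (D.δLeft (i + 1))).comap
      ((D.totGrading.p d).comp (((Algebra.lsmul k k (D.Alg ⊗[k] TensorAlgebra k V)).toLinearMap.flip
        y).comp D.π.toLinearMap))) ht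
    rw [← word_add] at hu
    exact key (1 + b) (by omega) _ ⟨u, hu, rfl⟩
  · have h1 : D.kosVal i x ∈ D.totGrading.zG m := hx
    have h2 := D.totGrading.zp_ne hm h1
    rw [hn, NatGrading.zp_natCast] at h2
    rw [Submodule.mem_comap, LinearMap.comp_apply, h2]
    exact zero_mem _

theorem mem_kosBad_of_mem_map {i d : ℕ} (n : ℤ) {x : D.kosSyz i}
    (hx : D.kosVal i x ∈ (D.posPart (i + 1) d).map (D.δLeft (i + 1))) : x ∈ D.kosBad i n := by
  have h : (D.posPart (i + 1) d).map (D.δLeft (i + 1)) ≤ (D.kosBad i n).map (D.kosVal i) := by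
    rw [Submodule.map_le_iff_le_comap]
    refine D.posPart_le fun b e hb _ a ha j hj _ => ?_
    obtain ⟨b, rfl⟩ : ∃ c, b = c + 1 := ⟨b - 1, by omega⟩
    refine ⟨a • D.kosβ i ⟨j, hj⟩, smul_mem_bad (D := D) _ n (D.ε_algDeg_succ ha) _, ?_⟩
    exact (D.δLeft_tmul (i + 1) a j).symm
  obtain ⟨y, hy, hyx⟩ := h hx
  rwa [← D.kosVal_injective i hyx]

theorem kosβDeg_injective {i d : ℕ} {n : ℤ} (hn : -n = d)
    (hex : ∀ e < d, D.ZL i ⊓ D.totGrading.G e ≤ D.BL i) : Function.Injective (D.kosβDeg i n) := by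
  rw [injective_iff_map_eq_zero]
  rintro ⟨j, hj⟩ h
  have hjd : j ∈ word k V d := by
    have := hj.2
    rwa [hn, ← wordGrading_zG, NatGrading.zG_natCast] at this
  have h1 := D.p_kosVal_mem hn hex ((Submodule.Quotient.mk_eq_zero _).1 h)
  have h2 : D.totGrading.p d (D.δLeft (i + 1) (1 ⊗ₜ j)) = D.δLeft (i + 1) (1 ⊗ₜ j) :=
    D.totGrading.p_same _ _ (D.δLeft_one_tmul_mem_tot hj.1 hjd)
  exact Subtype.ext (D.eq_zero_of_δLeft_mem hj.1 hjd (h2 ▸ h1))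

theorem kosSyz_quotient_eq_zero {i : ℕ} {n : ℤ} (hn : -n < 0) (x : D.kosSyz i ⧸ D.kosBad i n) :
    x = 0 := by
  obtain ⟨x, rfl⟩ := Submodule.Quotient.mk_surjective _ x
  rw [Submodule.Quotient.mk_eq_zero]
  suffices ∀ y ∈ D.ZL i, y ∈ (D.kosBad i n).map (D.kosVal i) by
    obtain ⟨y, hy, hyx⟩ := this _ (D.kosVal_mem x)
    rwa [← D.kosVal_injective i hyx]
  intro y hy
  refine D.totGrading.mem_of_p_mem fun m => ?_
  obtain ⟨z, hz⟩ := D.exists_kosVal_eq (D.p_mem_ZL i m hy)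
  refine ⟨z, mem_bad_of_mem_deg (D := D) _ n (m := m) (by omega) ?_, hz⟩
  change D.kosVal i z ∈ D.totGrading.zG m
  rw [hz, NatGrading.zG_natCast]
  exact D.totGrading.p_mem m y

/-- Write a cycle as `δ y` and split the component of `y` in degree `d = -n` as `1 ⊗ j` plus a
decomposable term. The boundary of that term is a decomposable cycle, so the class of the cycle is
the image of `j`. -/
theorem kosβDeg_surjective {i : ℕ} (hex : D.ZL i ≤ D.BL i) (n : ℤ) :
    Function.Surjective (D.kosβDeg i n) := by
  intro x
  rcases lt_or_ge (-n) 0 with hn | hn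
  · exact ⟨0, by rw [map_zero, D.kosSyz_quotient_eq_zero hn x]⟩
  obtain ⟨d, hd⟩ := Int.eq_ofNat_of_zero_le hn
  replace hd : -n = (d : ℤ) := hd
  obtain ⟨x, rfl⟩ := Submodule.Quotient.mk_surjective _ x
  obtain ⟨y, hy, hyx⟩ := hex (D.kosVal_mem x)
  obtain ⟨j, hj, hjd, hyj⟩ := D.exists_sub_mem_posPart (d := d) hy
  refine ⟨⟨j, hj, ?_⟩, ?_⟩
  · rwa [hd, ← wordGrading_zG, NatGrading.zG_natCast]
  · refine (Submodule.Quotient.eq _).2 ?_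
    obtain ⟨z, hz⟩ := D.exists_kosVal_eq (D.p_mem_ZL i d (D.kosVal_mem x))
    have h1 : z - D.kosβ i ⟨j, hj⟩ ∈ D.kosBad i n := by
      refine D.mem_kosBad_of_mem_map n (d := d) ⟨_, hyj, ?_⟩
      rw [map_sub, map_sub, hz, ← hyx, D.p_δLeft d hy, kosVal_kosβ]
    have h2 : x - z ∈ D.kosBad i n := by
      have h3 : D.kosVal i (x - z) ∈ (D.kosBad i n).map (D.kosVal i) := by
        refine D.totGrading.mem_of_p_mem fun m => ?_
        rw [map_sub, map_sub, hz]
        by_cases hm : d = m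
        · subst hm
          rw [D.totGrading.p_same _ _ (D.totGrading.p_mem _ _), sub_self]
          exact zero_mem _
        · rw [D.totGrading.p_ne _ _ hm _ (D.totGrading.p_mem _ _), sub_zero]
          obtain ⟨z', hz'⟩ := D.exists_kosVal_eq (D.p_mem_ZL i m (D.kosVal_mem x))
          refine ⟨z', mem_bad_of_mem_deg (D := D) _ n (m := m) (by omega) ?_, hz'⟩
          change D.kosVal i z' ∈ D.totGrading.zG m
          rw [hz', NatGrading.zG_natCast]
          exact D.totGrading.p_mem m _
      obtain ⟨y, hy, hyx⟩ := h3
      rwa [← D.kosVal_injective i hyx]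
    have h3 := neg_mem (add_mem h2 h1)
    rw [sub_add_sub_cancel, neg_sub] at h3
    exact h3

instance (i : ℕ) (n : ℤ) : FiniteDimensional k (D.Jdeg i n) := by
  have : FiniteDimensional k (wordZ k V n) := by
    rcases lt_or_ge n 0 with hn | hn
    · rw [← wordGrading_zG, NatGrading.zG_of_neg _ hn]
      infer_instance
    · lift n to ℕ using hn
      rw [← wordGrading_zG, NatGrading.zG_natCast, wordGrading_G]
      infer_instance
  exact Submodule.finiteDimensional_of_le inf_le_right

/-- Graded Nakayama by induction on the degree `d`. Exactness in lower degrees makes `kosβDeg`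
injective in degree `d`; the dimensions agree and are finite, so it is bijective. A cycle of degree
`d` is then `δ(1 ⊗ j)` up to a decomposable cycle, itself a boundary by the induction hypothesis. -/
theorem ZL_le_BL {i : ℕ}
    (h : ∀ n, Nonempty (Module.Dual k (D.kosSyz i ⧸ D.kosBad i n) ≃ₗ[k] D.JdualDeg (i + 1) n)) :
    D.ZL i ≤ D.BL i := by
  have hG : ∀ d, D.ZL i ⊓ D.totGrading.G d ≤ D.BL i := by
    intro d
    induction d using Nat.strong_induction_on with
    | _ d hex =>
      rintro x ⟨hx, hxd⟩
      have hinj := D.kosβDeg_injective (n := -d) (neg_neg _) hex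
      obtain ⟨e⟩ := h (-d)
      have hfin : FiniteDimensional k (Module.Dual k (D.kosSyz i ⧸ D.kosBad i (-d))) :=
        e.symm.finiteDimensional
      -- Finite dimension of the quotient is not known beforehand; it is inferred from that of its
      -- dual, which is isomorphic to the dual of a piece of `V^{(d)}`.
      have hfin' : FiniteDimensional k (D.kosSyz i ⧸ D.kosBad i (-d)) :=
        (Module.finite_dual_iff k).1 hfin
      have hdim := e.finrank_eq
      rw [Subspace.dual_finrank_eq, Subspace.dual_finrank_eq] at hdim
      have hsurj := (LinearMap.injective_iff_surjective_of_finrank_eq_finrank hdim.symm).1 hinj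
      obtain ⟨x, rfl⟩ := D.exists_kosVal_eq hx
      obtain ⟨⟨j, hj⟩, hjx⟩ := hsurj (Submodule.Quotient.mk x)
      have h1 : D.kosβ i ⟨j, hj.1⟩ - x ∈ D.kosBad i (-d) := (Submodule.Quotient.eq _).1 hjx
      have h2 := D.p_kosVal_mem (neg_neg _) hex h1
      obtain ⟨y, hy, hyx⟩ := h2
      have hjd : j ∈ word k V d := by
        have := hj.2
        rwa [neg_neg, ← wordGrading_zG, NatGrading.zG_natCast] at this
      rw [map_sub, map_sub, kosVal_kosβ, D.totGrading.p_same _ _ hxd,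
        D.totGrading.p_same _ _ (D.δLeft_one_tmul_mem_tot hj.1 hjd)] at hyx
      refine ⟨1 ⊗ₜ j - y, sub_mem (D.tmul_mem_KLeft 1 hj.1) (D.posPart_le_KLeft _ _ hy), ?_⟩
      rw [map_sub, hyx, sub_sub_cancel]
  exact fun x hx => D.totGrading.mem_of_p_mem fun d =>
    hG d ⟨D.p_mem_ZL i d hx, D.totGrading.p_mem d x⟩

theorem nonempty_dual_kos_equiv {i : ℕ} (hex : D.ZL i ≤ D.BL i) (n : ℤ) :
    Nonempty (Module.Dual k (D.kosSyz i ⧸ D.kosBad i n) ≃ₗ[k] D.JdualDeg (i + 1) n) := by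
  have hinj : Function.Injective (D.kosβDeg i n) := by
    rcases lt_or_ge (-n) 0 with hn | hn
    · rintro ⟨x, hx⟩ ⟨y, hy⟩ -
      have h0 : wordZ k V (-n) = ⊥ := by rw [← wordGrading_zG, NatGrading.zG_of_neg _ hn]
      have hx' : x ∈ (⊥ : Submodule k (TensorAlgebra k V)) := h0 ▸ hx.2
      have hy' : y ∈ (⊥ : Submodule k (TensorAlgebra k V)) := h0 ▸ hy.2
      exact Subtype.ext (((Submodule.mem_bot k).1 hx').trans ((Submodule.mem_bot k).1 hy').symm)
    · obtain ⟨d, hd⟩ := Int.eq_ofNat_of_zero_le hn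
      exact D.kosβDeg_injective hd fun e _ => inf_le_left.trans hex
  exact ⟨(LinearEquiv.ofBijective _ ⟨hinj, D.kosβDeg_surjective hex n⟩).dualMap⟩

/-! ### Degree zero, and the criterion for the left complex -/

theorem nonempty_subquotient_trivDeg_equiv (n : ℤ) :
    Nonempty (Subquotient (trivDeg k n) (⊥ : Submodule k k) ≃ₗ[k] D.JdualDeg 0 n) := by
  have hmem : ∀ c, c ∈ trivDeg k n ↔ algebraMap k (TensorAlgebra k V) c ∈ D.Jdeg 0 (-n) := by
    intro c
    have h0 : algebraMap k (TensorAlgebra k V) c ∈ word k V 0 := by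
      rw [word_zero]
      exact Submodule.algebraMap_mem c
    by_cases hn : n = 0
    · subst hn
      refine iff_of_true (mem_trivDeg_zero rfl c) ⟨h0, ?_⟩
      rw [neg_zero]
      exact h0
    · constructor
      · intro h
        rw [trivDeg_ne hn h, map_zero]
        exact zero_mem _
      · intro h
        have h1 := (wordGrading k V).zp_ne (m := ((0 : ℕ) : ℤ)) (n := -n) (by omega)
          (by rwa [NatGrading.zG_natCast])
        have h2 := h.2
        rw [← wordGrading_zG] at h2
        rw [NatGrading.zp_same _ h2] at h1
        rw [← TensorAlgebra.algebraMap_leftInverse V c, h1, map_zero]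
        exact zero_mem _
  let f : trivDeg k n →ₗ[k] D.Jdeg 0 (-n) :=
    (Algebra.linearMap k (TensorAlgebra k V)).restrict fun c hc => (hmem c).1 hc
  have hf : Function.Bijective f := by
    constructor
    · intro c c' h
      exact Subtype.ext ((TensorAlgebra.algebraMap_leftInverse V).injective
        (congrArg Subtype.val h))
    · rintro ⟨x, hx⟩
      have hx0 : x ∈ word k V 0 := hx.1
      rw [word_zero] at hx0
      obtain ⟨c, rfl⟩ := Submodule.mem_one.1 hx0
      exact ⟨⟨c, (hmem c).2 hx⟩, rfl⟩
  have hbot : (⊥ : Submodule k k).submoduleOf (trivDeg k n) = ⊥ := by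
    ext x
    exact ⟨fun h => Subtype.ext h, fun h => congrArg Subtype.val h⟩
  -- The degree `n` part of `J_0` is identified with its own dual, which is possible, though not
  -- canonically, because it is finite-dimensional.
  obtain ⟨e⟩ := (Basis.linearEquiv_dual_iff_finiteDimensional (K := k)
    (V := D.Jdeg 0 (-n))).2 inferInstance
  exact ⟨(Submodule.quotEquivOfEqBot _ hbot).trans ((LinearEquiv.ofBijective f hf).trans e)⟩

/-- The converse is a strong induction on the homological degree: exactness below `i` gives the
Koszul description of `Ext^{i+1}`, and its agreement with the dual of `J_{i+1}` gives exactness at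
`i`. The hypothesis on `Ext^0` is not informative. -/
theorem isLeftMultiKoszul_iff_ext (Q : GradedProjRes.{u, v, w} D) :
    D.IsLeftMultiKoszul ↔ ∀ (i : ℕ) (n : ℤ), Nonempty (Q.ExtDeg i n ≃ₗ[k] D.JdualDeg i n) := by
  rw [isLeftMultiKoszul_iff]
  constructor
  · rintro hex (_ | i) n
    · obtain ⟨e⟩ := Q.extDeg_zero_eq n
      obtain ⟨e'⟩ := D.nonempty_subquotient_trivDeg_equiv n
      exact ⟨e.trans e'⟩
    · obtain ⟨e⟩ := Q.nonempty_extDeg_succ_equiv_kos (i := i) (fun j _ => hex j) n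
      obtain ⟨e'⟩ := D.nonempty_dual_kos_equiv (hex i) n
      exact ⟨e.trans e'⟩
  · intro h i
    induction i using Nat.strong_induction_on with
    | _ i hex =>
      refine D.ZL_le_BL fun n => ?_
      obtain ⟨e⟩ := Q.nonempty_extDeg_succ_equiv_kos hex n
      obtain ⟨e'⟩ := h (i + 1) n
      exact ⟨e.symm.trans e'⟩

end Relations

/-! ### Reversal of words -/

section reversal

variable (k : Type u) (V : Type v) [Field k] [AddCommGroup V] [Module k V]

/-- The anti-automorphism of `T(V)` which reverses words, as a map to the opposite algebra. -/
def revHom : TensorAlgebra k V →ₐ[k] (TensorAlgebra k V)ᵐᵒᵖ :=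
  TensorAlgebra.lift k ((MulOpposite.opLinearEquiv k).toLinearMap.comp (TensorAlgebra.ι k))

/-- The linear map which reverses words. -/
def revLin : TensorAlgebra k V →ₗ[k] TensorAlgebra k V :=
  (MulOpposite.opLinearEquiv k).symm.toLinearMap.comp (revHom k V).toLinearMap

variable {k V}

theorem revLin_mul (x y : TensorAlgebra k V) :
    revLin k V (x * y) = revLin k V y * revLin k V x := by
  change (revHom k V (x * y)).unop = _
  rw [map_mul, MulOpposite.unop_mul]
  rfl

theorem revLin_algebraMap (r : k) :
    revLin k V (algebraMap k (TensorAlgebra k V) r) = algebraMap k (TensorAlgebra k V) r := by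
  change (revHom k V (algebraMap k (TensorAlgebra k V) r)).unop = _
  rw [AlgHom.commutes]
  rfl

theorem revLin_ι (x : V) : revLin k V (TensorAlgebra.ι k x) = TensorAlgebra.ι k x := by
  change (revHom k V (TensorAlgebra.ι k x)).unop = _
  rw [revHom, TensorAlgebra.lift_ι_apply]
  rfl

theorem revLin_revLin (x : TensorAlgebra k V) : revLin k V (revLin k V x) = x := by
  induction x using word_induction with
  | h0 r => rw [revLin_algebraMap, revLin_algebraMap]
  | hadd x y hx hy => rw [map_add, map_add, hx, hy]
  | hmul x a ha => rw [revLin_mul, revLin_mul, revLin_ι, revLin_ι, ha]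

variable (k V) in
/-- The linear involution of `T(V)` which reverses words. -/
def rev : TensorAlgebra k V ≃ₗ[k] TensorAlgebra k V :=
  LinearEquiv.ofInvolutive (revLin k V) revLin_revLin

theorem rev_mul (x y : TensorAlgebra k V) : rev k V (x * y) = rev k V y * rev k V x :=
  revLin_mul x y

theorem rev_rev (x : TensorAlgebra k V) : rev k V (rev k V x) = x := revLin_revLin x

theorem algebraMapInv_rev (x : TensorAlgebra k V) :
    TensorAlgebra.algebraMapInv (rev k V x) = (TensorAlgebra.algebraMapInv x : k) := by
  induction x using word_induction with
  | h0 r => exact congrArg _ (revLin_algebraMap r)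
  | hadd x y hx hy => rw [map_add, map_add, map_add, hx, hy]
  | hmul x a ha =>
    have : rev k V (TensorAlgebra.ι k x) = TensorAlgebra.ι k x := revLin_ι x
    rw [rev_mul, map_mul, map_mul, this, algebraMapInv_ι, mul_zero, zero_mul]

/-- The image of a subspace under reversal of words. -/
def revSub (X : Submodule k (TensorAlgebra k V)) : Submodule k (TensorAlgebra k V) :=
  X.map (rev k V).toLinearMap

theorem rev_mem_revSub {X : Submodule k (TensorAlgebra k V)} {x : TensorAlgebra k V} :
    rev k V x ∈ revSub X ↔ x ∈ X :=
  ⟨fun ⟨_, hy, h⟩ => (rev k V).injective h ▸ hy, fun h => ⟨x, h, rfl⟩⟩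

theorem mem_revSub {X : Submodule k (TensorAlgebra k V)} {x : TensorAlgebra k V} :
    x ∈ revSub X ↔ rev k V x ∈ X := by
  rw [← rev_mem_revSub (X := X), rev_rev]

theorem revSub_mono {X Y : Submodule k (TensorAlgebra k V)} (h : X ≤ Y) : revSub X ≤ revSub Y :=
  Submodule.map_mono h

theorem revSub_revSub (X : Submodule k (TensorAlgebra k V)) : revSub (revSub X) = X :=
  Submodule.ext fun x => by rw [mem_revSub, rev_mem_revSub]

theorem revSub_mul (X Y : Submodule k (TensorAlgebra k V)) :
    revSub (X * Y) = revSub Y * revSub X := by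
  have h : ∀ X Y : Submodule k (TensorAlgebra k V), revSub (X * Y) ≤ revSub Y * revSub X :=
    fun X Y => Submodule.map_le_iff_le_comap.2 <| Submodule.mul_le.2 fun x hx y hy => by
      rw [Submodule.mem_comap]
      change rev k V (x * y) ∈ _
      rw [rev_mul]
      exact Submodule.mul_mem_mul (rev_mem_revSub.2 hy) (rev_mem_revSub.2 hx)
  refine le_antisymm (h X Y) ?_
  have h1 := revSub_mono (h (revSub Y) (revSub X))
  rwa [revSub_revSub, revSub_revSub, revSub_revSub] at h1

theorem revSub_inf (X Y : Submodule k (TensorAlgebra k V)) :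
    revSub (X ⊓ Y) = revSub X ⊓ revSub Y :=
  Submodule.ext fun x => by simp only [mem_revSub, Submodule.mem_inf]

theorem revSub_sup (X Y : Submodule k (TensorAlgebra k V)) :
    revSub (X ⊔ Y) = revSub X ⊔ revSub Y := Submodule.map_sup _ _ _

theorem revSub_iSup {α : Sort*} (X : α → Submodule k (TensorAlgebra k V)) :
    revSub (⨆ a, X a) = ⨆ a, revSub (X a) := Submodule.map_iSup _ _

theorem revSub_top : revSub (⊤ : Submodule k (TensorAlgebra k V)) = ⊤ :=
  Submodule.ext fun x => by simp [mem_revSub]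

theorem revSub_bot : revSub (⊥ : Submodule k (TensorAlgebra k V)) = ⊥ := Submodule.map_bot _

theorem revSub_augSub : revSub (augSub k V) = augSub k V :=
  Submodule.ext fun x => by rw [mem_revSub, mem_augSub, mem_augSub, algebraMapInv_rev]

theorem revSub_word_one : revSub (word k V 1) = word k V 1 := by
  have h : revSub (word k V 1) ≤ word k V 1 := by
    rw [word, pow_one, revSub, Submodule.map_le_iff_le_comap]
    rintro _ ⟨x, rfl⟩
    exact ⟨x, (revLin_ι x).symm⟩
  refine le_antisymm h ?_
  have h1 := revSub_mono h
  rwa [revSub_revSub] at h1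

theorem revSub_word (n : ℕ) : revSub (word k V n) = word k V n := by
  induction n with
  | zero =>
    have h : revSub (word k V 0) ≤ word k V 0 := by
      rw [word_zero, revSub, Submodule.map_le_iff_le_comap]
      intro x hx
      obtain ⟨r, rfl⟩ := Submodule.mem_one.1 hx
      exact Submodule.mem_one.2 ⟨r, (revLin_algebraMap r).symm⟩
    refine le_antisymm h ?_
    have h1 := revSub_mono h
    rwa [revSub_revSub] at h1
  | succ n ih => rw [word_add, revSub_mul, ih, revSub_word_one, ← word_add, add_comm, word_add]

theorem revSub_wordZ (n : ℤ) : revSub (wordZ k V n) = wordZ k V n := by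
  rw [wordZ]
  split_ifs
  · exact revSub_word _
  · exact revSub_bot

theorem rev_mem_word {n : ℕ} {x : TensorAlgebra k V} : rev k V x ∈ word k V n ↔ x ∈ word k V n := by
  rw [← mem_revSub, revSub_word]

theorem p_rev (n : ℕ) (x : TensorAlgebra k V) :
    (wordGrading k V).p n (rev k V x) = rev k V ((wordGrading k V).p n x) := by
  induction x using (wordGrading k V).induction with
  | h0 => simp
  | hadd x y hx hy => simp only [map_add, hx, hy]
  | hG m x hx =>
    have hx' : rev k V x ∈ (wordGrading k V).G m := rev_mem_word.2 hx
    by_cases hmn : m = n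
    · subst hmn
      rw [(wordGrading k V).p_same m x hx, (wordGrading k V).p_same m _ hx']
    · rw [(wordGrading k V).p_ne m n hmn x hx, (wordGrading k V).p_ne m n hmn _ hx', map_zero]

theorem cut_rev {a b n : ℕ} (h : a + b = n) {x : TensorAlgebra k V} (hx : x ∈ word k V n) :
    cut k V b (rev k V x) = TensorProduct.comm k _ _
      (TensorProduct.map (rev k V).toLinearMap (rev k V).toLinearMap (cut k V a x)) := by
  rw [← h, word_add] at hx
  refine Submodule.mul_induction_on hx (fun y hy z hz => ?_) fun y z hy hz => ?_
  · rw [cut_mul hy, rev_mul, cut_mul (rev_mem_word.2 hz)]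
    rfl
  · simp only [map_add, hy, hz]

end reversal

namespace Relations

variable {k : Type u} {V : Type v} [Field k] [AddCommGroup V] [Module k V] (D : Relations k V)

theorem word_mul_revSub_mul_word (a b : ℕ) (X : Submodule k (TensorAlgebra k V)) :
    word k V a * revSub X * word k V b = revSub (word k V b * X * word k V a) := by
  rw [revSub_mul, revSub_mul, revSub_word, revSub_word, mul_assoc]

/-- The relations of the opposite algebra, obtained by reversing words. -/
def op : Relations k V where
  S := D.S
  two_le := D.two_le
  R s := revSub (D.R s)
  le_word s hs := (revSub_mono (D.le_word s hs)).trans_eq (revSub_word s)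
  minimal s hs := by
    have h : (⨆ t ∈ D.S, ⨆ (_ : t < s), ⨆ j ∈ Finset.range (s - t + 1),
        word k V j * revSub (D.R t) * word k V (s - t - j)) ≤ revSub (D.relLT s s) := by
      refine iSup₂_le fun t ht => iSup_le fun hts => iSup₂_le fun j hj => ?_
      rw [Finset.mem_range] at hj
      rw [word_mul_revSub_mul_word]
      exact revSub_mono (D.word_mul_R_mul_word_le_relLT ht hts (by omega))
    refine Disjoint.mono_right h (Submodule.disjoint_def.2 fun x hx hx' => ?_)
    rw [mem_revSub] at hx hx'
    exact (rev k V).map_eq_zero_iff.1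
      (Submodule.disjoint_def.1 (D.disjoint_relLT hs) _ hx hx')

theorem idealSub_op : D.op.idealSub = revSub D.idealSub := by
  rw [idealSub, idealSub, revSub_mul, revSub_mul, revSub_top, mul_assoc]
  simp only [revSub_iSup]
  rfl

/-! #### The symmetry of Govorov's description -/

theorem L_even (m : ℕ) : D.L (2 * m) = D.idealSub ^ m * ⊤ := by
  induction m with
  | zero => rw [pow_zero, one_mul]; rfl
  | succ m ih => rw [mul_add, mul_one, L, ih, pow_succ', mul_assoc]

theorem L_odd (m : ℕ) : D.L (2 * m + 1) = D.idealSub ^ m * augSub k V := by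
  induction m with
  | zero => rw [pow_zero, one_mul]; rfl
  | succ m ih => rw [show 2 * (m + 1) + 1 = 2 * m + 1 + 2 by ring, L, ih, pow_succ', mul_assoc]

theorem idealSub_pow_mul_top (m : ℕ) : D.idealSub ^ m * ⊤ = ⊤ * D.idealSub ^ m :=
  Commute.pow_left (D.idealSub_mul_top.trans D.top_mul_idealSub.symm) m

theorem revSub_idealSub_pow (m : ℕ) : revSub (D.idealSub ^ m) = D.op.idealSub ^ m := by
  induction m with
  | zero =>
    have := revSub_word (k := k) (V := V) 0
    rwa [word_zero] at this
  | succ m ih => rw [pow_succ, revSub_mul, ih, ← idealSub_op, ← pow_succ']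

theorem revSub_L_even (m : ℕ) : revSub (D.L (2 * m)) = D.op.L (2 * m) := by
  rw [L_even, L_even, revSub_mul, revSub_top, revSub_idealSub_pow, idealSub_pow_mul_top]

theorem revSub_L_odd (m : ℕ) : revSub (D.L (2 * m + 1)) = augSub k V * D.op.L (2 * m) := by
  rw [L_odd, L_even, revSub_mul, revSub_augSub, revSub_idealSub_pow, idealSub_pow_mul_top,
    ← mul_assoc, augSub_mul_top]

theorem revSub_augSub_mul_L_even (m : ℕ) :
    revSub (augSub k V * D.L (2 * m)) = D.op.L (2 * m + 1) := by
  rw [L_odd, L_even, revSub_mul, revSub_mul, revSub_top, revSub_augSub, revSub_idealSub_pow,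
    ← idealSub_pow_mul_top, mul_assoc, top_mul_augSub]

theorem revSub_augSub_mul_L_odd (m : ℕ) :
    revSub (augSub k V * D.L (2 * m + 1)) = augSub k V * D.op.L (2 * m + 1) := by
  rw [revSub_mul, revSub_L_odd, revSub_augSub, L_odd, L_even, mul_assoc, mul_assoc, top_mul_augSub]

/-- Reversal fixes `I^m` and `T_+ I^m T_+` up to passing to the opposite relations, and exchanges
`I^m T_+` with `T_+ I^m`. Hence for even `i` it interchanges the two intersected ideals, and for odd
`i` it preserves each of them. -/
theorem revSub_govZ (i : ℕ) (n : ℤ) : revSub (D.govZ i n) = D.op.govZ i n := by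
  rw [govZ, govZ, revSub_inf, revSub_inf, revSub_wordZ]
  congr 1
  obtain ⟨m, rfl | rfl⟩ := i.even_or_odd'
  · rw [revSub_L_odd, revSub_augSub_mul_L_even, inf_comm]
  · rw [show 2 * m + 1 + 1 = 2 * (m + 1) by ring, revSub_L_even, revSub_augSub_mul_L_odd]

theorem revSub_govB (i : ℕ) : revSub (D.govB i) = D.op.govB i := by
  rw [govB, govB, revSub_sup]
  obtain ⟨m, rfl | rfl⟩ := i.even_or_odd'
  · rw [show 2 * m + 2 = 2 * (m + 1) by ring, revSub_L_even, revSub_augSub_mul_L_odd]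
  · rw [show 2 * m + 1 + 1 = 2 * (m + 1) by ring, show 2 * m + 1 + 2 = 2 * (m + 1) + 1 by ring,
      revSub_L_odd, revSub_augSub_mul_L_even, sup_comm]

theorem nonempty_gov_equiv_op (i : ℕ) (n : ℤ) :
    Nonempty (Subquotient (D.govZ i n) (D.govB i) ≃ₗ[k]
      Subquotient (D.op.govZ i n) (D.op.govB i)) := by
  rw [← revSub_govZ, ← revSub_govB]
  refine nonempty_subquotient_equiv (rev k V).toLinearMap (fun z hz => rev_mem_revSub.2 hz)
    (fun z hz => ⟨rev k V z, mem_revSub.1 hz, ?_⟩) fun z _ => rev_mem_revSub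
  have : z - (rev k V).toLinearMap (rev k V z) = 0 := sub_eq_zero.2 (rev_rev z).symm
  rw [this]
  exact zero_mem _

/-- The two resolutions live over different algebras and cannot be compared by chain maps; Govorov's
subquotients of the common `T(V)` are compared instead. -/
theorem nonempty_extDeg_equiv_op (Q : GradedProjRes.{u, v, w} D)
    (Q' : GradedProjRes.{u, v, w'} D.op) (i : ℕ) (n : ℤ) :
    Nonempty (Q.ExtDeg i n ≃ₗ[k] Q'.ExtDeg i n) := by
  cases i with
  | zero =>
    obtain ⟨e⟩ := Q.extDeg_zero_eq n
    obtain ⟨e'⟩ := Q'.extDeg_zero_eq n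
    exact ⟨e.trans e'.symm⟩
  | succ i =>
    obtain ⟨e⟩ := Q.nonempty_extDeg_succ_equiv_dual i n
    obtain ⟨e'⟩ := Q'.nonempty_extDeg_succ_equiv_dual i n
    obtain ⟨e''⟩ := D.nonempty_gov_equiv_op i (-n)
    exact ⟨e.trans (e''.symm.dualMap.trans e'.symm)⟩

/-! #### The symmetry of the spaces `J_i` -/

theorem Js_op (s i : ℕ) : D.op.Js s i = revSub (D.Js s i) := by
  have h : ∀ D : Relations k V, revSub (D.Js s i) ≤ D.op.Js s i := fun D => by
    refine le_iInf₂ fun j hj => ?_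
    rw [Finset.mem_range] at hj
    have h1 : nn s i - s - (nn s i - s - j) = j := by omega
    -- The relation at position `j` counted from one end is at position `n_s(i) - s - j` counted
    -- from the other.
    refine (revSub_mono (iInf₂_le (nn s i - s - j) (Finset.mem_range.2 (by omega)))).trans_eq ?_
    rw [h1, ← word_mul_revSub_mul_word]
    rfl
  refine le_antisymm ?_ (h D)
  have h1 := revSub_mono (h D.op)
  have h2 : D.op.op.Js s i = D.Js s i := by
    simp only [Js, op, revSub_revSub]
  rwa [revSub_revSub, h2] at h1

theorem J_op (i : ℕ) : D.op.J i = revSub (D.J i) := by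
  rw [J, J]
  split_ifs
  · exact (revSub_word i).symm
  · simp only [revSub_iSup, Js_op]
    rfl

theorem Jdeg_op (i : ℕ) (n : ℤ) : D.op.Jdeg i n = revSub (D.Jdeg i n) := by
  rw [Jdeg, Jdeg, J_op, revSub_inf, revSub_wordZ]

theorem nonempty_JdualDeg_equiv_op (i : ℕ) (n : ℤ) :
    Nonempty (D.JdualDeg i n ≃ₗ[k] D.op.JdualDeg i n) := by
  change Nonempty (Module.Dual k (D.Jdeg i (-n)) ≃ₗ[k] Module.Dual k (D.op.Jdeg i (-n)))
  rw [Jdeg_op]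
  exact ⟨((rev k V).submoduleMap (D.Jdeg i (-n))).symm.dualMap⟩

/-! #### The symmetry of the multi-Koszul complexes -/

theorem exists_algRev : ∃ e : D.Alg ≃ₗ[k] D.op.Alg, ∀ x, e (D.π x) = D.op.π (rev k V x) := by
  let g : TensorAlgebra k V →ₗ[k] D.op.Alg := D.op.π.toLinearMap.comp (rev k V).toLinearMap
  have hg : Function.Surjective g := D.op.π_surjective.comp (rev k V).surjective
  have hker : LinearMap.ker D.π.toLinearMap = LinearMap.ker g := by
    ext x
    refine D.π_eq_zero_iff.trans (Iff.trans ?_ D.op.π_eq_zero_iff.symm)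
    rw [idealSub_op]
    exact rev_mem_revSub.symm
  refine ⟨((D.π.toLinearMap.quotKerEquivOfSurjective D.π_surjective).symm.trans
    (Submodule.quotEquivOfEq _ _ hker)).trans (g.quotKerEquivOfSurjective hg), fun x => ?_⟩
  have : (D.π.toLinearMap.quotKerEquivOfSurjective D.π_surjective).symm (D.π x) =
      Submodule.Quotient.mk x := by
    rw [LinearEquiv.symm_apply_eq]
    rfl
  rw [LinearEquiv.trans_apply, LinearEquiv.trans_apply, this]
  rfl

/-- The anti-isomorphism from `A` to the opposite algebra. -/
def algRev : D.Alg ≃ₗ[k] D.op.Alg := D.exists_algRev.choose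

theorem algRev_π (x : TensorAlgebra k V) : D.algRev (D.π x) = D.op.π (rev k V x) :=
  D.exists_algRev.choose_spec x

theorem algRev_mul (a b : D.Alg) : D.algRev (a * b) = D.algRev b * D.algRev a := by
  obtain ⟨x, rfl⟩ := D.π_surjective a
  obtain ⟨y, rfl⟩ := D.π_surjective b
  rw [← map_mul, algRev_π, algRev_π, algRev_π, rev_mul, map_mul]

theorem ε_algRev (a : D.Alg) : D.op.ε (D.algRev a) = D.ε a := by
  obtain ⟨x, rfl⟩ := D.π_surjective a
  rw [algRev_π, ε_π, ε_π, algebraMapInv_rev]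

/-- The identification of `T(V) ⊗ A` with `A' ⊗ T(V)`, where `A'` is the opposite algebra. -/
def totRev : TensorAlgebra k V ⊗[k] D.Alg ≃ₗ[k] D.op.Alg ⊗[k] TensorAlgebra k V :=
  (TensorProduct.congr (rev k V) D.algRev).trans (TensorProduct.comm k _ _)

theorem totRev_tmul (w : TensorAlgebra k V) (a : D.Alg) :
    D.totRev (w ⊗ₜ a) = D.algRev a ⊗ₜ rev k V w := rfl

theorem KRight_le {i : ℕ} {N : Submodule k (TensorAlgebra k V ⊗[k] D.Alg)}
    (h : ∀ j ∈ D.J i, ∀ a, j ⊗ₜ a ∈ N) : D.KRight i ≤ N := by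
  rintro _ ⟨x, rfl⟩
  induction x using TensorProduct.induction_on with
  | zero => rw [map_zero]; exact zero_mem _
  | tmul j a => exact h j j.2 a
  | add x y hx hy => rw [map_add]; exact add_mem hx hy

theorem map_KRight (i : ℕ) : (D.KRight i).map D.totRev.toLinearMap = D.op.KLeft i := by
  apply le_antisymm
  · rw [Submodule.map_le_iff_le_comap]
    refine D.KRight_le fun j hj a => D.op.tmul_mem_KLeft (D.algRev a) ?_
    rw [J_op]
    exact rev_mem_revSub.2 hj
  · rw [KLeft_eq]
    refine Submodule.map₂_le.2 fun a _ j hj => ?_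
    rw [J_op, mem_revSub] at hj
    refine ⟨rev k V j ⊗ₜ D.algRev.symm a, ⟨⟨_, hj⟩ ⊗ₜ D.algRev.symm a, rfl⟩, ?_⟩
    change D.algRev (D.algRev.symm a) ⊗ₜ rev k V (rev k V j) = a ⊗ₜ j
    rw [rev_rev, LinearEquiv.apply_symm_apply]

theorem augLeft_totRev (x : TensorAlgebra k V ⊗[k] D.Alg) :
    D.op.augLeft (D.totRev x) = D.augRight x := by
  induction x using TensorProduct.induction_on with
  | zero => rw [map_zero, map_zero, map_zero]
  | tmul w a =>
    rw [totRev_tmul, augLeft_tmul, ε_algRev, algebraMapInv_rev, mul_comm]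
    rfl
  | add x y hx hy => rw [map_add, map_add, map_add, hx, hy]

/-- Cutting off the first letters of the reversed word is cutting off as many last letters of the
original one. For `i = 0` the cuts are at the fixed positions `1` and `0`, with no projection to a
given length, so they correspond only for words of length `1`. -/
theorem cutLeft_rev {i : ℕ} {w : TensorAlgebra k V} (hw : i = 0 → w ∈ word k V 1) :
    D.op.cutLeft (i + 1) (rev k V w) = TensorProduct.comm k _ _
      (TensorProduct.map (rev k V).toLinearMap (rev k V).toLinearMap (D.cutRight (i + 1) w)) := by
  rcases Nat.eq_zero_or_pos i with rfl | hi
  · rw [zero_add, cutLeft_one, cutRight, if_pos rfl, cut_rev (zero_add 1) (hw rfl)]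
  · rw [cutLeft, cutRight, if_neg (by omega), if_neg (by omega), LinearMap.sum_apply,
      LinearMap.sum_apply, map_sum, map_sum]
    refine Finset.sum_congr rfl fun s hs => ?_
    have hlt := nn_lt_nn_succ (D.two_le s hs) i
    rw [LinearMap.comp_apply, LinearMap.comp_apply]
    have hp := p_rev (k := k) (V := V) (nn s (i + 1)) w
    refine (congrArg (cut k V _) hp).trans ?_
    refine cut_rev (n := nn s (i + 1)) ?_ ((wordGrading k V).p_mem _ w)
    rw [Nat.add_sub_cancel]
    omega

theorem lTensor_mul'_assoc_tmul (z : TensorAlgebra k V ⊗[k] TensorAlgebra k V) (a : D.Alg) :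
    D.totRev ((LinearMap.mul' k D.Alg).lTensor (TensorAlgebra k V)
      (TensorProduct.assoc k (TensorAlgebra k V) D.Alg D.Alg
        (D.π.toLinearMap.lTensor (TensorAlgebra k V) z ⊗ₜ a))) =
      D.algRev a • D.op.π.toLinearMap.rTensor (TensorAlgebra k V) (TensorProduct.comm k _ _
        (TensorProduct.map (rev k V).toLinearMap (rev k V).toLinearMap z)) := by
  induction z using TensorProduct.induction_on with
  | zero => rw [map_zero, map_zero, map_zero, map_zero, smul_zero, TensorProduct.zero_tmul,
      map_zero, map_zero, map_zero]
  | tmul x y =>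
    change D.algRev (D.π y * a) ⊗ₜ rev k V x = (D.algRev a * D.op.π (rev k V y)) ⊗ₜ rev k V x
    rw [algRev_mul, algRev_π]
  | add x y hx hy =>
    rw [map_add, map_add, map_add, map_add, smul_add, ← hx, ← hy, TensorProduct.add_tmul,
      map_add, map_add, map_add]

theorem δLeft_totRev {i : ℕ} {x : TensorAlgebra k V ⊗[k] D.Alg} (hx : x ∈ D.KRight (i + 1)) :
    D.op.δLeft (i + 1) (D.totRev x) = D.totRev (D.δRight (i + 1) x) := by
  refine (D.KRight_le fun j hj a => ?_ : _ ≤ LinearMap.eqLocus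
    ((D.op.δLeft (i + 1)).comp D.totRev.toLinearMap)
    (D.totRev.toLinearMap.comp (D.δRight (i + 1)))) hx
  have hj1 : i = 0 → j ∈ word k V 1 := by
    rintro rfl
    exact hj
  change D.op.δLeft (i + 1) (D.algRev a ⊗ₜ rev k V j) = D.totRev (D.δRight (i + 1) (j ⊗ₜ a))
  rw [δLeft_tmul_eq, D.cutLeft_rev hj1, ← lTensor_mul'_assoc_tmul]
  rfl

/-- `totRev` is a linear bijection that carries the augmented right complex onto the augmented left
complex of the opposite relations, so each exactness condition passes through images and kernels. -/
theorem isRightMultiKoszul_iff_op : D.IsRightMultiKoszul ↔ D.op.IsLeftMultiKoszul := by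
  have haug : (D.op.KLeft 0).map D.op.augLeft = (D.KRight 0).map D.augRight := by
    rw [← map_KRight, ← Submodule.map_comp]
    congr 1
    exact LinearMap.ext D.augLeft_totRev
  have hmap : ∀ i, (D.op.KLeft (i + 1)).map (D.op.δLeft (i + 1)) =
      ((D.KRight (i + 1)).map (D.δRight (i + 1))).map D.totRev.toLinearMap := fun i => by
    rw [← map_KRight]
    ext y
    constructor
    · rintro ⟨_, ⟨x, hx, rfl⟩, rfl⟩
      exact ⟨_, ⟨x, hx, rfl⟩, (D.δLeft_totRev hx).symm⟩
    · rintro ⟨_, ⟨x, hx, rfl⟩, rfl⟩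
      exact ⟨_, ⟨x, hx, rfl⟩, D.δLeft_totRev hx⟩
  have hker0 : D.op.KLeft 0 ⊓ LinearMap.ker D.op.augLeft =
      (D.KRight 0 ⊓ LinearMap.ker D.augRight).map D.totRev.toLinearMap := by
    rw [← map_KRight]
    ext y
    constructor
    · rintro ⟨⟨x, hx, rfl⟩, hy⟩
      exact ⟨x, ⟨hx, (D.augLeft_totRev x).symm.trans hy⟩, rfl⟩
    · rintro ⟨x, ⟨hx, hy⟩, rfl⟩
      exact ⟨⟨x, hx, rfl⟩, (D.augLeft_totRev x).trans hy⟩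
  have hker : ∀ i, D.op.KLeft (i + 1) ⊓ LinearMap.ker (D.op.δLeft (i + 1)) =
      (D.KRight (i + 1) ⊓ LinearMap.ker (D.δRight (i + 1))).map D.totRev.toLinearMap := fun i => by
    rw [← map_KRight]
    ext y
    constructor
    · rintro ⟨⟨x, hx, rfl⟩, hy⟩
      exact ⟨x, ⟨hx, D.totRev.map_eq_zero_iff.1 ((D.δLeft_totRev hx).symm.trans hy)⟩, rfl⟩
    · rintro ⟨x, ⟨hx, hy⟩, rfl⟩
      exact ⟨⟨x, hx, rfl⟩, (D.δLeft_totRev hx).trans (D.totRev.map_eq_zero_iff.2 hy)⟩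
  have hinj := Submodule.map_injective_of_injective (f := D.totRev.toLinearMap) D.totRev.injective
  constructor
  · rintro ⟨h, h0, h1⟩
    refine ⟨haug.trans h, ?_, fun i => ?_⟩
    · rw [hmap 0, hker0, h0]
    · rw [hmap (i + 1), hker, h1 i]
  · rintro ⟨h, h0, h1⟩
    refine ⟨haug.symm.trans h, hinj ?_, fun i => hinj ?_⟩
    · rw [← hmap 0, ← hker0, h0]
    · rw [← hmap (i + 1), ← hker, h1 i]

/-- The left criterion is applied to the opposite relations with their Gruenberg resolution; both
sides of the Ext condition are then carried back to `D` by reversal, whatever resolution `Q` was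
chosen. -/
theorem isRightMultiKoszul_iff_ext [FiniteDimensional k V] (Q : GradedProjRes.{u, v, w} D) :
    D.IsRightMultiKoszul ↔ ∀ (i : ℕ) (n : ℤ), Nonempty (Q.ExtDeg i n ≃ₗ[k] D.JdualDeg i n) := by
  rw [isRightMultiKoszul_iff_op, D.op.isLeftMultiKoszul_iff_ext D.op.gruenberg]
  refine forall₂_congr fun i n => ?_
  obtain ⟨e⟩ := D.nonempty_extDeg_equiv_op Q D.op.gruenberg i n
  obtain ⟨e'⟩ := D.nonempty_JdualDeg_equiv_op i n
  exact ⟨fun ⟨f⟩ => ⟨e.trans (f.trans e'.symm)⟩, fun ⟨f⟩ => ⟨e.symm.trans (f.trans e')⟩⟩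

end Relations

end MultiKoszul

end

theorem mainTheorem10 {k : Type u} {V : Type v} [Field k] [AddCommGroup V] [Module k V]
    [FiniteDimensional k V] (D : MultiKoszul.Relations k V) :
    Nonempty (MultiKoszul.Relations.GradedProjRes.{u, v, max u v} D) ∧
      ∀ Q : MultiKoszul.Relations.GradedProjRes.{u, v, w} D,
        (D.IsLeftMultiKoszul ↔
          ∀ (i : ℕ) (n : ℤ), Nonempty (Q.ExtDeg i n ≃ₗ[k] D.JdualDeg i n)) ∧
        (D.IsRightMultiKoszul ↔
          ∀ (i : ℕ) (n : ℤ), Nonempty (Q.ExtDeg i n ≃ₗ[k] D.JdualDeg i n)) :=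
  ⟨⟨D.gruenberg⟩, fun Q => ⟨D.isLeftMultiKoszul_iff_ext Q, D.isRightMultiKoszul_iff_ext Q⟩⟩
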